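/- **Setting.** Let $d\in\mathbb N$, $p\in(2,3)$, $q\ge p$ with $\frac2p+\frac1q>1$, and $\frac1r=\frac1p+\frac1q$. Write $X_{s,t}=X_t-X_s$ for increments, and $\|\cdot\|_{p,[s,t]}$ for the $p$-variation of a path or of a two-parameter function. *Price path.* Let $S:[0,\infty)\to(0,\infty)^d$ be a continuous path, and let $(\mathcal P^n)_{n\in\mathbb N}$, $\mathcal P^n=\{0=t^n_0<t^n_1<\cdots\}$, $t^n_k\to\infty$, be partitions of $[0,\infty)$ with mesh size vanishing on compacts, such that for every $T>0$ the path $S|_{[0,T]}$ has Property (RIE) with respect to the partitions $(\mathcal P^n\cup\{T\})\cap[0,T]$. That is, writing $\{t^n_k\}$ also for the points of these restricted partitions, the sums $I^n_t=\sum_k S_{t^n_k}\otimes S_{t^n_k\wedge t,\,t^n_{k+1}\wedge t}$ converge uniformly in $t\in[0,T]$ to a limit $\int_0^tS_u\otimes \mathrm dS_u$, and there is a control function $c$ (nonnegative and superadditive) with $$\sup_{0\le s\le t\le T}\frac{|S_{s,t}|^p}{c(s,t)}+\sup_n\sup_{k<\ell}\frac{\big|I^n_{t^n_k,t^n_\ell}-S_{t^n_k}\otimes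 S_{t^n_k,t^n_\ell}\big|^{p/2}}{c(t^n_k,t^n_\ell)}\le1\qquad(\tfrac00:=0).$$ Put $\mathbb S_{s,t}=\int_s^tS_u\otimes \mathrm dS_u-S_s\otimes S_{s,t}$ and $\mathbf S=(S,\mathbb S)$. The bracket of a rough path $\mathbf X=(X,\mathbb X)$ is $[\mathbf X]_t=X_{0,t}\otimes X_{0,t}-2\,\mathrm{Sym}(\mathbb X_{0,t})$. *Controlled paths and integrals.* A pair $(Y,Y')$ of continuous paths on $[0,T]$ with values in $\mathbb R^d$ and $\mathbb R^{d\times d}$ is $S$-controlled if $\|Y'\|_{q,[0,T]}<\infty$ and $R_{s,t}=Y_{s,t}-Y'_sS_{s,t}$ has $\|R\|_{r,[0,T]}<\infty$. For $S$-controlled paths, $\int_0^T Y\,\mathrm d\mathbf S=\lim\sum_{[s,t]}(Y_sS_{s,t}+Y'_s\mathbb S_{s,t})$ and $\int_0^T Y\otimes \mathrm dZ=\lim\sum_{[s,t]}(Y_s\otimes Z_{s,t}+Y'_sZ'_s\mathbb S_{s,t})$ as the mesh size of the partition of $[0,T]$ tends to zero (and similarly on $[s,t]$). A portfolio is a path $\pi:[0,\infty)\to\{x\in\mathbb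 R^d:\sum_ix^i=1\}$ that on each $[0,T]$ is the first component of an $S$-controlled path. Its wealth is $$W^\pi_t=\exp\Big(\int_0^t\frac{\pi_s}{S_s}\,\mathrm d\mathbf S_s-\frac12\sum_{i,j=1}^d\int_0^t\frac{\pi^i_s\pi^j_s}{S^i_sS^j_s}\,\mathrm d[\mathbf S]^{ij}_s\Big).$$ The market portfolio is $\mu^i=S^i/(S^1+\cdots+S^d)$, and $V^\pi=W^\pi/W^\mu$ is the relative wealth of $\pi$. Let $A^\mu_{s,t}=\int_s^t\mu_u\otimes \mathrm d\mu_u-\mu_s\otimes\mu_{s,t}$ be the second level of the canonical rough path lift of $\mu$, let $[\mu]$ be the bracket of $(\mu,A^\mu)$, and put $$\xi_T=\|\mu\|_{p,[0,T]}+\|A^\mu\|_{\frac p2,[0,T]}+\sum_{i=1}^d[\mu]^{ii}_T .$$ *Functionally controlled portfolios.* Let $\alpha\in(0,1]$, $K>0$, let $\overline\Delta=\{x\in\mathbb R^d:x^i\ge0,\ \sum_ix^i=1\}$, and let $C^{2+\alpha,K}$ be the set of functions $F\in C^{2+\alpha}(\overline\Delta;\mathbb R^d)$ with $\|F\|_{C^{2+\alpha}}=\max_{0\le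 n\le2}\|\mathrm D^nF\|_\infty+\|\mathrm D^2F\|_{\alpha\text{-Höl}}\le K$, with the metric $\|F-G\|_{C^2}=\max_{0\le n\le2}\|\mathrm D^nF-\mathrm D^nG\|_\infty$. (Here $\mathrm D$ is differentiation along $\overline\Delta$, and $\|\cdot\|_{\alpha\text{-Höl}}$ is the Hölder seminorm.) For $F\in C^{2+\alpha,K}$ let $$(\pi^F_t)^i=\mu^i_t\Big(F^i(\mu_t)+1-\sum_{j=1}^d\mu^j_tF^j(\mu_t)\Big),\qquad V^{*,K,\alpha}_T=\sup_{F\in C^{2+\alpha,K}}V^{\pi^F}_T .$$ Let $m$ be a Borel probability measure on $C^{2+\alpha,K}$ with full support, let $\nu$ be its image under $F\mapsto\pi^F$, and let $\pi^\nu$ be the universal portfolio $$\pi^\nu_t=\frac{\int\pi_tV^\pi_t\,\mathrm d\nu(\pi)}{\int V^\pi_t\,\mathrm d\nu(\pi)}=\frac{\int_{C^{2+\alpha,K}}\pi^F_tV^{\pi^F}_t\,\mathrm dm(F)}{\int_{C^{2+\alpha,K}}V^{\pi^F}_t\,\mathrm dm(F)} .$$ **Theorem.** Suppose that $\lim_{T\to\infty}(1+\|\mu\|_{p,[0,T]}^2)\,\xi_T=\infty$.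 Then every $\pi^F$ with $F\in C^{2+\alpha,K}$ is a portfolio, $V^{*,K,\alpha}_T$ is finite and the integrals that define $\pi^\nu_T$ exist for every $T\geq 0$, $\pi^\nu$ is a portfolio, and $$\lim_{T\to\infty}\frac{1}{(1+\|\mu\|_{p,[0,T]}^2)\,\xi_T}\Big(\log V^{*,K,\alpha}_T-\log V^{\pi^\nu}_T\Big)=0 .$$ -/

import Mathlib

open Filter Topology MeasureTheory Set
open scoped ENNReal NNReal BoundedContinuousFunction

set_option maxSynthPendingDepth 3

namespace RoughPortfolio

noncomputable section

/-! ### Vectors, matrices, `p`-variation, limits of sums along partitions -/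

/-- `ℝ^d` with the Euclidean norm. -/
abbrev Vec (d : ℕ) : Type := EuclideanSpace ℝ (Fin d)

/-- `ℝ^{d × d}` with the Euclidean (Frobenius) norm. -/
abbrev Mat (d : ℕ) : Type := EuclideanSpace ℝ (Fin d × Fin d)

/-- The tensor product `[a ⊗ b]^{ij} = a^i b^j`. -/
def tensor {d : ℕ} (a b : Vec d) : Mat d := WithLp.toLp 2 fun ij => a ij.1 * b ij.2

/-- The action of a matrix, seen as a linear map of `ℝ^d`, on a vector. -/
def act {d : ℕ} (M : Mat d) (v : Vec d) : Vec d := WithLp.toLp 2 fun i => ∑ j, M (i, j) * v j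

/-- The increments `X_{s,t} = X_t - X_s` of a path. -/
def inc {G : Type*} [Sub G] (X : ℝ → G) (s t : ℝ) : G := X t - X s

/-- The `p`-variation over `[s, t]` of a two-parameter function `A` (which vanishes on the
diagonal): the supremum of `(∑ |A_{u_i, u_{i+1}}|^p)^{1/p}` over all finite nondecreasing sequences
`u_0 ≤ ⋯ ≤ u_n` in `[s, t]`. The `p`-variation of a path `X` is that of `inc X`. -/
def pVar {G : Type*} [NormedAddCommGroup G] (p : ℝ) (A : ℝ → ℝ → G) (s t : ℝ) : ℝ≥0∞ :=
  ⨆ w : ℕ × {u : ℕ → ℝ // Monotone u ∧ ∀ i, u i ∈ Icc s t},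
    (∑ i ∈ Finset.range w.1, ‖A (w.2.1 i) (w.2.1 (i + 1))‖ₑ ^ p) ^ (1 / p)

/-- `I` is the limit of `∑ Ξ_{u_i, u_{i+1}}` over the partitions `s = u_0 ≤ ⋯ ≤ u_N = t` of `[s, t]`
as the mesh size tends to zero. -/
def HasMeshLimit {G : Type*} [NormedAddCommGroup G] (Ξ : ℝ → ℝ → G) (s t : ℝ) (I : G) : Prop :=
  ∀ ε > 0, ∃ δ > 0, ∀ (N : ℕ) (u : ℕ → ℝ), u 0 = s → u N = t →
    (∀ i < N, u i ≤ u (i + 1)) → (∀ i < N, u (i + 1) - u i < δ) →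
    ‖∑ i ∈ Finset.range N, Ξ (u i) (u (i + 1)) - I‖ < ε

open Classical in
/-- The limit in `HasMeshLimit` (zero if there is none). -/
def meshLimit {G : Type*} [NormedAddCommGroup G] (Ξ : ℝ → ℝ → G) (s t : ℝ) : G :=
  if h : ∃ I, HasMeshLimit Ξ s t I then h.choose else 0

/-! ### Property (RIE) and price paths -/

/-- A control function on `{0 ≤ s ≤ t ≤ T}`. -/
def IsControl (T : ℝ) (c : ℝ → ℝ → ℝ) : Prop :=
  (∀ s t, 0 ≤ s → s ≤ t → t ≤ T → 0 ≤ c s t) ∧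
  ∀ s u t, 0 ≤ s → s ≤ u → u ≤ t → t ≤ T → c s u + c u t ≤ c s t

/-- The left-point sum `∑_k S_{u_k} ⊗ S_{u_k ∧ t, u_{k+1} ∧ t}` along the points of `u`
(for `u` tending to infinity, or eventually constant, only finitely many terms are nonzero). -/
def riemannSum {d : ℕ} (S : ℝ → Vec d) (u : ℕ → ℝ) (t : ℝ) : Mat d :=
  ∑ᶠ k, tensor (S (u k)) (inc S (min (u k) t) (min (u (k + 1)) t))

/-- Property (RIE) on `[0, T]` for the path `S` and the partitions `P n` of `[0, T]`. A partition of
`[0, T]` is given as a nondecreasing sequence of points that starts at `0` and is eventually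
constant with value `T`. (The bound `≤ 1` for the sum of the two quotients by the control function
is expressed by bounding both numerators by the control function; this amounts to replacing the
control function by twice itself.) -/
structure RIE {d : ℕ} (p T : ℝ) (S : ℝ → Vec d) (P : ℕ → ℕ → ℝ) : Prop where
  continuousOn : ContinuousOn S (Icc 0 T)
  start : ∀ n, P n 0 = 0
  mono : ∀ n, Monotone (P n)
  final : ∀ n, ∀ᶠ k in atTop, P n k = T
  mesh : ∀ ε > 0, ∀ᶠ n in atTop, ∀ k, P n (k + 1) - P n k < ε
  converges : ∃ I : ℝ → Mat d,
    TendstoUniformlyOn (fun n t => riemannSum S (P n) t) I atTop (Icc 0 T)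
  control : ∃ c : ℝ → ℝ → ℝ, IsControl T c ∧
    (∀ s t, 0 ≤ s → s ≤ t → t ≤ T → ‖inc S s t‖ ^ p ≤ c s t) ∧
    ∀ n k l, k < l →
      ‖riemannSum S (P n) (P n l) - riemannSum S (P n) (P n k)
        - tensor (S (P n k)) (inc S (P n k) (P n l))‖ ^ (p / 2) ≤ c (P n k) (P n l)

/-- `u` enumerates a partition of `[0, ∞)`. -/
structure IsPartition (u : ℕ → ℝ) : Prop where
  start : u 0 = 0
  strictMono : StrictMono u
  tendsto : Tendsto u atTop atTop

/-- `S` is a price path, with associated sequence `P` of partitions of `[0, ∞)`: it is continuous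
with strictly positive coordinates on `[0, ∞)`, and on each `[0, T]` it has Property (RIE) for the
restricted partitions `(P n ∪ {T}) ∩ [0, T]`. -/
structure IsPricePath {d : ℕ} (p : ℝ) (S : ℝ → Vec d) (P : ℕ → ℕ → ℝ) : Prop where
  continuousOn : ContinuousOn S (Ici 0)
  pos : ∀ t, 0 ≤ t → ∀ i, 0 < S t i
  partition : ∀ n, IsPartition (P n)
  rie : ∀ T > 0, RIE p T S (fun n k => min (P n k) T)

/-! ### The rough path of a price path, controlled paths, brackets -/

/-- `∫_0^t S ⊗ dS`, the limit of the left-point sums along the given partitions. -/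
def pathIntegral {d : ℕ} (S : ℝ → Vec d) (P : ℕ → ℕ → ℝ) (t : ℝ) : Mat d :=
  limUnder atTop fun n => riemannSum S (P n) t

/-- The second level `𝕊_{s,t} = ∫_s^t S ⊗ dS - S_s ⊗ S_{s,t}` of the rough path of `S`. -/
def secondLevel {d : ℕ} (S : ℝ → Vec d) (P : ℕ → ℕ → ℝ) (s t : ℝ) : Mat d :=
  inc (pathIntegral S P) s t - tensor (S s) (inc S s t)

/-- The `(i, j)` component of the bracket `X_{0,t} ⊗ X_{0,t} - 2 Sym(A_{0,t})` of `(X, A)`. -/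
def bracket {d : ℕ} (X : ℝ → Vec d) (A : ℝ → ℝ → Mat d) (i j : Fin d) (t : ℝ) : ℝ :=
  inc X 0 t i * inc X 0 t j - (A 0 t (i, j) + A 0 t (j, i))

/-- `(Y, Y')` is an `S`-controlled path on `[0, T]`, with `Y'` of finite `q`-variation and with a
remainder of finite `r`-variation, where `1 / r = 1 / p + 1 / q`. -/
structure IsControlled {d : ℕ} (p q T : ℝ) (S Y : ℝ → Vec d) (Y' : ℝ → Mat d) : Prop where
  continuousOn : ContinuousOn Y (Icc 0 T)
  continuousOn_deriv : ContinuousOn Y' (Icc 0 T)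
  deriv_var : pVar q (inc Y') 0 T < ⊤
  remainder_var : pVar (1 / (1 / p + 1 / q))
    (fun s t => inc Y s t - act (Y' s) (inc S s t)) 0 T < ⊤

/-- The compensated summand `Y_s S_{s,t} + Y'_s 𝕊_{s,t}` of the rough integral `∫ Y d𝐒`. As
`𝕊 = ∫ S_{s,u} ⊗ dS_u`, the second term is `∑_{i,j} (Y'_s)^{ij} 𝕊^{ji}_{s,t}`. -/
def roughGerm {d : ℕ} (S : ℝ → Vec d) (A : ℝ → ℝ → Mat d) (Y : ℝ → Vec d) (Y' : ℝ → Mat d)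
    (s t : ℝ) : ℝ :=
  ∑ i, Y s i * inc S s t i + ∑ i, ∑ j, Y' s (i, j) * A s t (j, i)

/-- The compensated summand of the integral `∫ Y ⊗ dZ` of two controlled paths, with `(i, j)`
component `Y^i_s Z^j_{s,t} + ∑_{k,l} (Y'_s)^{ik} (Z'_s)^{jl} 𝕊^{kl}_{s,t}`. -/
def tensorGerm {d : ℕ} (A : ℝ → ℝ → Mat d) (Y : ℝ → Vec d) (Y' : ℝ → Mat d)
    (Z : ℝ → Vec d) (Z' : ℝ → Mat d) (s t : ℝ) : Mat d :=
  WithLp.toLp 2 fun ij =>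
    Y s ij.1 * inc Z s t ij.2 + ∑ k, ∑ l, Y' s (ij.1, k) * Z' s (ij.2, l) * A s t (k, l)

/-- The second level `∫_s^t Z ⊗ dZ - Z_s ⊗ Z_{s,t}` of the canonical lift of a controlled path. -/
def canonicalLift {d : ℕ} (A : ℝ → ℝ → Mat d) (Z : ℝ → Vec d) (Z' : ℝ → Mat d)
    (s t : ℝ) : Mat d :=
  meshLimit (tensorGerm A Z Z' Z Z') s t - tensor (Z s) (inc Z s t)

/-! ### Portfolios, wealth, the market portfolio -/

/-- `π` is a portfolio for `S`: its coordinates sum to one, and on each `[0, T]` it is the first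
component of an `S`-controlled path. -/
def IsPortfolio {d : ℕ} (p q : ℝ) (S π : ℝ → Vec d) : Prop :=
  (∀ t, 0 ≤ t → ∑ i, π t i = 1) ∧ ∀ T > 0, ∃ π' : ℝ → Mat d, IsControlled p q T S π π'

/-- The coordinatewise quotient `π / S`. -/
def quot {d : ℕ} (S π : ℝ → Vec d) (t : ℝ) : Vec d := WithLp.toLp 2 fun i => π t i / S t i

/-- The Gubinelli derivative of `π / S`, the product of the controlled paths `(π, π')` and
`(1 / S, D(1 / S))`. -/
def quotDeriv {d : ℕ} (S π : ℝ → Vec d) (π' : ℝ → Mat d) (t : ℝ) : Mat d :=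
  WithLp.toLp 2 fun ij =>
    π' t ij / S t ij.1 - if ij.1 = ij.2 then π t ij.1 / (S t ij.1) ^ 2 else 0

open Classical in
/-- The wealth
`exp (∫_0^t (π / S) d𝐒 - 1/2 ∑_{i,j} ∫_0^t (π^i π^j) / (S^i S^j) d[𝐒]^{ij})`
of the portfolio `π` at time `t`. The rough integral is formed with some Gubinelli derivative of `π`
on `[0, t]`; under Property (RIE) it does not depend on which one. The value is `0` if
there is no Gubinelli derivative, that is, if `π` is not a portfolio. -/
def wealth {d : ℕ} (p q : ℝ) (S : ℝ → Vec d) (P : ℕ → ℕ → ℝ) (π : ℝ → Vec d) (t : ℝ) : ℝ :=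
  if h : ∃ π' : ℝ → Mat d, IsControlled p q t S π π' then
    Real.exp
      (meshLimit (roughGerm S (secondLevel S P) (quot S π) (quotDeriv S π h.choose)) 0 t
        - 1 / 2 * ∑ i, ∑ j, meshLimit (fun u v =>
            π u i * π u j / (S u i * S u j) * inc (bracket S (secondLevel S P) i j) u v) 0 t)
  else 0

/-- The market portfolio `μ^i = S^i / (S^1 + ⋯ + S^d)`. -/
def market {d : ℕ} (S : ℝ → Vec d) (t : ℝ) : Vec d :=
  WithLp.toLp 2 fun i => S t i / ∑ j, S t j

/-- The Gubinelli derivative of `μ` with respect to `S`: the Jacobian matrix at `S_t` of the map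
`x ↦ x / (x^1 + ⋯ + x^d)`. -/
def marketDeriv {d : ℕ} (S : ℝ → Vec d) (t : ℝ) : Mat d :=
  WithLp.toLp 2 fun ij =>
    (if ij.1 = ij.2 then 1 / ∑ k, S t k else 0) - S t ij.1 / (∑ k, S t k) ^ 2

/-- The second level `A^μ` of the canonical rough path lift of `μ`. -/
def marketLift {d : ℕ} (S : ℝ → Vec d) (P : ℕ → ℕ → ℝ) : ℝ → ℝ → Mat d :=
  canonicalLift (secondLevel S P) (market S) (marketDeriv S)

/-- The wealth `V^π = W^π / W^μ` of `π` relative to the market portfolio. -/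
def relWealth {d : ℕ} (p q : ℝ) (S : ℝ → Vec d) (P : ℕ → ℕ → ℝ) (π : ℝ → Vec d) (t : ℝ) : ℝ :=
  wealth p q S P π t / wealth p q S P (market S) t

/-- `ξ_T = ‖μ‖_{p,[0,T]} + ‖A^μ‖_{p/2,[0,T]} + ∑_i [μ]^{ii}_T`. -/
def xi {d : ℕ} (p : ℝ) (S : ℝ → Vec d) (P : ℕ → ℕ → ℝ) (T : ℝ) : ℝ :=
  (pVar p (inc (market S)) 0 T).toReal + (pVar (p / 2) (marketLift S P) 0 T).toReal
    + ∑ i, bracket (market S) (marketLift S P) i i T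

/-- The clock `(1 + ‖μ‖_{p,[0,T]}^2) ξ_T`. -/
def clock {d : ℕ} (p : ℝ) (S : ℝ → Vec d) (P : ℕ → ℕ → ℝ) (T : ℝ) : ℝ :=
  (1 + (pVar p (inc (market S)) 0 T).toReal ^ 2) * xi p S P T

/-! ### The ball of `C^{2+α}` on the closed simplex -/

/-- The closed unit simplex in `ℝ^d`. -/
def simplex (d : ℕ) : Set (Vec d) := {x | (∀ i, 0 ≤ x i) ∧ ∑ i, x i = 1}

/-- `f'` is the Fréchet derivative of the function `f` on the simplex. Such a derivative is
determined on the vectors tangent to the simplex only; it is extended by zero to the normal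
direction `(1, …, 1)`, which makes it unique and does not change its norm. -/
def HasSimplexFDeriv {d : ℕ} {G : Type*} [NormedAddCommGroup G] [NormedSpace ℝ G]
    (f : simplex d → G) (f' : simplex d → Vec d →L[ℝ] G) : Prop :=
  ∀ x : simplex d, f' x (WithLp.toLp 2 fun _ => 1) = 0 ∧
    (fun y : simplex d => f y - f x - f' x ((y : Vec d) - x)) =o[𝓝 x]
      fun y : simplex d => (y : Vec d) - x

/-- Triples `(F, F', F'')` of bounded continuous functions on the simplex, normed by the maximum of
the three supremum norms. -/
abbrev Jet (d : ℕ) : Type :=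
  (simplex d →ᵇ Vec d) × (simplex d →ᵇ (Vec d →L[ℝ] Vec d)) ×
    (simplex d →ᵇ (Vec d →L[ℝ] Vec d →L[ℝ] Vec d))

/-- The set of all `F` with `‖F‖_{C^{2+α}} = max_{n ≤ 2} ‖D^n F‖_∞ + ‖D^2 F‖_{α-Höl} ≤ K`. A `C^2`
function is recorded together with its first two derivatives, which it determines. -/
def holderSet (d : ℕ) (α : ℝ≥0) (K : ℝ) : Set (Jet d) :=
  {J | HasSimplexFDeriv J.1 J.2.1 ∧ HasSimplexFDeriv J.2.1 J.2.2 ∧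
    MemHolder α J.2.2 ∧ ‖J‖ + nnHolderNorm α J.2.2 ≤ K}

/-- The space `C^{2+α,K}` of functions from the closed simplex to `ℝ^d`. -/
def HolderBall (d : ℕ) (α : ℝ≥0) (K : ℝ) : Type := holderSet d α K

/-- The metric of `C^{2+α,K}` is the distance `‖F - G‖_{C^2} = max_{n ≤ 2} ‖D^n F - D^n G‖_∞`. -/
instance (d : ℕ) (α : ℝ≥0) (K : ℝ) : MetricSpace (HolderBall d α K) :=
  inferInstanceAs (MetricSpace (holderSet d α K))

instance (d : ℕ) (α : ℝ≥0) (K : ℝ) : MeasurableSpace (HolderBall d α K) := borel _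

instance (d : ℕ) (α : ℝ≥0) (K : ℝ) : BorelSpace (HolderBall d α K) := ⟨rfl⟩

open Classical in
/-- The value `F(x)` for `x` in the simplex (and zero elsewhere). -/
def HolderBall.eval {d : ℕ} {α : ℝ≥0} {K : ℝ} (F : HolderBall d α K) (x : Vec d) : Vec d :=
  if h : x ∈ simplex d then F.1.1 ⟨x, h⟩ else 0

/-! ### Functionally controlled portfolios and the universal portfolio -/

/-- The functionally controlled portfolio
`(π^F)^i = μ^i (F^i(μ) + 1 - ∑_j μ^j F^j(μ))`. -/
def controlledPortfolio {d : ℕ} {α : ℝ≥0} {K : ℝ} (S : ℝ → Vec d) (F : HolderBall d α K)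
    (t : ℝ) : Vec d :=
  WithLp.toLp 2 fun i =>
    market S t i *
      (F.eval (market S t) i + 1 - ∑ j, market S t j * F.eval (market S t) j)

/-- The relative wealth `V^{π^F}_t`. -/
def controlledWealth {d : ℕ} {α : ℝ≥0} {K : ℝ} (p q : ℝ) (S : ℝ → Vec d) (P : ℕ → ℕ → ℝ)
    (F : HolderBall d α K) (t : ℝ) : ℝ :=
  relWealth p q S P (controlledPortfolio S F) t

/-- The universal portfolio `(∫ π_t V^π_t dν(π)) / (∫ V^π_t dν(π))`, where `ν` is the image of the
measure `m` under `F ↦ π^F`; both integrals are written as integrals with respect to `m`. -/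
def universalPortfolio {d : ℕ} {α : ℝ≥0} {K : ℝ} (p q : ℝ) (S : ℝ → Vec d) (P : ℕ → ℕ → ℝ)
    (m : Measure (HolderBall d α K)) (t : ℝ) : Vec d :=
  (∫ F, controlledWealth p q S P F t ∂m)⁻¹ •
    ∫ F, controlledWealth p q S P F t • controlledPortfolio S F t ∂m

/-- The relative wealth `sup_F V^{π^F}_T` of the best retrospectively chosen portfolio. -/
def bestWealth {d : ℕ} (α : ℝ≥0) (K : ℝ) (p q : ℝ) (S : ℝ → Vec d) (P : ℕ → ℕ → ℝ)
    (T : ℝ) : ℝ :=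
  ⨆ F : HolderBall d α K, controlledWealth p q S P F T

end

end RoughPortfolio

open RoughPortfolio

namespace RoughPortfolio

/-! ### Controls and `p`-variation -/

section Variation

variable {G : Type*} [NormedAddCommGroup G]

/-- The supremum of the sums in the definition of the `p`-variation. -/
noncomputable def varSum (p : ℝ) (A : ℝ → ℝ → G) (s t : ℝ) : ℝ≥0∞ :=
  ⨆ w : ℕ × {u : ℕ → ℝ // Monotone u ∧ ∀ i, u i ∈ Icc s t},
    ∑ i ∈ Finset.range w.1, ‖A (w.2.1 i) (w.2.1 (i + 1))‖ₑ ^ p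

lemma pVar_eq_varSum {p : ℝ} (hp : 0 < p) (A : ℝ → ℝ → G) (s t : ℝ) :
    pVar p A s t = varSum p A s t ^ (1 / p) := by
  have h := (ENNReal.orderIsoRpow (1 / p) (by positivity)).map_iSup
    (fun w : ℕ × {u : ℕ → ℝ // Monotone u ∧ ∀ i, u i ∈ Icc s t} =>
      ∑ i ∈ Finset.range w.1, ‖A (w.2.1 i) (w.2.1 (i + 1))‖ₑ ^ p)
  exact h.symm

lemma varSum_mono {p : ℝ} (A : ℝ → ℝ → G) {s s' t t' : ℝ} (hs : s' ≤ s) (ht : t ≤ t') :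
    varSum p A s t ≤ varSum p A s' t' := by
  refine iSup_le fun w => ?_
  refine le_iSup_of_le ⟨w.1, w.2.1, w.2.2.1, fun i => Icc_subset_Icc hs ht (w.2.2.2 i)⟩ le_rfl

lemma varSum_superadd {p : ℝ} (A : ℝ → ℝ → G) {s u t : ℝ} (hsu : s ≤ u) (hut : u ≤ t) :
    varSum p A s u + varSum p A u t ≤ varSum p A s t := by
  have : Nonempty (ℕ × {v : ℕ → ℝ // Monotone v ∧ ∀ i, v i ∈ Icc s u}) :=
    ⟨0, fun _ => s, monotone_const, fun _ => ⟨le_rfl, hsu⟩⟩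
  have : Nonempty (ℕ × {v : ℕ → ℝ // Monotone v ∧ ∀ i, v i ∈ Icc u t}) :=
    ⟨0, fun _ => u, monotone_const, fun _ => ⟨le_rfl, hut⟩⟩
  refine ENNReal.iSup_add_iSup_le ?_
  rintro ⟨n, v, hv, hv'⟩ ⟨m, w, hw, hw'⟩
  let z : ℕ → ℝ := fun i => if i ≤ n then v i else w (i - (n + 1))
  have hz : Monotone z := by
    refine monotone_nat_of_le_succ fun i => ?_
    by_cases h1 : i + 1 ≤ n
    · simp only [z, h1, if_true, show i ≤ n by omega]
      exact hv (by omega)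
    · by_cases h2 : i ≤ n
      · simp only [z, h1, h2, if_true, if_false]
        exact (hv' i).2.trans (hw' _).1
      · simp only [z, h1, h2, if_false]
        exact hw (by omega)
  have hz' : ∀ i, z i ∈ Icc s t := by
    intro i
    by_cases h2 : i ≤ n
    · simp only [z, h2, if_true]
      exact ⟨(hv' i).1, (hv' i).2.trans hut⟩
    · simp only [z, h2, if_false]
      exact ⟨hsu.trans (hw' _).1, (hw' _).2⟩
  refine le_iSup_of_le ⟨n + 1 + m, z, hz, hz'⟩ ?_
  simp only
  rw [Finset.sum_range_add]
  refine add_le_add ?_ (le_of_eq ?_)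
  · rw [Finset.sum_range_succ]
    refine le_trans (le_of_eq ?_) le_self_add
    refine Finset.sum_congr rfl fun i hi => ?_
    have : i < n := Finset.mem_range.1 hi
    simp [z, show i ≤ n by omega, show i + 1 ≤ n by omega]
  · refine Finset.sum_congr rfl fun i _ => ?_
    have h1 : ¬ (n + 1 + i ≤ n) := by omega
    have h2 : ¬ (n + 1 + i + 1 ≤ n) := by omega
    have h3 : n + 1 + i + 1 - (n + 1) = i + 1 := by omega
    simp [z, h1, h2, h3]

lemma enorm_rpow_le_varSum {p : ℝ} (A : ℝ → ℝ → G) {s t : ℝ} (hst : s ≤ t) :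
    ‖A s t‖ₑ ^ p ≤ varSum p A s t := by
  refine le_iSup_of_le ⟨1, fun i => if i = 0 then s else t, ?_, ?_⟩ ?_
  · refine monotone_nat_of_le_succ fun i => ?_
    by_cases h : i = 0 <;> simp [h, hst]
  · intro i
    by_cases h : i = 0 <;> simp [h, hst]
  · simp

lemma varSum_lt_top {p : ℝ} (hp : 0 < p) {A : ℝ → ℝ → G} {s t : ℝ} (h : pVar p A s t < ⊤) :
    varSum p A s t < ⊤ := by
  rw [pVar_eq_varSum hp] at h
  by_contra h'
  rw [not_lt, top_le_iff] at h'
  rw [h', ENNReal.top_rpow_of_pos (by positivity)] at h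
  exact lt_irrefl _ h

/-- The control function `‖A‖_{p,[s,t]}^p`. -/
noncomputable def varControl (p : ℝ) (A : ℝ → ℝ → G) (s t : ℝ) : ℝ := (varSum p A s t).toReal

lemma varControl_eq {p : ℝ} (hp : 0 < p) (A : ℝ → ℝ → G) (s t : ℝ) :
    varControl p A s t = (pVar p A s t).toReal ^ p := by
  rw [pVar_eq_varSum hp, varControl, ← ENNReal.toReal_rpow, ← Real.rpow_mul ENNReal.toReal_nonneg,
    one_div_mul_cancel hp.ne', Real.rpow_one]

lemma varControl_rpow {p : ℝ} (hp : 0 < p) (A : ℝ → ℝ → G) (s t : ℝ) :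
    varControl p A s t ^ (1 / p) = (pVar p A s t).toReal := by
  rw [pVar_eq_varSum hp, varControl, ← ENNReal.toReal_rpow]

lemma isControl_varControl {p T : ℝ} (hp : 0 < p) {A : ℝ → ℝ → G} (h : pVar p A 0 T < ⊤) :
    IsControl T (varControl p A) := by
  have hT := varSum_lt_top hp h
  refine ⟨fun _ _ _ _ _ => ENNReal.toReal_nonneg, fun s u t hs hsu hut ht => ?_⟩
  have h1 : varSum p A s t < ⊤ := (varSum_mono A hs ht).trans_lt hT
  have h2 : varSum p A s u < ⊤ := (varSum_mono A hs (hut.trans ht)).trans_lt hT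
  have h3 : varSum p A u t < ⊤ := (varSum_mono A (hs.trans hsu) ht).trans_lt hT
  unfold varControl
  rw [← ENNReal.toReal_add h2.ne h3.ne]
  exact ENNReal.toReal_mono h1.ne (varSum_superadd A hsu hut)

lemma norm_rpow_le_varControl {p T : ℝ} (hp : 0 < p) {A : ℝ → ℝ → G} (h : pVar p A 0 T < ⊤)
    {s t : ℝ} (hs : 0 ≤ s) (hst : s ≤ t) (ht : t ≤ T) : ‖A s t‖ ^ p ≤ varControl p A s t := by
  have h1 : varSum p A s t < ⊤ := (varSum_mono A hs ht).trans_lt (varSum_lt_top hp h)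
  have := ENNReal.toReal_mono h1.ne (enorm_rpow_le_varSum (p := p) A hst)
  rwa [← ENNReal.toReal_rpow, toReal_enorm] at this

lemma norm_le_varControl {p T : ℝ} (hp : 0 < p) {A : ℝ → ℝ → G} (h : pVar p A 0 T < ⊤)
    {s t : ℝ} (hs : 0 ≤ s) (hst : s ≤ t) (ht : t ≤ T) :
    ‖A s t‖ ≤ varControl p A s t ^ (1 / p) := by
  have := Real.rpow_le_rpow (by positivity) (norm_rpow_le_varControl hp h hs hst ht)
    (by positivity : 0 ≤ 1 / p)
  rwa [← Real.rpow_mul (norm_nonneg _), mul_one_div_cancel hp.ne', Real.rpow_one] at this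

lemma IsControl.mono {T : ℝ} {c : ℝ → ℝ → ℝ} (h : IsControl T c) {s s' t t' : ℝ} (h0 : 0 ≤ s')
    (hs : s' ≤ s) (hst : s ≤ t) (ht : t ≤ t') (hT : t' ≤ T) : c s t ≤ c s' t' := by
  have h1 := h.2 s' s t' h0 hs (hst.trans ht) hT
  have h2 := h.2 s t t' (h0.trans hs) hst ht hT
  have h3 := h.1 s' s h0 hs ((hst.trans ht).trans hT)
  have h4 := h.1 t t' ((h0.trans hs).trans hst) ht hT
  linarith

lemma IsControl.add {T : ℝ} {c c' : ℝ → ℝ → ℝ} (h : IsControl T c) (h' : IsControl T c') :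
    IsControl T (fun s t => c s t + c' s t) :=
  ⟨fun s t h1 h2 h3 => add_nonneg (h.1 s t h1 h2 h3) (h'.1 s t h1 h2 h3), fun s u t h1 h2 h3 h4 => by
    linarith [h.2 s u t h1 h2 h3 h4, h'.2 s u t h1 h2 h3 h4]⟩

lemma IsControl.const_mul {T a : ℝ} (ha : 0 ≤ a) {c : ℝ → ℝ → ℝ} (h : IsControl T c) :
    IsControl T (fun s t => a * c s t) :=
  ⟨fun s t h1 h2 h3 => mul_nonneg ha (h.1 s t h1 h2 h3), fun s u t h1 h2 h3 h4 => by
    rw [← mul_add]; exact mul_le_mul_of_nonneg_left (h.2 s u t h1 h2 h3 h4) ha⟩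

lemma IsControl.restrict {T T' : ℝ} (hT : T' ≤ T) {c : ℝ → ℝ → ℝ} (h : IsControl T c) :
    IsControl T' c :=
  ⟨fun s t h1 h2 h3 => h.1 s t h1 h2 (h3.trans hT),
    fun s u t h1 h2 h3 h4 => h.2 s u t h1 h2 h3 (h4.trans hT)⟩

lemma IsControl.sum_le {T : ℝ} {c : ℝ → ℝ → ℝ} (h : IsControl T c) {u : ℕ → ℝ} {N : ℕ}
    (hu : ∀ i < N, u i ≤ u (i + 1)) (h0 : 0 ≤ u 0) (hT : u N ≤ T) :
    ∑ i ∈ Finset.range N, c (u i) (u (i + 1)) ≤ c (u 0) (u N) := by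
  have hmono : ∀ n ≤ N, u 0 ≤ u n ∧ u n ≤ u N := by
    intro n hn
    constructor
    · induction n with
      | zero => exact le_rfl
      | succ k ih => exact (ih (by omega)).trans (hu k (by omega))
    · induction hn using Nat.decreasingInduction with
      | self => exact le_rfl
      | of_succ k hk ih => exact (hu k hk).trans ih
  have : ∀ n ≤ N, ∑ i ∈ Finset.range n, c (u i) (u (i + 1)) ≤ c (u 0) (u n) := by
    intro n
    induction n with
    | zero => intro _; simpa using h.1 _ _ h0 le_rfl ((hmono 0 (by omega)).2.trans hT)
    | succ k ih =>
      intro hk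
      rw [Finset.sum_range_succ]
      have := h.2 (u 0) (u k) (u (k + 1)) h0 (hmono k (by omega)).1 (hu k (by omega))
        ((hmono (k + 1) hk).2.trans hT)
      linarith [ih (by omega)]
  exact this N le_rfl

lemma varSum_le_of_control {p T : ℝ} {A : ℝ → ℝ → G} {c : ℝ → ℝ → ℝ} (hp : 0 < p)
    (hc : IsControl T c) (h : ∀ s t, 0 ≤ s → s ≤ t → t ≤ T → ‖A s t‖ ^ p ≤ c s t) :
    varSum p A 0 T ≤ ENNReal.ofReal (c 0 T) := by
  refine iSup_le fun ⟨n, u, hu, hu'⟩ => ?_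
  simp only
  have h1 : ∀ i, ‖A (u i) (u (i + 1))‖ₑ ^ p ≤ ENNReal.ofReal (c (u i) (u (i + 1))) := by
    intro i
    rw [← ofReal_norm, ENNReal.ofReal_rpow_of_nonneg (norm_nonneg _) hp.le]
    exact ENNReal.ofReal_le_ofReal (h _ _ (hu' _).1 (hu (by omega)) (hu' _).2)
  refine (Finset.sum_le_sum fun i _ => h1 i).trans ?_
  rw [← ENNReal.ofReal_sum_of_nonneg
    fun i _ => hc.1 _ _ (hu' _).1 (hu (by omega)) (hu' _).2]
  refine ENNReal.ofReal_le_ofReal ?_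
  refine (hc.sum_le (fun i _ => hu (by omega)) (hu' _).1 (hu' _).2).trans ?_
  exact hc.mono le_rfl (hu' _).1 (hu (by omega)) (hu' _).2 le_rfl

lemma pVar_lt_top_of_control {p T : ℝ} {A : ℝ → ℝ → G} {c : ℝ → ℝ → ℝ} (hp : 0 < p)
    (hc : IsControl T c) (h : ∀ s t, 0 ≤ s → s ≤ t → t ≤ T → ‖A s t‖ ^ p ≤ c s t) :
    pVar p A 0 T < ⊤ := by
  rw [pVar_eq_varSum hp]
  exact ENNReal.rpow_lt_top_of_nonneg (by positivity)
    ((varSum_le_of_control hp hc h).trans_lt ENNReal.ofReal_lt_top).ne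

/-- A control function that is small on short intervals. -/
structure IsRegularControl (T : ℝ) (c : ℝ → ℝ → ℝ) : Prop where
  isControl : IsControl T c
  small : ∀ ε > 0, ∃ δ > 0, ∀ s t, 0 ≤ s → s ≤ t → t ≤ T → t - s < δ → c s t ≤ ε

lemma IsRegularControl.add {T : ℝ} {c c' : ℝ → ℝ → ℝ} (h : IsRegularControl T c)
    (h' : IsRegularControl T c') : IsRegularControl T (fun s t => c s t + c' s t) := by
  refine ⟨h.1.add h'.1, fun ε hε => ?_⟩
  obtain ⟨δ, hδ, h1⟩ := h.2 (ε / 2) (by positivity)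
  obtain ⟨δ', hδ', h2⟩ := h'.2 (ε / 2) (by positivity)
  refine ⟨min δ δ', lt_min hδ hδ', fun s t a b c d => ?_⟩
  linarith [h1 s t a b c (d.trans_le (min_le_left _ _)), h2 s t a b c (d.trans_le (min_le_right _ _))]

lemma IsRegularControl.restrict {T T' : ℝ} (hT : T' ≤ T) {c : ℝ → ℝ → ℝ}
    (h : IsRegularControl T c) : IsRegularControl T' c := by
  refine ⟨h.1.restrict hT, fun ε hε => ?_⟩
  obtain ⟨δ, hδ, h1⟩ := h.2 ε hε
  exact ⟨δ, hδ, fun s t a b c d => h1 s t a b (c.trans hT) d⟩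

lemma sum_le_varControl {p T : ℝ} (hp : 0 < p) {A : ℝ → ℝ → G} (h : pVar p A 0 T < ⊤) {s t : ℝ}
    (hs : 0 ≤ s) (ht : t ≤ T) (n : ℕ) {u : ℕ → ℝ} (hu : Monotone u) (hu' : ∀ i, u i ∈ Icc s t) :
    ∑ i ∈ Finset.range n, ‖A (u i) (u (i + 1))‖ ^ p ≤ varControl p A s t := by
  refine (Finset.sum_le_sum fun i _ => norm_rpow_le_varControl hp h (hs.trans (hu' i).1)
    (hu (Nat.le_succ i)) ((hu' (i+1)).2.trans ht)).trans ?_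
  refine ((isControl_varControl hp h).sum_le (fun i _ => hu (Nat.le_succ i)) (hs.trans (hu' 0).1)
    ((hu' n).2.trans ht)).trans ?_
  exact (isControl_varControl hp h).mono hs (hu' 0).1 (hu (Nat.zero_le n)) (hu' n).2 ht

lemma exists_lt_sum {p T : ℝ} (hp : 0 < p) {A : ℝ → ℝ → G} (h : pVar p A 0 T < ⊤) {s t : ℝ}
    (hs : 0 ≤ s) (hst : s ≤ t) (ht : t ≤ T) {ε : ℝ} (hε : 0 < ε) :
    ∃ (n : ℕ) (u : ℕ → ℝ), Monotone u ∧ (∀ i, u i ∈ Icc s t) ∧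
      varControl p A s t - ε < ∑ i ∈ Finset.range n, ‖A (u i) (u (i + 1))‖ ^ p := by
  by_contra! H
  have h1 : varSum p A s t ≤ ENNReal.ofReal (varControl p A s t - ε) := by
    refine iSup_le fun ⟨n, u, hu, hu'⟩ => ?_
    refine le_trans (le_of_eq ?_) (ENNReal.ofReal_le_ofReal (H n u hu hu'))
    rw [ENNReal.ofReal_sum_of_nonneg fun i _ => by positivity]
    refine Finset.sum_congr rfl fun i _ => ?_
    rw [← ofReal_norm, ENNReal.ofReal_rpow_of_nonneg (norm_nonneg _) hp.le]
  have h0 := H 0 (fun _ => s) monotone_const fun _ => ⟨le_rfl, hst⟩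
  simp only [Finset.range_zero, Finset.sum_empty] at h0
  have h2 : varSum p A s t < ⊤ := (varSum_mono A hs ht).trans_lt (varSum_lt_top hp h)
  have h3 := ENNReal.toReal_mono ENNReal.ofReal_ne_top h1
  rw [ENNReal.toReal_ofReal h0] at h3
  change varControl p A s t ≤ _ at h3
  linarith

end Variation

section Regular

variable {G : Type*} [NormedAddCommGroup G] {p T : ℝ} {A : ℝ → ℝ → G}

/-- Joint continuity of a two-parameter function on `[0, T]²`. -/
def ContOnSq (T : ℝ) (A : ℝ → ℝ → G) : Prop :=
  ContinuousOn (fun x : ℝ × ℝ => A x.1 x.2) (Icc 0 T ×ˢ Icc 0 T)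

lemma ContOnSq.comp_sum (hp : 0 < p) (hA : ContOnSq T A) {x : ℝ} (n : ℕ) (f : ℕ → ℝ → ℝ) {s : Set ℝ}
    (hf : ∀ i, Continuous (f i)) (hs : ∀ i, MapsTo (f i) s (Icc 0 T)) (hx : x ∈ s) :
    ContinuousWithinAt (fun v => ∑ i ∈ Finset.range n, ‖A (f i v) (f (i + 1) v)‖ ^ p) s x := by
  have h : ContinuousOn (fun v => ∑ i ∈ Finset.range n, ‖A (f i v) (f (i + 1) v)‖ ^ p) s := by
    refine continuousOn_finsetSum _ fun i _ => ?_
    refine ContinuousOn.rpow_const ?_ fun _ _ => Or.inr hp.le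
    refine ContinuousOn.norm ?_
    exact hA.comp ((hf i).prodMk (hf (i + 1))).continuousOn fun v hv => ⟨hs i hv, hs (i + 1) hv⟩
  exact h x hx

lemma exists_right_small (hp : 0 < p) (h : pVar p A 0 T < ⊤) (hA : ContOnSq T A) {x : ℝ}
    (hx : 0 ≤ x) (hxT : x < T) {ε : ℝ} (hε : 0 < ε) :
    ∃ v, x < v ∧ v ≤ T ∧ varControl p A x v ≤ ε := by
  obtain ⟨n, u, hu, hu', hs⟩ := exists_lt_sum hp h hx hxT.le le_rfl (half_pos hε)
  have hc := hA.comp_sum hp n (fun i v => max (u i) v) (s := Icc x T) (x := x)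
    (fun i => by fun_prop) (fun i v hv => ⟨hx.trans (hv.1.trans (le_max_right _ _)),
      max_le (hu' i).2 hv.2⟩) ⟨le_rfl, hxT.le⟩
  have h0 : ∑ i ∈ Finset.range n, ‖A (max (u i) x) (max (u (i + 1)) x)‖ ^ p =
      ∑ i ∈ Finset.range n, ‖A (u i) (u (i + 1))‖ ^ p :=
    Finset.sum_congr rfl fun i _ => by rw [max_eq_left (hu' _).1, max_eq_left (hu' _).1]
  have h1 := hc.eventually (lt_mem_nhds (a := varControl p A x T - ε) (by beta_reduce; rw [h0]; linarith))
  have h2 : 𝓝[>] x ≤ 𝓝[Icc x T] x := by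
    rw [← nhdsWithin_Ioc_eq_nhdsGT hxT]
    exact nhdsWithin_mono _ Ioc_subset_Icc_self
  obtain ⟨v, hv1, hv2⟩ := ((h1.filter_mono h2).and (Ioc_mem_nhdsGT hxT)).exists
  refine ⟨v, hv2.1, hv2.2, ?_⟩
  have h3 := sum_le_varControl hp h (hx.trans hv2.1.le) le_rfl n (u := fun i => max (u i) v)
    (fun i j hij => max_le_max (hu hij) le_rfl) (fun i => ⟨le_max_right _ _,
      max_le (hu' i).2 hv2.2⟩)
  have h4 := (isControl_varControl hp h).2 x v T hx hv2.1.le hv2.2 le_rfl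
  linarith

lemma exists_left_small (hp : 0 < p) (h : pVar p A 0 T < ⊤) (hA : ContOnSq T A) {x : ℝ}
    (hx : 0 < x) (hxT : x ≤ T) {ε : ℝ} (hε : 0 < ε) :
    ∃ v, v < x ∧ 0 ≤ v ∧ varControl p A v x ≤ ε := by
  obtain ⟨n, u, hu, hu', hs⟩ := exists_lt_sum hp h le_rfl hx.le hxT (half_pos hε)
  have hc := hA.comp_sum hp n (fun i v => min (u i) v) (s := Icc 0 x) (x := x)
    (fun i => by fun_prop) (fun i v hv => ⟨le_min (hu' i).1 hv.1,
      (min_le_right _ _).trans (hv.2.trans hxT)⟩) ⟨hx.le, le_rfl⟩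
  have h0 : ∑ i ∈ Finset.range n, ‖A (min (u i) x) (min (u (i + 1)) x)‖ ^ p =
      ∑ i ∈ Finset.range n, ‖A (u i) (u (i + 1))‖ ^ p :=
    Finset.sum_congr rfl fun i _ => by rw [min_eq_left (hu' _).2, min_eq_left (hu' _).2]
  have h1 := hc.eventually (lt_mem_nhds (a := varControl p A 0 x - ε) (by beta_reduce; rw [h0]; linarith))
  have h2 : 𝓝[<] x ≤ 𝓝[Icc 0 x] x := by
    rw [← nhdsWithin_Ico_eq_nhdsLT hx]
    exact nhdsWithin_mono _ Ico_subset_Icc_self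
  obtain ⟨v, hv1, hv2⟩ := ((h1.filter_mono h2).and (Ico_mem_nhdsLT hx)).exists
  refine ⟨v, hv2.2, hv2.1, ?_⟩
  have h3 := sum_le_varControl hp h le_rfl (hv2.2.le.trans hxT) n (u := fun i => min (u i) v)
    (fun i j hij => min_le_min (hu hij) le_rfl) (fun i => ⟨le_min (hu' i).1 hv2.1,
      min_le_right _ _⟩)
  have h4 := (isControl_varControl hp h).2 0 v x le_rfl hv2.1 hv2.2.le hxT
  linarith

lemma varControl_le_split (hp : 0 < p) (h : pVar p A 0 T < ⊤) {a x b B : ℝ} (ha : 0 ≤ a)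
    (hax : a ≤ x) (hxb : x ≤ b) (hb : b ≤ T)
    (hB : ∀ y z, a ≤ y → y ≤ z → z ≤ b → ‖A y z‖ ^ p ≤ B) :
    varControl p A a b ≤ varControl p A a x + varControl p A x b + B := by
  have hB0 : 0 ≤ B := le_trans (by positivity) (hB a a le_rfl le_rfl (hax.trans hxb))
  refine le_of_forall_pos_lt_add fun ε hε => ?_
  obtain ⟨n, u, hu, hu', hs⟩ := exists_lt_sum hp h ha (hax.trans hxb) hb hε
  set g : ℝ → ℝ := fun y => if x < y then B else 0
  have key : ∀ i ∈ Finset.range n, ‖A (u i) (u (i + 1))‖ ^ p ≤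
      ‖A (min (u i) x) (min (u (i + 1)) x)‖ ^ p + ‖A (max (u i) x) (max (u (i + 1)) x)‖ ^ p
        + (g (u (i + 1)) - g (u i)) := by
    intro i _
    have hle : u i ≤ u (i + 1) := hu (Nat.le_succ i)
    have p1 : 0 ≤ ‖A (min (u i) x) (min (u (i + 1)) x)‖ ^ p := by positivity
    have p2 : 0 ≤ ‖A (max (u i) x) (max (u (i + 1)) x)‖ ^ p := by positivity
    rcases le_or_gt (u (i + 1)) x with h1 | h1
    · have h2 := hle.trans h1
      rw [min_eq_left h1, min_eq_left h2] at *
      simp only [g, not_lt.2 h1, not_lt.2 h2, if_false]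
      linarith
    · rcases lt_or_ge x (u i) with h2 | h2
      · rw [max_eq_left h1.le, max_eq_left h2.le] at *
        simp only [g, h1, h2, if_true]
        linarith
      · simp only [g, h1, not_lt.2 h2, if_true, if_false]
        linarith [hB (u i) (u (i + 1)) (hu' _).1 hle (hu' _).2]
  have h1 := Finset.sum_le_sum key
  rw [Finset.sum_add_distrib, Finset.sum_add_distrib, Finset.sum_range_sub (fun i => g (u i))] at h1
  have h2 := sum_le_varControl hp h ha (hxb.trans hb) n (u := fun i => min (u i) x)
    (fun i j hij => min_le_min (hu hij) le_rfl)
    (fun i => ⟨le_min (hu' i).1 hax, min_le_right _ _⟩)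
  have h3 := sum_le_varControl hp h (ha.trans hax) hb n (u := fun i => max (u i) x)
    (fun i j hij => max_le_max (hu hij) le_rfl)
    (fun i => ⟨le_max_right _ _, max_le (hu' i).2 hxb⟩)
  have h4 : g (u n) - g (u 0) ≤ B := by
    simp only [g]; split_ifs <;> linarith
  linarith

lemma exists_local_small (hp : 0 < p) (h : pVar p A 0 T < ⊤) (hA : ContOnSq T A)
    (h0 : ∀ t, A t t = 0) {x : ℝ} (hx : x ∈ Icc 0 T) {ε : ℝ} (hε : 0 < ε) :
    ∃ δ > 0, ∀ a b, 0 ≤ a → a ≤ b → b ≤ T → x - δ < a → b < x + δ → varControl p A a b ≤ ε := by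
  obtain ⟨δ1, hδ1, H1⟩ : ∃ δ > 0, ∀ b, x ≤ b → b ≤ T → b < x + δ → varControl p A x b ≤ ε / 3 := by
    rcases hx.2.lt_or_eq with h1 | h1
    · obtain ⟨v, hv, hvT, hv'⟩ := exists_right_small hp h hA hx.1 h1 (ε := ε / 3) (by positivity)
      refine ⟨v - x, by linarith, fun b h2 h3 h4 => le_trans ?_ hv'⟩
      exact (isControl_varControl hp h).mono hx.1 le_rfl h2 (by linarith) hvT
    · refine ⟨1, one_pos, fun b h2 h3 _ => ?_⟩
      have : b = x := by linarith
      subst this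
      have := (isControl_varControl hp h).2 b b b hx.1 le_rfl le_rfl hx.2
      linarith
  obtain ⟨δ2, hδ2, H2⟩ : ∃ δ > 0, ∀ a, 0 ≤ a → a ≤ x → x - δ < a → varControl p A a x ≤ ε / 3 := by
    rcases hx.1.lt_or_eq with h1 | h1
    · obtain ⟨v, hv, hvT, hv'⟩ := exists_left_small hp h hA h1 hx.2 (ε := ε / 3) (by positivity)
      refine ⟨x - v, by linarith, fun b h2 h3 h4 => le_trans ?_ hv'⟩
      exact (isControl_varControl hp h).mono hvT (by linarith) h3 le_rfl hx.2
    · refine ⟨1, one_pos, fun b h2 h3 _ => ?_⟩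
      have : b = x := by linarith
      subst this
      have := (isControl_varControl hp h).2 b b b h2 le_rfl le_rfl hx.2
      linarith
  obtain ⟨δ3, hδ3, H3⟩ : ∃ δ > 0, ∀ y z, y ∈ Icc 0 T → z ∈ Icc 0 T → |y - x| < δ → |z - x| < δ →
      ‖A y z‖ ^ p ≤ ε / 3 := by
    have hc : ContinuousWithinAt (fun y : ℝ × ℝ => ‖A y.1 y.2‖ ^ p) (Icc 0 T ×ˢ Icc 0 T) (x, x) :=
      ((hA.norm).rpow_const fun _ _ => Or.inr hp.le) (x, x) ⟨hx, hx⟩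
    have h3 : ‖A (x, x).1 (x, x).2‖ ^ p < ε / 3 := by
      simp only [h0, norm_zero, Real.zero_rpow hp.ne']; positivity
    have h4 := hc.eventually (gt_mem_nhds h3)
    rw [eventually_nhdsWithin_iff, Metric.eventually_nhds_iff] at h4
    obtain ⟨δ, hδ, h5⟩ := h4
    refine ⟨δ, hδ, fun y z hy hz h6 h7 => (h5 (y := (y, z)) ?_ ⟨hy, hz⟩).le⟩
    rw [Prod.dist_eq]
    exact max_lt h6 h7
  refine ⟨min δ1 (min δ2 δ3), by positivity, fun a b ha hab hb h1 h2 => ?_⟩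
  have m1 := min_le_left δ1 (min δ2 δ3)
  have m2 := (min_le_right δ1 (min δ2 δ3)).trans (min_le_left _ _)
  have m3 := (min_le_right δ1 (min δ2 δ3)).trans (min_le_right _ _)
  have hc := isControl_varControl hp h
  rcases le_total x a with h3 | h3
  · have := H1 b (h3.trans hab) hb (by linarith)
    have := hc.mono hx.1 h3 hab le_rfl hb
    linarith
  · rcases le_total b x with h4 | h4
    · have := H2 a ha h3 (by linarith)
      have := hc.mono ha le_rfl hab h4 hx.2
      linarith
    · have := varControl_le_split hp h ha h3 h4 hb (B := ε / 3) fun y z hy hyz hz =>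
        H3 y z ⟨ha.trans hy, (hyz.trans hz).trans hb⟩ ⟨(ha.trans hy).trans hyz, hz.trans hb⟩
          (by rw [abs_lt]; constructor <;> linarith) (by rw [abs_lt]; constructor <;> linarith)
      linarith [H1 b h4 hb (by linarith), H2 a ha h3 (by linarith)]

lemma isRegularControl_varControl (hp : 0 < p) (h : pVar p A 0 T < ⊤) (hA : ContOnSq T A)
    (h0 : ∀ t, A t t = 0) : IsRegularControl T (varControl p A) := by
  refine ⟨isControl_varControl hp h, fun ε hε => ?_⟩
  have H : ∀ x : Icc 0 T, ∃ δ > 0, ∀ a b, 0 ≤ a → a ≤ b → b ≤ T → (x : ℝ) - δ < a → b < x + δ →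
      varControl p A a b ≤ ε := fun x => exists_local_small hp h hA h0 x.2 hε
  choose δ hδ H using H
  obtain ⟨η, hη, hc⟩ := lebesgue_number_lemma_of_metric (isCompact_Icc (a := (0:ℝ)) (b := T))
    (c := fun x : Icc 0 T => Metric.ball (x : ℝ) (δ x)) (fun x => Metric.isOpen_ball)
    (fun x hx => mem_iUnion.2 ⟨⟨x, hx⟩, Metric.mem_ball_self (hδ _)⟩)
  refine ⟨η, hη, fun s t hs hst ht hd => ?_⟩
  obtain ⟨x, hx⟩ := hc s ⟨hs, hst.trans ht⟩
  have h1 : s ∈ Metric.ball (x : ℝ) (δ x) := hx (Metric.mem_ball_self hη)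
  have h2 : t ∈ Metric.ball (x : ℝ) (δ x) := hx (by
    rw [Metric.mem_ball, Real.dist_eq, abs_of_nonneg (by linarith)]; exact hd)
  rw [Metric.mem_ball, Real.dist_eq, abs_lt] at h1 h2
  exact H x s t hs hst ht (by linarith) (by linarith)

end Regular

/-! ### Sewing -/

section Sewing

variable {G : Type*} [NormedAddCommGroup G]

/-- The constant in the maximal inequality for sums over partitions. -/
noncomputable def sewC (θ : ℝ) : ℝ := 2 / (1 - 2 ^ (1 - θ))

lemma two_rpow_lt_one {θ : ℝ} (hθ : 1 < θ) : (2 : ℝ) ^ (1 - θ) < 1 :=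
  Real.rpow_lt_one_of_one_lt_of_neg one_lt_two (by linarith)

lemma sewC_pos {θ : ℝ} (hθ : 1 < θ) : 0 < sewC θ :=
  div_pos two_pos (by linarith [two_rpow_lt_one hθ])

lemma sewC_spec {θ : ℝ} (hθ : 1 < θ) : sewC θ * 2 ^ (1 - θ) + 2 = sewC θ := by
  have := two_rpow_lt_one hθ
  unfold sewC
  field_simp [show (1 - (2 : ℝ) ^ (1 - θ)) ≠ 0 by linarith]
  ring

/-- The maximal inequality for almost additive functions of two indices. -/
lemma discrete_sewing {Ξ : ℕ → ℕ → G} {w : ℕ → ℕ → ℝ} {θ K : ℝ} (hθ : 1 < θ) (hK : 0 ≤ K) {N : ℕ}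
    (hw0 : ∀ i j, i ≤ j → j ≤ N → 0 ≤ w i j)
    (hw : ∀ i j k, i ≤ j → j ≤ k → k ≤ N → w i j + w j k ≤ w i k)
    (hδ : ∀ i j k, i ≤ j → j ≤ k → k ≤ N → ‖Ξ i k - Ξ i j - Ξ j k‖ ≤ K * w i k ^ θ)
    (h0 : ∀ i ≤ N, Ξ i i = 0) :
    ∀ n i, i + n ≤ N →
      ‖∑ k ∈ Finset.range n, Ξ (i + k) (i + k + 1) - Ξ i (i + n)‖
        ≤ K * sewC θ * w i (i + n) ^ θ := by
  intro n
  induction n using Nat.strong_induction_on with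
  | _ n ih =>
  intro i hi
  have hC := sewC_pos hθ
  rcases Nat.eq_zero_or_pos n with rfl | hn
  · have := hw0 i i le_rfl hi
    simp only [Finset.range_zero, Finset.sum_empty, add_zero, h0 i hi, sub_zero, norm_zero]
    positivity
  set W := w i (i + n) with hW
  have hW0 : 0 ≤ W := hw0 _ _ (by omega) hi
  have hdiag : ∀ a ≤ N, w a a = 0 := fun a ha => by
    have h1 := hw a a a le_rfl le_rfl ha
    have h2 := hw0 a a le_rfl ha
    linarith
  classical
  set j := Nat.findGreatest (fun j => w i (i + j) ≤ W / 2) (n - 1) with hj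
  have hj1 : w i (i + j) ≤ W / 2 :=
    Nat.findGreatest_spec (P := fun j => w i (i + j) ≤ W / 2) (m := 0) (Nat.zero_le _)
      (by simp only [add_zero, hdiag i (by omega)]; linarith)
  have hjn : j ≤ n - 1 := Nat.findGreatest_le _
  have hj2 : w (i + (j + 1)) (i + n) ≤ W / 2 := by
    rcases Nat.eq_or_lt_of_le hjn with h | h
    · rw [show j + 1 = n by omega, hdiag _ hi]; linarith
    · have h1 := Nat.findGreatest_is_greatest (P := fun j => w i (i + j) ≤ W / 2)
        (show j < j + 1 by omega) (by omega : j + 1 ≤ n - 1)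
      have h2 := hw i (i + (j + 1)) (i + n) (by omega) (by omega) hi
      linarith
  obtain ⟨m, hm⟩ : ∃ m, n = j + 1 + m := ⟨n - (j + 1), by omega⟩
  have e1 := ih j (by omega) i (by omega)
  have e2 := ih m (by omega) (i + (j + 1)) (by omega)
  have e3 := hδ i (i + j) (i + n) (by omega) (by omega) hi
  have e4 := hδ (i + j) (i + (j + 1)) (i + n) (by omega) (by omega) hi
  have hmono : w (i + j) (i + n) ≤ W := by
    linarith [hw i (i + j) (i + n) (by omega) (by omega) hi, hw0 i (i + j) (by omega) (by omega)]
  have hhalf : ∀ x, 0 ≤ x → x ≤ W / 2 → K * sewC θ * x ^ θ ≤ K * sewC θ * (W ^ θ * 2 ^ (-θ)) := by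
    intro x hx hxW
    have h1 : x ^ θ ≤ (W / 2) ^ θ := Real.rpow_le_rpow hx hxW (by linarith)
    rw [Real.div_rpow hW0 two_pos.le, div_eq_mul_inv, ← Real.rpow_neg two_pos.le] at h1
    gcongr
  have f1 := e1.trans (hhalf _ (hw0 _ _ (by omega) (by omega)) hj1)
  have f2 : ‖∑ k ∈ Finset.range m, Ξ (i + (j + 1) + k) (i + (j + 1) + k + 1)
      - Ξ (i + (j + 1)) (i + n)‖ ≤ K * sewC θ * (W ^ θ * 2 ^ (-θ)) := by
    have h1 : i + (j + 1) + m = i + n := by omega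
    rw [h1] at e2
    exact e2.trans (hhalf _ (hw0 _ _ (by omega) hi) hj2)
  have f4 : K * w (i + j) (i + n) ^ θ ≤ K * W ^ θ := by
    have := Real.rpow_le_rpow (hw0 (i + j) (i + n) (by omega) hi) hmono (by linarith : 0 ≤ θ)
    gcongr
  have hsum : ∑ k ∈ Finset.range n, Ξ (i + k) (i + k + 1) - Ξ i (i + n) =
      (∑ k ∈ Finset.range j, Ξ (i + k) (i + k + 1) - Ξ i (i + j))
      + (∑ k ∈ Finset.range m, Ξ (i + (j + 1) + k) (i + (j + 1) + k + 1)
        - Ξ (i + (j + 1)) (i + n))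
      - (Ξ i (i + n) - Ξ i (i + j) - Ξ (i + j) (i + n))
      - (Ξ (i + j) (i + n) - Ξ (i + j) (i + (j + 1)) - Ξ (i + (j + 1)) (i + n)) := by
    rw [hm, Finset.sum_range_add, Finset.sum_range_succ]
    simp only [add_assoc]
    abel
  have hfin : K * sewC θ * (W ^ θ * 2 ^ (-θ)) + K * sewC θ * (W ^ θ * 2 ^ (-θ)) + K * W ^ θ
      + K * W ^ θ = K * sewC θ * W ^ θ := by
    have h1 := sewC_spec hθ
    rw [show (1 - θ) = 1 + -θ by ring, Real.rpow_add two_pos, Real.rpow_one] at h1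
    linear_combination (K * W ^ θ) * h1
  rw [hsum]
  calc _ ≤ _ := norm_sub_le _ _
    _ ≤ _ := add_le_add (norm_sub_le _ _) le_rfl
    _ ≤ _ := add_le_add (add_le_add (norm_add_le _ _) le_rfl) le_rfl
    _ ≤ _ := add_le_add (add_le_add (add_le_add f1 f2) e3) (e4.trans f4)
    _ = _ := hfin

/-- A germ on `[0, T]`: it vanishes on the diagonal and is almost additive with respect to the
control function `w`. -/
structure IsGerm (T θ K : ℝ) (w : ℝ → ℝ → ℝ) (Ξ : ℝ → ℝ → G) : Prop where
  diag : ∀ t, 0 ≤ t → t ≤ T → Ξ t t = 0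
  almost_add : ∀ s u t, 0 ≤ s → s ≤ u → u ≤ t → t ≤ T →
    ‖Ξ s t - Ξ s u - Ξ u t‖ ≤ K * w s t ^ θ

lemma mono_of_step {u : ℕ → ℝ} {N : ℕ} (hu : ∀ i < N, u i ≤ u (i + 1)) :
    ∀ i j, i ≤ j → j ≤ N → u i ≤ u j := by
  intro i j hij
  induction hij with
  | refl => intro _; exact le_rfl
  | step h ih => intro hj; exact (ih (by omega)).trans (hu _ (by omega))

variable {T θ K : ℝ} {w : ℝ → ℝ → ℝ} {Ξ : ℝ → ℝ → G}

lemma IsGerm.sum_sub_le (hθ : 1 < θ) (hK : 0 ≤ K) (hw : IsControl T w) (h : IsGerm T θ K w Ξ)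
    {u : ℕ → ℝ} {N : ℕ} (hu : ∀ i < N, u i ≤ u (i + 1)) (h0 : 0 ≤ u 0) (hT : u N ≤ T) :
    ‖∑ i ∈ Finset.range N, Ξ (u i) (u (i + 1)) - Ξ (u 0) (u N)‖
      ≤ K * sewC θ * w (u 0) (u N) ^ θ := by
  have hm := mono_of_step hu
  have h1 := discrete_sewing (Ξ := fun i j => Ξ (u i) (u j)) (w := fun i j => w (u i) (u j))
    hθ hK (N := N)
    (fun i j hij hj => hw.1 _ _ (h0.trans (hm 0 i (by omega) (by omega))) (hm i j hij hj)
      ((hm j N hj le_rfl).trans hT))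
    (fun i j k hij hjk hk => hw.2 _ _ _ (h0.trans (hm 0 i (by omega) (by omega)))
      (hm i j hij (by omega)) (hm j k hjk hk) ((hm k N hk le_rfl).trans hT))
    (fun i j k hij hjk hk => h.2 _ _ _ (h0.trans (hm 0 i (by omega) (by omega)))
      (hm i j hij (by omega)) (hm j k hjk hk) ((hm k N hk le_rfl).trans hT))
    (fun i hi => h.1 _ (h0.trans (hm 0 i (by omega) (by omega))) ((hm i N hi le_rfl).trans hT))
    N 0 (by omega)
  simpa using h1

lemma rpow_sum_le (hθ : 1 < θ) (hw : IsRegularControl T w) {ε : ℝ} (hε : 0 < ε) :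
    ∃ δ > 0, ∀ (N : ℕ) (u : ℕ → ℝ), 0 ≤ u 0 → u N ≤ T → (∀ i < N, u i ≤ u (i + 1)) →
      (∀ i < N, u (i + 1) - u i < δ) →
      ∑ i ∈ Finset.range N, w (u i) (u (i + 1)) ^ θ ≤ ε := by
  by_cases hT : 0 ≤ T
  swap
  · refine ⟨1, one_pos, fun N u h0 hN hu _ => ?_⟩
    have := mono_of_step hu 0 N (by omega) le_rfl
    linarith
  have hw0 : 0 ≤ w 0 T := hw.1.1 0 T le_rfl hT le_rfl
  set M := w 0 T + 1 with hMdef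
  have hM : 0 < M := by positivity
  obtain ⟨δ, hδ, H⟩ := hw.2 ((ε / M) ^ (1 / (θ - 1))) (by positivity)
  refine ⟨δ, hδ, fun N u h0 hN hu hd => ?_⟩
  have hm := mono_of_step hu
  have key : ∀ i ∈ Finset.range N, w (u i) (u (i + 1)) ^ θ ≤ ε / M * w (u i) (u (i + 1)) := by
    intro i hi
    have hi' := Finset.mem_range.1 hi
    have a1 : 0 ≤ u i := h0.trans (hm 0 i (by omega) hi'.le)
    have a2 : u (i + 1) ≤ T := (hm (i + 1) N (by omega) le_rfl).trans hN
    have a3 := hw.1.1 _ _ a1 (hu i hi') a2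
    have a4 := H _ _ a1 (hu i hi') a2 (hd i hi')
    have a5 := Real.rpow_le_rpow a3 a4 (by linarith : 0 ≤ θ - 1)
    rw [← Real.rpow_mul (by positivity), one_div_mul_cancel (by linarith), Real.rpow_one] at a5
    rcases a3.lt_or_eq with h | h
    · rw [show θ = (θ - 1) + 1 by ring, Real.rpow_add h, Real.rpow_one]
      gcongr
    · rw [← h, Real.zero_rpow (by linarith)]; simp
  refine (Finset.sum_le_sum key).trans ?_
  rw [← Finset.mul_sum]
  have h2 := hw.1.sum_le hu h0 hN
  have h3 := hw.1.mono le_rfl h0 (hm 0 N (by omega) le_rfl) hN le_rfl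
  calc ε / M * _ ≤ ε / M * M := by gcongr; simp only [M]; linarith
    _ = ε := div_mul_cancel₀ _ hM.ne'

/-- The interval `[a, b]` clamped to `[c, d]` and the interval `[c, d]` clamped to `[a, b]` agree
up to degenerate intervals. -/
lemma germ_clamp (h : ∀ t, 0 ≤ t → t ≤ T → Ξ t t = 0) {a b c d : ℝ} (hab : a ≤ b) (hcd : c ≤ d)
    (ha : 0 ≤ a) (hc : 0 ≤ c) (hb : b ≤ T) (hd : d ≤ T) :
    Ξ (max a (min c b)) (max a (min d b)) = Ξ (max c (min a d)) (max c (min b d)) := by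
  rcases le_total b c with h1 | h1
  · rw [min_eq_right h1, min_eq_right (h1.trans hcd), min_eq_left (hab.trans (h1.trans hcd)),
      min_eq_left (h1.trans hcd), max_eq_right hab, max_eq_left h1, max_eq_left (hab.trans h1),
      h b (ha.trans hab) hb, h c hc (hcd.trans hd)]
  · rcases le_total d a with h2 | h2
    · rw [min_eq_left (hcd.trans (h2.trans hab)), min_eq_left (h2.trans hab), min_eq_right h2,
        min_eq_right (h2.trans hab), max_eq_right hcd, max_eq_left h2, max_eq_left (hcd.trans h2),
        h a ha (hab.trans hb), h d (hc.trans hcd) hd]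
    · rw [min_eq_left h1, min_eq_left h2, max_eq_right (le_min h2 hab), max_eq_right (le_min h1 hcd),
        max_comm a c, min_comm d b]

/-- Comparison of the sums over two partitions of the same interval. -/
lemma IsGerm.sum_sub_sum_le (hθ : 1 < θ) (hK : 0 ≤ K) (hw : IsControl T w) (h : IsGerm T θ K w Ξ)
    {u v : ℕ → ℝ} {N M : ℕ} (hu : ∀ i < N, u i ≤ u (i + 1)) (hv : ∀ i < M, v i ≤ v (i + 1))
    (h0 : 0 ≤ u 0) (hT : u N ≤ T) (huv0 : v 0 = u 0) (huv : v M = u N) :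
    ‖∑ i ∈ Finset.range N, Ξ (u i) (u (i + 1)) - ∑ i ∈ Finset.range M, Ξ (v i) (v (i + 1))‖
      ≤ K * sewC θ * (∑ i ∈ Finset.range N, w (u i) (u (i + 1)) ^ θ
        + ∑ i ∈ Finset.range M, w (v i) (v (i + 1)) ^ θ) := by
  have main : ∀ (u v : ℕ → ℝ) (N M : ℕ), (∀ i < N, u i ≤ u (i + 1)) → (∀ i < M, v i ≤ v (i + 1)) →
      0 ≤ u 0 → u N ≤ T → v 0 = u 0 → v M = u N →
      ‖∑ i ∈ Finset.range N, ∑ j ∈ Finset.range M,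
          Ξ (max (u i) (min (v j) (u (i + 1)))) (max (u i) (min (v (j + 1)) (u (i + 1))))
        - ∑ i ∈ Finset.range N, Ξ (u i) (u (i + 1))‖
        ≤ K * sewC θ * ∑ i ∈ Finset.range N, w (u i) (u (i + 1)) ^ θ := by
    intro u v N M hu hv h0 hT huv0 huv
    rw [← Finset.sum_sub_distrib, Finset.mul_sum]
    refine norm_sum_le_of_le _ fun i hi => ?_
    have hi' := Finset.mem_range.1 hi
    have hm := mono_of_step hu
    have a0 := hm 0 i (by omega) hi'.le
    have a1 : 0 ≤ u i := h0.trans a0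
    have a2 := hm (i + 1) N (by omega) le_rfl
    have a3 := hu i hi'
    have := h.sum_sub_le hθ hK hw (u := fun j => max (u i) (min (v j) (u (i + 1)))) (N := M)
      (fun j hj => max_le_max le_rfl (min_le_min (hv j hj) le_rfl))
      (a1.trans (le_max_left _ _)) (max_le (by linarith) ((min_le_right _ _).trans (a2.trans hT)))
    simp only [huv0, huv] at this
    rwa [max_eq_left ((min_le_left _ _).trans a0), min_eq_right a2, max_eq_right a3] at this
  have h1 := main u v N M hu hv h0 hT huv0 huv
  have h2 := main v u M N hv hu (huv0 ▸ h0) (huv ▸ hT) huv0.symm huv.symm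
  have hmu := mono_of_step hu
  have hmv := mono_of_step hv
  have h3 : ∑ i ∈ Finset.range N, ∑ j ∈ Finset.range M,
        Ξ (max (u i) (min (v j) (u (i + 1)))) (max (u i) (min (v (j + 1)) (u (i + 1))))
      = ∑ j ∈ Finset.range M, ∑ i ∈ Finset.range N,
        Ξ (max (v j) (min (u i) (v (j + 1)))) (max (v j) (min (u (i + 1)) (v (j + 1)))) := by
    rw [Finset.sum_comm]
    refine Finset.sum_congr rfl fun j hj => Finset.sum_congr rfl fun i hi => ?_
    have hi' := Finset.mem_range.1 hi
    have hj' := Finset.mem_range.1 hj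
    exact germ_clamp h.1 (hu i hi') (hv j hj') (h0.trans (hmu 0 i (by omega) hi'.le))
      ((huv0 ▸ h0).trans (hmv 0 j (by omega) hj'.le))
      ((hmu (i + 1) N (by omega) le_rfl).trans hT)
      ((hmv (j + 1) M (by omega) le_rfl).trans (huv ▸ hT))
  rw [h3] at h1
  rw [mul_add]
  refine le_trans (le_of_eq ?_) ((norm_sub_le _ _).trans (add_le_add h1 h2) |>.trans
    (le_of_eq (by ring)))
  rw [← norm_neg]
  congr 1
  abel

/-- The equidistant partition of `[s, t]`. -/
noncomputable def equiPart (s t : ℝ) (n i : ℕ) : ℝ := s + (t - s) * (i / (n + 1))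

lemma equiPart_zero (s t : ℝ) (n : ℕ) : equiPart s t n 0 = s := by simp [equiPart]

lemma equiPart_last (s t : ℝ) (n : ℕ) : equiPart s t n (n + 1) = t := by
  have : ((n : ℝ) + 1) ≠ 0 := by positivity
  simp [equiPart, div_self this]

lemma equiPart_succ_sub (s t : ℝ) (n i : ℕ) :
    equiPart s t n (i + 1) - equiPart s t n i = (t - s) / (n + 1) := by
  simp only [equiPart]; push_cast; ring

lemma equiPart_le {s t : ℝ} (hst : s ≤ t) (n i : ℕ) :
    equiPart s t n i ≤ equiPart s t n (i + 1) := by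
  have := equiPart_succ_sub s t n i
  have h2 : 0 ≤ (t - s) / (n + 1) := div_nonneg (by linarith) (by positivity)
  linarith

lemma equiPart_mesh (s t : ℝ) {δ : ℝ} (hδ : 0 < δ) :
    ∀ᶠ n in atTop, ∀ i, equiPart s t n (i + 1) - equiPart s t n i < δ := by
  have h : Tendsto (fun n : ℕ => (t - s) * (1 / ((n : ℝ) + 1))) atTop (𝓝 ((t - s) * 0)) :=
    tendsto_one_div_add_atTop_nhds_zero_nat.const_mul _
  rw [mul_zero] at h
  filter_upwards [h.eventually (gt_mem_nhds hδ)] with n hn i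
  rw [equiPart_succ_sub]
  rwa [mul_one_div] at hn

/-- A limit along vanishing mesh size is a limit along any sequence of such partitions. -/
lemma HasMeshLimit.tendsto {s t : ℝ} {I : G} (h : HasMeshLimit Ξ s t I) {N : ℕ → ℕ}
    {u : ℕ → ℕ → ℝ} (h0 : ∀ n, u n 0 = s) (h1 : ∀ n, u n (N n) = t)
    (hm : ∀ n, ∀ i < N n, u n i ≤ u n (i + 1))
    (hmesh : ∀ δ > 0, ∀ᶠ n in atTop, ∀ i < N n, u n (i + 1) - u n i < δ) :
    Tendsto (fun n => ∑ i ∈ Finset.range (N n), Ξ (u n i) (u n (i + 1))) atTop (𝓝 I) := by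
  rw [Metric.tendsto_nhds]
  intro ε hε
  obtain ⟨δ, hδ, H⟩ := h ε hε
  filter_upwards [hmesh δ hδ] with n hn
  rw [dist_eq_norm]
  exact H (N n) (u n) (h0 n) (h1 n) (hm n) hn

lemma HasMeshLimit.tendsto_equiPart {s t : ℝ} (hst : s ≤ t) {I : G} (h : HasMeshLimit Ξ s t I) :
    Tendsto (fun n => ∑ i ∈ Finset.range (n + 1), Ξ (equiPart s t n i) (equiPart s t n (i + 1)))
      atTop (𝓝 I) :=
  h.tendsto (N := fun n => n + 1) (equiPart_zero s t) (equiPart_last s t)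
    (fun n i _ => equiPart_le hst n i)
    (fun _ hδ => (equiPart_mesh s t hδ).mono fun _ hn i _ => hn i)

lemma HasMeshLimit.unique {s t : ℝ} (hst : s ≤ t) {I J : G} (hI : HasMeshLimit Ξ s t I)
    (hJ : HasMeshLimit Ξ s t J) : I = J :=
  tendsto_nhds_unique (hI.tendsto_equiPart hst) (hJ.tendsto_equiPart hst)

lemma HasMeshLimit.meshLimit_eq {s t : ℝ} (hst : s ≤ t) {I : G} (hI : HasMeshLimit Ξ s t I) :
    meshLimit Ξ s t = I := by
  have h : ∃ I, HasMeshLimit Ξ s t I := ⟨I, hI⟩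
  rw [meshLimit, dif_pos h]
  exact h.choose_spec.unique hst hI

lemma IsGerm.hasMeshLimit [CompleteSpace G] (hθ : 1 < θ) (hK : 0 ≤ K) (hw : IsRegularControl T w)
    (h : IsGerm T θ K w Ξ) {s t : ℝ} (hs : 0 ≤ s) (hst : s ≤ t) (ht : t ≤ T) :
    HasMeshLimit Ξ s t (meshLimit Ξ s t) := by
  have hC := sewC_pos hθ
  set σ : ℕ → G := fun n =>
    ∑ i ∈ Finset.range (n + 1), Ξ (equiPart s t n i) (equiPart s t n (i + 1))
  have hcmp : ∀ ε > 0, ∃ δ > 0, ∀ (N M : ℕ) (u v : ℕ → ℝ), u 0 = s → u N = t → v 0 = s → v M = t →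
      (∀ i < N, u i ≤ u (i + 1)) → (∀ i < M, v i ≤ v (i + 1)) → (∀ i < N, u (i + 1) - u i < δ) →
      (∀ i < M, v (i + 1) - v i < δ) →
      ‖∑ i ∈ Finset.range N, Ξ (u i) (u (i + 1)) - ∑ i ∈ Finset.range M, Ξ (v i) (v (i + 1))‖
        ≤ ε := by
    intro ε hε
    have hD : 0 < 2 * (K * sewC θ + 1) := by positivity
    obtain ⟨δ, hδ, H⟩ := rpow_sum_le hθ hw (div_pos hε hD)
    refine ⟨δ, hδ, fun N M u v hu0 huN hv0 hvM hu hv hud hvd => ?_⟩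
    refine (h.sum_sub_sum_le hθ hK hw.1 hu hv (by rw [hu0]; exact hs) (by rw [huN]; exact ht)
      (by rw [hv0, hu0]) (by rw [hvM, huN])).trans ?_
    have h1 := H N u (by rw [hu0]; exact hs) (by rw [huN]; exact ht) hu hud
    have h2 := H M v (by rw [hv0]; exact hs) (by rw [hvM]; exact ht) hv hvd
    calc _ ≤ (K * sewC θ + 1) * (ε / (2 * (K * sewC θ + 1)) + ε / (2 * (K * sewC θ + 1))) := by
          refine mul_le_mul (by linarith) (add_le_add h1 h2) ?_ (by positivity)
          refine add_nonneg (Finset.sum_nonneg fun i hi => ?_) (Finset.sum_nonneg fun i hi => ?_)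
          · have hi' := Finset.mem_range.1 hi
            exact Real.rpow_nonneg (hw.1.1 _ _
              (hs.trans (hu0 ▸ mono_of_step hu 0 i (by omega) hi'.le)) (hu i hi')
              ((mono_of_step hu (i + 1) N (by omega) le_rfl).trans (huN ▸ ht))) _
          · have hi' := Finset.mem_range.1 hi
            exact Real.rpow_nonneg (hw.1.1 _ _
              (hs.trans (hv0 ▸ mono_of_step hv 0 i (by omega) hi'.le)) (hv i hi')
              ((mono_of_step hv (i + 1) M (by omega) le_rfl).trans (hvM ▸ ht))) _
      _ = ε := by field_simp; norm_num
  have hcauchy : CauchySeq σ := by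
    rw [Metric.cauchySeq_iff']
    intro ε hε
    obtain ⟨δ, hδ, H⟩ := hcmp (ε / 2) (by positivity)
    obtain ⟨n0, hn0⟩ := (eventually_atTop.1 (equiPart_mesh s t hδ))
    refine ⟨n0, fun n hn => ?_⟩
    rw [dist_eq_norm]
    refine lt_of_le_of_lt (H _ _ _ _ (equiPart_zero s t n) (equiPart_last s t n)
      (equiPart_zero s t n0) (equiPart_last s t n0) (fun i _ => equiPart_le hst _ _)
      (fun i _ => equiPart_le hst _ _) (fun i _ => hn0 n hn i) (fun i _ => hn0 n0 le_rfl i)) ?_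
    linarith
  obtain ⟨I, hI⟩ := cauchySeq_tendsto_of_complete hcauchy
  have hex : HasMeshLimit Ξ s t I := by
    intro ε hε
    obtain ⟨δ, hδ, H⟩ := hcmp (ε / 2) (by positivity)
    refine ⟨δ, hδ, fun N u hu0 huN hu hud => ?_⟩
    have h1 : ‖∑ i ∈ Finset.range N, Ξ (u i) (u (i + 1)) - I‖ ≤ ε / 2 := by
      refine le_of_tendsto (tendsto_const_nhds.sub hI).norm ?_
      filter_upwards [equiPart_mesh s t hδ] with n hn
      exact H _ _ _ _ hu0 huN (equiPart_zero s t n) (equiPart_last s t n) hu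
        (fun i _ => equiPart_le hst _ _) hud (fun i _ => hn i)
    linarith
  rwa [hex.meshLimit_eq hst]

lemma IsGerm.norm_meshLimit_sub_le [CompleteSpace G] (hθ : 1 < θ) (hK : 0 ≤ K)
    (hw : IsRegularControl T w) (h : IsGerm T θ K w Ξ) {s t : ℝ} (hs : 0 ≤ s) (hst : s ≤ t)
    (ht : t ≤ T) : ‖meshLimit Ξ s t - Ξ s t‖ ≤ K * sewC θ * w s t ^ θ := by
  have h1 := (h.hasMeshLimit hθ hK hw hs hst ht).tendsto_equiPart hst
  refine le_of_tendsto (h1.sub_const _).norm (Eventually.of_forall fun n => ?_)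
  have := h.sum_sub_le hθ hK hw.1 (u := equiPart s t n) (N := n + 1)
    (fun i _ => equiPart_le hst n i) (by rwa [equiPart_zero]) (by rwa [equiPart_last])
  rwa [equiPart_zero, equiPart_last] at this

lemma IsGerm.meshLimit_add [CompleteSpace G] (hθ : 1 < θ) (hK : 0 ≤ K) (hw : IsRegularControl T w)
    (h : IsGerm T θ K w Ξ) {s u t : ℝ} (hs : 0 ≤ s) (hsu : s ≤ u) (hut : u ≤ t) (ht : t ≤ T) :
    meshLimit Ξ s u + meshLimit Ξ u t = meshLimit Ξ s t := by
  have hst := hsu.trans hut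
  set e := equiPart s t
  have he : ∀ n i, e n i ≤ e n (i + 1) := fun n i => equiPart_le hst n i
  have hez : ∀ n, e n 0 = s := equiPart_zero s t
  have hel : ∀ n, e n (n + 1) = t := equiPart_last s t
  have h1 := (h.hasMeshLimit hθ hK hw hs hst ht).tendsto_equiPart hst
  have h2 := (h.hasMeshLimit hθ hK hw hs hsu (hut.trans ht)).tendsto (N := fun n => n + 1)
    (u := fun n i => min (e n i) u) (fun n => by simp [e, equiPart_zero, hsu])
    (fun n => by simp [e, equiPart_last, hut]) (fun n i _ => min_le_min (he n i) le_rfl)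
    (fun δ hδ => (equiPart_mesh s t hδ).mono fun n hn i _ => by
      have := hn i
      have := he n i
      simp only [e, min_def]
      split_ifs <;> linarith)
  have h3 := (h.hasMeshLimit hθ hK hw (hs.trans hsu) hut ht).tendsto (N := fun n => n + 1)
    (u := fun n i => max (e n i) u) (fun n => by simp [e, equiPart_zero, hsu])
    (fun n => by simp [e, equiPart_last, hut]) (fun n i _ => max_le_max (he n i) le_rfl)
    (fun δ hδ => (equiPart_mesh s t hδ).mono fun n hn i _ => by
      have := hn i
      have := he n i
      simp only [e, max_def]
      split_ifs <;> linarith)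
  have h4 := (h2.add h3).sub h1
  have h5 : Tendsto (fun n => (∑ i ∈ Finset.range (n + 1), Ξ (min (e n i) u) (min (e n (i + 1)) u)
      + ∑ i ∈ Finset.range (n + 1), Ξ (max (e n i) u) (max (e n (i + 1)) u))
      - ∑ i ∈ Finset.range (n + 1), Ξ (e n i) (e n (i + 1))) atTop (𝓝 0) := by
    rw [Metric.tendsto_nhds]
    intro ε hε
    obtain ⟨δ, hδ, H⟩ := rpow_sum_le hθ hw (ε := ε / (2 * (K + 1))) (by positivity)
    filter_upwards [equiPart_mesh s t hδ] with n hn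
    have hH := H (n + 1) (e n) (by rwa [hez]) (by rwa [hel])
      (fun i _ => he n i) (fun i _ => hn i)
    rw [dist_zero_right, ← Finset.sum_add_distrib, ← Finset.sum_sub_distrib]
    have hm := mono_of_step (u := e n) (N := n + 1) (fun i _ => he n i)
    have key : ∀ i ∈ Finset.range (n + 1), ‖Ξ (min (e n i) u) (min (e n (i + 1)) u)
        + Ξ (max (e n i) u) (max (e n (i + 1)) u) - Ξ (e n i) (e n (i + 1))‖
        ≤ K * w (e n i) (e n (i + 1)) ^ θ := by
      intro i hi
      have hi' := Finset.mem_range.1 hi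
      have a0 : 0 ≤ e n i := by
        have := hm 0 i (by omega) hi'.le
        rw [hez] at this
        exact hs.trans this
      have a1 : e n (i + 1) ≤ T := by
        have := hm (i + 1) (n + 1) (by omega) le_rfl
        rw [hel] at this
        exact this.trans ht
      have a2 : 0 ≤ K * w (e n i) (e n (i + 1)) ^ θ :=
        mul_nonneg hK (Real.rpow_nonneg (hw.1.1 _ _ a0 (he n i) a1) _)
      have a3 := h.1 u (hs.trans hsu) (hut.trans ht)
      rcases le_total (e n (i + 1)) u with b1 | b1
      · have b2 := (he n i).trans b1
        rw [min_eq_left b1, min_eq_left b2, max_eq_right b1, max_eq_right b2, a3]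
        simpa using a2
      · rcases le_total u (e n i) with b2 | b2
        · rw [min_eq_right b1, min_eq_right b2, max_eq_left b1, max_eq_left b2, a3]
          simpa using a2
        · rw [min_eq_right b1, min_eq_left b2, max_eq_left b1, max_eq_right b2]
          rw [← norm_neg]
          refine le_trans (le_of_eq ?_) (h.2 (e n i) u (e n (i + 1)) a0 b2 b1 a1)
          congr 1
          abel
    refine lt_of_le_of_lt (norm_sum_le_of_le _ key) ?_
    rw [← Finset.mul_sum]
    calc _ ≤ (K + 1) * (ε / (2 * (K + 1))) :=
          mul_le_mul (by linarith) hH (Finset.sum_nonneg fun i hi => by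
            have hi' := Finset.mem_range.1 hi
            have a0 : 0 ≤ e n i := by
              have := hm 0 i (by omega) hi'.le
              rw [hez] at this
              exact hs.trans this
            have a1 : e n (i + 1) ≤ T := by
              have := hm (i + 1) (n + 1) (by omega) le_rfl
              rw [hel] at this
              exact this.trans ht
            exact Real.rpow_nonneg (hw.1.1 _ _ a0 (he n i) a1) _) (by positivity)
      _ = ε / 2 := by field_simp
      _ < ε := by linarith
  exact sub_eq_zero.1 (tendsto_nhds_unique h4 h5)

lemma IsGerm.meshLimit_self [CompleteSpace G] (hθ : 1 < θ) (hK : 0 ≤ K) (hw : IsRegularControl T w)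
    (h : IsGerm T θ K w Ξ) {t : ℝ} (ht0 : 0 ≤ t) (ht : t ≤ T) : meshLimit Ξ t t = 0 := by
  have := h.meshLimit_add hθ hK hw ht0 le_rfl le_rfl ht
  simpa using this

end Sewing

/-! ### Sums along the given partitions -/

section Grid

variable {G : Type*} [NormedAddCommGroup G]

/-- The points of the restricted partition `(P n ∪ {T}) ∩ [0, T]`. -/
noncomputable def grid (P : ℕ → ℕ → ℝ) (T : ℝ) (n k : ℕ) : ℝ := min (P n k) T

open Classical in
/-- The number of intervals of the restricted partition. -/
noncomputable def numPts (P : ℕ → ℕ → ℝ) (T : ℝ) (n : ℕ) : ℕ := sInf {k | T ≤ P n k}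

/-- The sum of `Ξ` along the restricted partition. -/
noncomputable def psum (P : ℕ → ℕ → ℝ) (T : ℝ) (Ξ : ℝ → ℝ → G) (n : ℕ) : G :=
  ∑ i ∈ Finset.range (numPts P T n), Ξ (grid P T n i) (grid P T n (i + 1))

/-- Partitions of `[0, ∞)` with mesh size vanishing on compacts. -/
structure GridSeq (P : ℕ → ℕ → ℝ) : Prop where
  partition : ∀ n, IsPartition (P n)
  mesh : ∀ T > 0, ∀ ε > 0, ∀ᶠ n in atTop, ∀ k, grid P T n (k + 1) - grid P T n k < ε

variable {P : ℕ → ℕ → ℝ} {T : ℝ}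

lemma GridSeq.nonneg (hP : GridSeq P) (n k : ℕ) : 0 ≤ P n k :=
  (hP.1 n).start ▸ (hP.1 n).strictMono.monotone (Nat.zero_le k)

lemma GridSeq.grid_zero (hP : GridSeq P) (hT : 0 ≤ T) (n : ℕ) : grid P T n 0 = 0 := by
  simp [grid, (hP.1 n).start, hT]

lemma GridSeq.le_numPts (hP : GridSeq P) (n : ℕ) : T ≤ P n (numPts P T n) := by
  have h : {k | T ≤ P n k}.Nonempty := ((hP.1 n).tendsto.eventually_ge_atTop T).exists
  exact Nat.sInf_mem h

lemma GridSeq.grid_last (hP : GridSeq P) (n : ℕ) : grid P T n (numPts P T n) = T :=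
  min_eq_right (hP.le_numPts n)

lemma GridSeq.grid_mono (hP : GridSeq P) (n : ℕ) : Monotone (grid P T n) := fun _ _ hij =>
  min_le_min ((hP.1 n).strictMono.monotone hij) le_rfl

lemma GridSeq.grid_nonneg (hP : GridSeq P) (hT : 0 ≤ T) (n k : ℕ) : 0 ≤ grid P T n k :=
  le_min (hP.nonneg n k) hT

lemma grid_le (n k : ℕ) : grid P T n k ≤ T := min_le_right _ _

lemma GridSeq.mesh' (hP : GridSeq P) (hT : 0 ≤ T) {ε : ℝ} (hε : 0 < ε) :
    ∀ᶠ n in atTop, ∀ k, grid P T n (k + 1) - grid P T n k < ε := by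
  rcases hT.lt_or_eq with h | h
  · exact hP.mesh T h ε hε
  · refine Eventually.of_forall fun n k => ?_
    have h1 : ∀ k, grid P T n k = 0 := fun k => le_antisymm ((grid_le n k).trans h.symm.le)
      (hP.grid_nonneg hT n k)
    simp [h1, hε]

lemma HasMeshLimit.psum (hP : GridSeq P) (hT : 0 ≤ T) {Ξ : ℝ → ℝ → G} {I : G}
    (h : HasMeshLimit Ξ 0 T I) : Tendsto (psum P T Ξ) atTop (𝓝 I) :=
  h.tendsto (hP.grid_zero hT) hP.grid_last (fun n i _ => hP.grid_mono n (Nat.le_succ i))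
    (fun _ hδ => (hP.mesh' hT hδ).mono fun _ hn i _ => hn i)

lemma psum_add (Ξ Ξ' : ℝ → ℝ → G) (n : ℕ) :
    psum P T (fun s t => Ξ s t + Ξ' s t) n = psum P T Ξ n + psum P T Ξ' n :=
  Finset.sum_add_distrib

lemma psum_sub (Ξ Ξ' : ℝ → ℝ → G) (n : ℕ) :
    psum P T (fun s t => Ξ s t - Ξ' s t) n = psum P T Ξ n - psum P T Ξ' n :=
  Finset.sum_sub_distrib _ _

lemma psum_mul (a : ℝ) (Ξ : ℝ → ℝ → ℝ) (n : ℕ) :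
    psum P T (fun s t => a * Ξ s t) n = a * psum P T Ξ n := (Finset.mul_sum _ _ _).symm

lemma psum_sum {κ : Type*} (s : Finset κ) (Ξ : κ → ℝ → ℝ → G) (n : ℕ) :
    psum P T (fun u v => ∑ k ∈ s, Ξ k u v) n = ∑ k ∈ s, psum P T (Ξ k) n := Finset.sum_comm

lemma GridSeq.psum_inc (hP : GridSeq P) (hT : 0 ≤ T) (f : ℝ → G) (n : ℕ) :
    psum P T (inc f) n = f T - f 0 := by
  simp only [psum, inc]
  rw [Finset.sum_range_sub (fun i => f (grid P T n i)), hP.grid_last, hP.grid_zero hT]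

lemma GridSeq.psum_congr (hP : GridSeq P) (hT : 0 ≤ T) {Ξ Ξ' : ℝ → ℝ → G}
    (h : ∀ s t, 0 ≤ s → s ≤ t → t ≤ T → Ξ s t = Ξ' s t) (n : ℕ) : psum P T Ξ n = psum P T Ξ' n :=
  Finset.sum_congr rfl fun i _ => h _ _ (hP.grid_nonneg hT n i) (hP.grid_mono n (Nat.le_succ i))
    (grid_le n _)

lemma GridSeq.norm_psum_le (hP : GridSeq P) (hT : 0 ≤ T) {Ξ : ℝ → ℝ → G} {Ξ' : ℝ → ℝ → ℝ}
    (h : ∀ s t, 0 ≤ s → s ≤ t → t ≤ T → ‖Ξ s t‖ ≤ Ξ' s t) (n : ℕ) :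
    ‖psum P T Ξ n‖ ≤ psum P T Ξ' n :=
  norm_sum_le_of_le _ fun i _ => h _ _ (hP.grid_nonneg hT n i) (hP.grid_mono n (Nat.le_succ i))
    (grid_le n _)

/-- Sums of germs of order greater than one vanish in the limit. -/
lemma GridSeq.psum_tendsto_zero (hP : GridSeq P) (hT : 0 ≤ T) {w : ℝ → ℝ → ℝ} {θ C : ℝ}
    (hw : IsRegularControl T w) (hθ : 1 < θ) {Ξ : ℝ → ℝ → G}
    (h : ∀ s t, 0 ≤ s → s ≤ t → t ≤ T → ‖Ξ s t‖ ≤ C * w s t ^ θ) :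
    Tendsto (psum P T Ξ) atTop (𝓝 0) := by
  have hle : ∀ n, ‖psum P T Ξ n‖ ≤ |C| * psum P T (fun s t => w s t ^ θ) n := by
    intro n
    rw [← psum_mul]
    refine hP.norm_psum_le hT (fun s t h0 hst ht => (h s t h0 hst ht).trans ?_) n
    exact mul_le_mul_of_nonneg_right (le_abs_self C) (Real.rpow_nonneg (hw.1.1 _ _ h0 hst ht) _)
  refine squeeze_zero_norm hle ?_
  rw [Metric.tendsto_nhds]
  intro ε hε
  obtain ⟨δ, hδ, H⟩ := rpow_sum_le hθ hw (ε := ε / (2 * (|C| + 1))) (by positivity)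
  filter_upwards [hP.mesh' hT hδ] with n hn
  have h1 : psum P T (fun s t => w s t ^ θ) n ≤ _ := H (numPts P T n) (grid P T n)
    (hP.grid_nonneg hT n 0) (grid_le n _) (fun i _ => hP.grid_mono n (Nat.le_succ i))
    (fun i _ => hn i)
  have h2 : 0 ≤ psum P T (fun s t => w s t ^ θ) n :=
    Finset.sum_nonneg fun i _ => Real.rpow_nonneg (hw.1.1 _ _ (hP.grid_nonneg hT n i)
      (hP.grid_mono n (Nat.le_succ i)) (grid_le n _)) _
  rw [dist_zero_right, Real.norm_of_nonneg (by positivity)]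
  calc _ ≤ (|C| + 1) * (ε / (2 * (|C| + 1))) := mul_le_mul (by linarith) h1 h2 (by positivity)
    _ = ε / 2 := by field_simp
    _ < ε := by linarith

end Grid

/-! ### The rough path of a price path -/

section Rough

variable {d : ℕ} {p q T : ℝ} {S : ℝ → Vec d} {P : ℕ → ℕ → ℝ}

lemma IsPricePath.gridSeq (hS : IsPricePath p S P) : GridSeq P :=
  ⟨hS.partition, fun T hT => (hS.rie T hT).mesh⟩

lemma tensor_zero {d : ℕ} (a : Vec d) : tensor a 0 = 0 := by
  ext ij; simp [tensor]

lemma continuous_tensor {d : ℕ} : Continuous fun x : Vec d × Vec d => tensor x.1 x.2 := by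
  unfold tensor
  refine (PiLp.continuous_toLp 2 _).comp (continuous_pi fun ij => ?_)
  fun_prop

lemma riemannSum_eq_sum (hP : GridSeq P) {t : ℝ} (n N : ℕ)
    (hN : numPts P T n ≤ N) : riemannSum S (grid P T n) t =
      ∑ k ∈ Finset.range N, tensor (S (grid P T n k))
        (inc S (min (grid P T n k) t) (min (grid P T n (k + 1)) t)) := by
  refine finsum_eq_sum_of_support_subset _ fun k hk => ?_
  by_contra h
  refine hk ?_
  have h1 : N ≤ k := by simpa using h
  have h2 : ∀ j, N ≤ j → grid P T n j = T := fun j hj => le_antisymm (grid_le n j)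
    ((hP.grid_last (T := T) n).symm.le.trans (hP.grid_mono n (hN.trans hj)))
  simp [h2 k h1, h2 (k + 1) (by omega), inc, tensor_zero]

lemma riemannSum_grid {t : ℝ} (ht : t ≤ T) (hP : GridSeq P) (n : ℕ) :
    riemannSum S (grid P T n) t = riemannSum S (P n) t := by
  refine finsum_congr fun k => ?_
  have h : ∀ j, min (grid P T n j) t = min (P n j) t := fun j => by
    rw [grid, min_assoc, min_eq_right ht]
  rw [h, h]
  rcases le_total (P n k) T with h1 | h1
  · rw [grid, min_eq_left h1]
  · have h2 : P n k ≤ P n (k + 1) := (hP.1 n).strictMono.monotone (Nat.le_succ k)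
    rw [min_eq_right (ht.trans h1), min_eq_right (ht.trans (h1.trans h2))]
    simp [inc, tensor_zero]

lemma tendstoUniformlyOn_pathIntegral (hS : IsPricePath p S P) (hT : 0 < T) :
    TendstoUniformlyOn (fun n t => riemannSum S (grid P T n) t) (pathIntegral S P) atTop
      (Icc 0 T) := by
  obtain ⟨I, hI⟩ := (hS.rie T hT).converges
  refine hI.congr_right fun t ht => ?_
  have h1 : Tendsto (fun n => riemannSum S (P n) t) atTop (𝓝 (I t)) := by
    refine (hI.tendsto_at ht).congr fun n => ?_
    exact riemannSum_grid ht.2 hS.gridSeq n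
  exact h1.limUnder_eq.symm

lemma IsPricePath.continuousOn_Icc (hS : IsPricePath p S P) : ContinuousOn S (Icc 0 T) :=
  hS.continuousOn.mono Icc_subset_Ici_self

lemma continuousOn_riemannSum (hS : IsPricePath p S P) (hT : 0 < T) (n : ℕ) :
    ContinuousOn (riemannSum S (grid P T n)) (Icc 0 T) := by
  have hP := hS.gridSeq
  have h1 : ContinuousOn (fun t => ∑ k ∈ Finset.range (numPts P T n), tensor (S (grid P T n k))
        (inc S (min (grid P T n k) t) (min (grid P T n (k + 1)) t))) (Icc 0 T) := by
    refine continuousOn_finsetSum _ fun k _ => ?_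
    refine continuous_tensor.comp_continuousOn (continuousOn_const.prodMk ?_)
    have h2 : ∀ k, ContinuousOn (fun t => S (min (grid P T n k) t)) (Icc 0 T) := fun k =>
      (hS.continuousOn_Icc (T := T)).comp (by fun_prop) fun t ht =>
        ⟨le_min (hP.grid_nonneg hT.le n k) ht.1, (min_le_right _ _).trans ht.2⟩
    exact (h2 _).sub (h2 _)
  exact h1.congr fun t _ => riemannSum_eq_sum hP n _ le_rfl

lemma continuousOn_pathIntegral (hS : IsPricePath p S P) (hT : 0 < T) :
    ContinuousOn (pathIntegral S P) (Icc 0 T) :=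
  (tendstoUniformlyOn_pathIntegral hS hT).continuousOn
    (Frequently.of_forall fun n => continuousOn_riemannSum hS hT n)

lemma contOnSq_inc {G : Type*} [NormedAddCommGroup G] {X : ℝ → G} (h : ContinuousOn X (Icc 0 T)) :
    ContOnSq T (inc X) :=
  (h.comp continuousOn_snd fun _ hx => hx.2).sub (h.comp continuousOn_fst fun _ hx => hx.1)

lemma contOnSq_secondLevel (hS : IsPricePath p S P) (hT : 0 < T) :
    ContOnSq T (secondLevel S P) := by
  refine (contOnSq_inc (continuousOn_pathIntegral hS hT)).sub ?_
  refine continuous_tensor.comp_continuousOn (ContinuousOn.prodMk ?_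
    (contOnSq_inc hS.continuousOn_Icc))
  exact hS.continuousOn_Icc.comp continuousOn_fst fun _ hx => hx.1

lemma secondLevel_self (t : ℝ) : secondLevel S P t t = 0 := by
  simp [secondLevel, inc, tensor_zero]

/-- Increments of the left-point sums between points of the partition. -/
lemma riemannSum_succ_sub (hP : GridSeq P) (n k : ℕ) :
    riemannSum S (grid P T n) (grid P T n (k + 1)) - riemannSum S (grid P T n) (grid P T n k)
      = tensor (S (grid P T n k)) (inc S (grid P T n k) (grid P T n (k + 1))) := by
  have hm := hP.grid_mono (T := T) n
  set N := max (numPts P T n) (k + 1)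
  rw [riemannSum_eq_sum hP n N (le_max_left _ _),
    riemannSum_eq_sum hP n N (le_max_left _ _), ← Finset.sum_sub_distrib]
  rw [Finset.sum_eq_single_of_mem k (Finset.mem_range.2 (lt_max_of_lt_right k.lt_succ_self))]
  · rw [min_eq_left (hm (Nat.le_succ k)), min_self, min_self, min_eq_right (hm (Nat.le_succ k))]
    simp [inc, tensor_zero]
  · intro j _ hj
    rcases lt_or_gt_of_ne hj with h | h
    · rw [min_eq_left (hm (show j ≤ k + 1 by omega)), min_eq_left (hm (show j + 1 ≤ k + 1 by omega)),
        min_eq_left (hm (show j ≤ k by omega)), min_eq_left (hm (show j + 1 ≤ k by omega)), sub_self]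
    · rw [min_eq_right (hm (show k + 1 ≤ j by omega)),
        min_eq_right (hm (show k + 1 ≤ j + 1 by omega)), min_eq_right (hm (show k ≤ j by omega)),
        min_eq_right (hm (show k ≤ j + 1 by omega))]
      simp [inc, tensor_zero]

open Classical in
/-- The index of the first point of the restricted partition at or after `v`. -/
noncomputable def nextIdx (P : ℕ → ℕ → ℝ) (T : ℝ) (n : ℕ) (v : ℝ) : ℕ :=
  sInf {k | v ≤ grid P T n k}

lemma le_grid_nextIdx (hP : GridSeq P) (n : ℕ) {v : ℝ} (hv : v ≤ T) :
    v ≤ grid P T n (nextIdx P T n v) := by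
  have h : {k | v ≤ grid P T n k}.Nonempty := ⟨numPts P T n, by simpa [hP.grid_last n] using hv⟩
  exact Nat.sInf_mem h

lemma nextIdx_mono (hP : GridSeq P) (n : ℕ) {v v' : ℝ} (h : v ≤ v') (hv : v' ≤ T) :
    nextIdx P T n v ≤ nextIdx P T n v' :=
  Nat.sInf_le (h.trans (le_grid_nextIdx hP n hv))

lemma grid_nextIdx_tendsto (hP : GridSeq P) (hT : 0 < T) {v : ℝ} (hv0 : 0 ≤ v) (hv : v ≤ T) :
    Tendsto (fun n => grid P T n (nextIdx P T n v)) atTop (𝓝 v) := by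
  rw [Metric.tendsto_nhds]
  intro ε hε
  filter_upwards [hP.mesh T hT ε hε] with n hn
  have h1 := le_grid_nextIdx hP n hv
  rw [Real.dist_eq, abs_of_nonneg (by linarith)]
  rcases Nat.eq_zero_or_pos (nextIdx P T n v) with h | h
  · rw [h, hP.grid_zero hT.le]; linarith
  · have h2 : ¬ v ≤ grid P T n (nextIdx P T n v - 1) := fun h3 => by
      have : nextIdx P T n v ≤ nextIdx P T n v - 1 := Nat.sInf_le h3
      omega
    have h3 := hn (nextIdx P T n v - 1)
    rw [show nextIdx P T n v - 1 + 1 = nextIdx P T n v by omega] at h3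
    push Not at h2
    linarith

lemma grid_mem (hP : GridSeq P) (hT : 0 ≤ T) (n k : ℕ) : grid P T n k ∈ Icc 0 T :=
  ⟨hP.grid_nonneg hT n k, grid_le n k⟩

lemma pVar_secondLevel_lt_top (hp : 0 < p) (hS : IsPricePath p S P) (hT : 0 < T) :
    pVar (p / 2) (secondLevel S P) 0 T < ⊤ := by
  obtain ⟨c, hc, -, hc2⟩ := (hS.rie T hT).control
  have hP := hS.gridSeq
  rw [pVar_eq_varSum (by positivity)]
  refine ENNReal.rpow_lt_top_of_nonneg (by positivity) (ne_of_lt ?_)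
  refine lt_of_le_of_lt (iSup_le fun w => ?_) (ENNReal.ofReal_lt_top (r := c 0 T))
  obtain ⟨N, u, hu, hu'⟩ := w
  simp only
  have e1 : ∀ i ∈ Finset.range N, ‖secondLevel S P (u i) (u (i + 1))‖ₑ ^ (p / 2)
      = ENNReal.ofReal (‖secondLevel S P (u i) (u (i + 1))‖ ^ (p / 2)) := fun i _ => by
    rw [← ofReal_norm, ENNReal.ofReal_rpow_of_nonneg (norm_nonneg _) (by positivity)]
  rw [Finset.sum_congr rfl e1, ← ENNReal.ofReal_sum_of_nonneg fun i _ => by positivity]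
  refine ENNReal.ofReal_le_ofReal ?_
  set a : ℕ → ℕ → ℝ := fun n i => grid P T n (nextIdx P T n (u i)) with ha
  have ha1 : ∀ i, Tendsto (fun n => a n i) atTop (𝓝[Icc 0 T] (u i)) := fun i =>
    tendsto_nhdsWithin_iff.2 ⟨grid_nextIdx_tendsto hP hT (hu' i).1 (hu' i).2,
      Eventually.of_forall fun n => grid_mem hP hT.le n _⟩
  have hR : ∀ i, Tendsto (fun n => riemannSum S (grid P T n) (a n i)) atTop
      (𝓝 (pathIntegral S P (u i))) := fun i =>
    (tendstoUniformlyOn_pathIntegral hS hT).tendsto_comp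
      (continuousOn_pathIntegral hS hT _ (hu' i)) (ha1 i)
  have hSa : ∀ i, Tendsto (fun n => S (a n i)) atTop (𝓝 (S (u i))) := fun i =>
    (hS.continuousOn_Icc (T := T) _ (hu' i)).tendsto.comp (ha1 i)
  have hlim : Tendsto (fun n => ∑ i ∈ Finset.range N,
      ‖riemannSum S (grid P T n) (a n (i + 1)) - riemannSum S (grid P T n) (a n i)
        - tensor (S (a n i)) (inc S (a n i) (a n (i + 1)))‖ ^ (p / 2)) atTop
      (𝓝 (∑ i ∈ Finset.range N, ‖secondLevel S P (u i) (u (i + 1))‖ ^ (p / 2))) := by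
    refine tendsto_finsetSum _ fun i _ => ?_
    refine ((((hR (i + 1)).sub (hR i)).sub ?_).norm).rpow_const (Or.inr (by positivity))
    exact (continuous_tensor.tendsto _).comp
      ((hSa i).prodMk_nhds ((hSa (i + 1)).sub (hSa i)))
  refine le_of_tendsto hlim (Eventually.of_forall fun n => ?_)
  have hidx : ∀ i, nextIdx P T n (u i) ≤ nextIdx P T n (u (i + 1)) := fun i =>
    nextIdx_mono hP n (hu (Nat.le_succ i)) (hu' _).2
  have hle : ∀ i, a n i ≤ a n (i + 1) := fun i => hP.grid_mono n (hidx i)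
  refine (Finset.sum_le_sum fun i _ => ?_ : _ ≤ ∑ i ∈ Finset.range N, c (a n i) (a n (i + 1))).trans
    ((hc.sum_le (fun i _ => hle i) (hP.grid_nonneg hT.le n _) (grid_le n _)).trans
      (hc.mono le_rfl (hP.grid_nonneg hT.le n _)
        (hP.grid_mono n (nextIdx_mono hP n (hu (Nat.zero_le N)) (hu' _).2)) (grid_le n _) le_rfl))
  rcases (hidx i).lt_or_eq with h | h
  · exact hc2 n _ _ h
  · have h2 : a n (i + 1) = a n i := by simp only [ha, h]
    rw [h2]
    simp only [inc, sub_self, tensor_zero, norm_zero]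
    rw [Real.zero_rpow (by positivity)]
    exact hc.1 _ _ (hP.grid_nonneg hT.le n _) le_rfl (grid_le n _)

lemma pVar_path_lt_top (hp : 0 < p) (hS : IsPricePath p S P) (hT : 0 < T) :
    pVar p (inc S) 0 T < ⊤ := by
  obtain ⟨c, hc, hc1, -⟩ := (hS.rie T hT).control
  exact pVar_lt_top_of_control hp hc hc1

/-- Sums of the second level against a path of complementary variation vanish in the limit along
the given partitions. -/
lemma psum_smul_secondLevel_tendsto (hp : 2 < p) (hS : IsPricePath p S P) (hT : 0 ≤ T)
    {κ : ℝ} (hκ : 0 < κ) (hκ1 : κ < 1) (hκp : 1 < 2 / p + κ) {b : ℝ → ℝ} {c : ℝ → ℝ → ℝ}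
    (hc : IsControl T c) (hb : ∀ s t, 0 ≤ s → s ≤ t → t ≤ T → |b t - b s| ≤ c s t ^ κ) :
    Tendsto (psum P T fun s t => b s • secondLevel S P s t) atTop (𝓝 0) := by
  have hP := hS.gridSeq
  rcases hT.eq_or_lt with rfl | hT0
  · have h : ∀ n, psum P 0 (fun s t => b s • secondLevel S P s t) n = 0 := fun n => by
      refine Finset.sum_eq_zero fun i _ => ?_
      have h1 : ∀ k, grid P 0 n k = 0 := fun k => le_antisymm (grid_le n k) (hP.grid_nonneg le_rfl n k)
      rw [h1, h1]; simp [secondLevel_self]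
    simp only [funext h]
    exact tendsto_const_nhds
  obtain ⟨c0, hc0, -, hc2⟩ := (hS.rie T hT0).control
  have hfin := pVar_secondLevel_lt_top (by linarith : 0 < p) hS hT0
  have hp2 : 0 < p / 2 := by linarith
  have h2p : 0 < 2 / p := by positivity
  have hĉ := isControl_varControl hp2 hfin
  set ĉ := varControl (p / 2) (secondLevel S P)
  set w : ℝ → ℝ → ℝ := fun s t => c s t + (ĉ s t + c0 s t) with hw
  have hwc : IsControl T w := hc.add (hĉ.add hc0)
  set η := (κ + 2 / p - 1) / (2 * (2 / p)) with hη
  set θ := κ + (2 / p) * (1 - η) with hθdef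
  have hη0 : 0 < η := by apply div_pos <;> linarith
  have hη1 : η < 1 := by rw [hη, div_lt_one (by positivity)]; linarith
  have hθ : 1 < θ := by
    have : (2 / p) * η = (κ + 2 / p - 1) / 2 := by rw [hη]; field_simp
    have : θ = κ + 2 / p - (2 / p) * η := by rw [hθdef]; ring
    linarith
  set ψ : ℕ → ℝ → Mat d := fun n t => pathIntegral S P t - riemannSum S (grid P T n) t with hψ
  have hψ0 : ∀ ε > 0, ∀ᶠ n in atTop, ∀ t ∈ Icc 0 T, ‖ψ n t‖ < ε := by
    intro ε hε
    have := Metric.tendstoUniformlyOn_iff.1 (tendstoUniformlyOn_pathIntegral hS hT0) ε hε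
    simpa only [dist_eq_norm] using this
  have hmain : ∀ ε > 0, ∀ᶠ n in atTop, ‖psum P T (fun s t => b s • secondLevel S P s t) n‖
      ≤ |b 0| * ε + 2 * ε ^ η * sewC θ * w 0 T ^ θ := by
    intro ε hε
    filter_upwards [hψ0 (ε / 2) (by positivity)] with n hn
    set u := grid P T n with hu
    have hu0 : ∀ i, 0 ≤ u i := hP.grid_nonneg hT n
    have huT : ∀ i, u i ≤ T := grid_le n
    have hum : Monotone u := hP.grid_mono n
    have hψε : ∀ i j, ‖ψ n (u j) - ψ n (u i)‖ ≤ ε := fun i j =>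
      (norm_sub_le _ _).trans (by
        linarith [hn (u j) ⟨hu0 j, huT j⟩, hn (u i) ⟨hu0 i, huT i⟩])
    have hψw : ∀ i j, i ≤ j → ‖ψ n (u j) - ψ n (u i)‖ ≤ 2 * w (u i) (u j) ^ (2 / p) := by
      intro i j hij
      have a0 := hc.1 _ _ (hu0 i) (hum hij) (huT j)
      have a1 := hĉ.1 _ _ (hu0 i) (hum hij) (huT j)
      have a2 := hc0.1 _ _ (hu0 i) (hum hij) (huT j)
      rcases hij.eq_or_lt with rfl | h
      · rw [sub_self, norm_zero]; positivity
      have h1 : ‖secondLevel S P (u i) (u j)‖ ≤ w (u i) (u j) ^ (2 / p) := by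
        have := norm_le_varControl hp2 hfin (hu0 i) (hum hij) (huT j)
        rw [one_div_div] at this
        exact this.trans (Real.rpow_le_rpow a1 (by simp only [hw]; linarith) h2p.le)
      have h2 : ‖riemannSum S u (u j) - riemannSum S u (u i) - tensor (S (u i))
          (inc S (u i) (u j))‖ ≤ w (u i) (u j) ^ (2 / p) := by
        have h3 : ‖riemannSum S u (u j) - riemannSum S u (u i) - tensor (S (u i))
          (inc S (u i) (u j))‖ ^ (p / 2) ≤ c0 (u i) (u j) := hc2 n i j h
        have := Real.rpow_le_rpow (by positivity) h3 h2p.le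
        rw [← Real.rpow_mul (norm_nonneg _), div_mul_div_cancel₀ (by norm_num),
          div_self (by linarith), Real.rpow_one] at this
        exact this.trans (Real.rpow_le_rpow a2 (by simp only [hw]; linarith) h2p.le)
      have h3 : ψ n (u j) - ψ n (u i) = secondLevel S P (u i) (u j) -
          (riemannSum S u (u j) - riemannSum S u (u i) - tensor (S (u i)) (inc S (u i) (u j))) := by
        simp only [hψ, secondLevel, inc]; abel
      rw [h3]
      exact (norm_sub_le _ _).trans (by linarith)
    have h1 := discrete_sewing (Ξ := fun i j => b (u i) • (ψ n (u j) - ψ n (u i)))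
      (w := fun i j => w (u i) (u j)) (K := 2 * ε ^ η) hθ (by positivity) (N := numPts P T n)
      (fun i j hij _ => hwc.1 _ _ (hu0 i) (hum hij) (huT j))
      (fun i j k hij hjk _ => hwc.2 _ _ _ (hu0 i) (hum hij) (hum hjk) (huT k))
      (fun i j k hij hjk _ => by
        have e : b (u i) • (ψ n (u k) - ψ n (u i)) - b (u i) • (ψ n (u j) - ψ n (u i))
            - b (u j) • (ψ n (u k) - ψ n (u j)) = -(b (u j) - b (u i)) • (ψ n (u k) - ψ n (u j)) := by
          simp only [smul_sub, sub_smul, neg_smul]; abel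
        have hij' := hum hij
        have hjk' := hum hjk
        have w1 : w (u j) (u k) ≤ w (u i) (u k) := hwc.mono (hu0 i) hij' hjk' le_rfl (huT k)
        have w2 : c (u i) (u j) ≤ w (u i) (u k) := by
          have := hwc.mono (hu0 i) le_rfl hij' hjk' (huT k)
          have a1 := hĉ.1 _ _ (hu0 i) hij' (huT j)
          have a2 := hc0.1 _ _ (hu0 i) hij' (huT j)
          have : w (u i) (u j) = c (u i) (u j) + (ĉ (u i) (u j) + c0 (u i) (u j)) := rfl
          linarith
        have w0 := hwc.1 _ _ (hu0 j) hjk' (huT k)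
        have w3 := w0.trans w1
        set x := ‖ψ n (u k) - ψ n (u j)‖ with hx
        have hx0 : 0 ≤ x := norm_nonneg _
        have x1 : x ≤ ε ^ η * (2 * w (u i) (u k) ^ (2 / p)) ^ (1 - η) := by
          calc x = x ^ (η + (1 - η)) := by rw [add_sub_cancel, Real.rpow_one]
            _ = x ^ η * x ^ (1 - η) := Real.rpow_add_of_nonneg hx0 hη0.le (by linarith)
            _ ≤ _ := by
              refine mul_le_mul (Real.rpow_le_rpow hx0 (hψε _ _) hη0.le)
                (Real.rpow_le_rpow hx0 ((hψw j k hjk).trans ?_) (by linarith)) (by positivity)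
                (by positivity)
              have := Real.rpow_le_rpow w0 w1 h2p.le
              linarith
        have x2 : (2 * w (u i) (u k) ^ (2 / p)) ^ (1 - η)
            ≤ 2 * w (u i) (u k) ^ ((2 / p) * (1 - η)) := by
          rw [Real.mul_rpow two_pos.le (by positivity), ← Real.rpow_mul w3]
          refine mul_le_mul_of_nonneg_right ?_ (by positivity)
          calc (2 : ℝ) ^ (1 - η) ≤ 2 ^ (1 : ℝ) :=
                Real.rpow_le_rpow_of_exponent_le one_le_two (by linarith)
            _ = 2 := Real.rpow_one _
        rw [e, norm_smul, norm_neg, Real.norm_eq_abs]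
        have b1 := (hb _ _ (hu0 i) hij' (huT j)).trans (Real.rpow_le_rpow
          (hc.1 _ _ (hu0 i) hij' (huT j)) w2 hκ.le)
        calc |b (u j) - b (u i)| * x ≤ w (u i) (u k) ^ κ *
              (ε ^ η * (2 * w (u i) (u k) ^ ((2 / p) * (1 - η)))) :=
              mul_le_mul b1 (x1.trans (mul_le_mul_of_nonneg_left x2 (by positivity))) hx0
                (by positivity)
          _ = 2 * ε ^ η * w (u i) (u k) ^ θ := by
              rw [hθdef, Real.rpow_add_of_nonneg w3 hκ.le
                (mul_nonneg h2p.le (by linarith))]; ring)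
      (fun i _ => by simp) (numPts P T n) 0 (by omega)
    have h2 : psum P T (fun s t => b s • secondLevel S P s t) n =
        ∑ k ∈ Finset.range (numPts P T n), b (u (0 + k)) • (ψ n (u (0 + k + 1)) - ψ n (u (0 + k))) := by
      refine Finset.sum_congr rfl fun k _ => ?_
      have e1 := riemannSum_succ_sub (S := S) hP (T := T) n k
      have e2 : ψ n (u (k + 1)) - ψ n (u k) = secondLevel S P (u k) (u (k + 1)) := by
        simp only [hψ, secondLevel, hu]
        rw [← e1]
        simp only [inc]
        abel
      rw [zero_add, e2]
    have h3 : ‖b (u 0) • (ψ n (u (0 + numPts P T n)) - ψ n (u 0))‖ ≤ |b 0| * ε := by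
      rw [norm_smul, Real.norm_eq_abs, hu, hP.grid_zero hT]
      refine mul_le_mul_of_nonneg_left ?_ (abs_nonneg _)
      have := hψε 0 (0 + numPts P T n)
      rwa [hu, hP.grid_zero hT] at this
    rw [← h2] at h1
    have h4 : w (u 0) (u (0 + numPts P T n)) = w 0 T := by
      rw [zero_add, hu, hP.grid_zero hT, hP.grid_last]
    rw [h4] at h1
    have h5 := norm_add_le (psum P T (fun s t => b s • secondLevel S P s t) n
      - b (u 0) • (ψ n (u (0 + numPts P T n)) - ψ n (u 0)))
      (b (u 0) • (ψ n (u (0 + numPts P T n)) - ψ n (u 0)))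
    rw [sub_add_cancel] at h5
    linarith
  have hlim : Tendsto (fun ε : ℝ => |b 0| * ε + 2 * ε ^ η * sewC θ * w 0 T ^ θ) (𝓝[>] 0) (𝓝 0) := by
    have h1 : ContinuousAt (fun ε : ℝ => |b 0| * ε + 2 * ε ^ η * sewC θ * w 0 T ^ θ) 0 := by
      have : ContinuousAt (fun ε : ℝ => ε ^ η) 0 :=
        Real.continuousAt_rpow_const _ _ (Or.inr hη0.le)
      fun_prop
    have h2 := h1.tendsto
    simp only [mul_zero, Real.zero_rpow hη0.ne', zero_mul, add_zero] at h2
    exact h2.mono_left nhdsWithin_le_nhds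
  rw [Metric.tendsto_nhds]
  intro ε hε
  obtain ⟨ε', h1, h2⟩ := ((hlim.eventually (gt_mem_nhds hε)).and self_mem_nhdsWithin).exists
  filter_upwards [hmain ε' h2] with n hn
  rw [dist_zero_right]
  exact hn.trans_lt h1

end Rough

open Asymptotics

/-! ### Landau calculus on increments -/

section Landau

/-- Landau symbols with respect to this filter are uniform bounds in the index and in
`0 ≤ s ≤ t ≤ T`. -/
def tri (ι : Type*) (T : ℝ) : Filter (ι × ℝ × ℝ) := 𝓟 {x | 0 ≤ x.2.1 ∧ x.2.1 ≤ x.2.2 ∧ x.2.2 ≤ T}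

/-- Landau symbols with respect to this filter are uniform bounds in the index and in
`0 ≤ s ≤ u ≤ t ≤ T`. -/
def tri3 (ι : Type*) (T : ℝ) : Filter (ι × ℝ × ℝ × ℝ) :=
  𝓟 {x | 0 ≤ x.2.1 ∧ x.2.1 ≤ x.2.2.1 ∧ x.2.2.1 ≤ x.2.2.2 ∧ x.2.2.2 ≤ T}

/-- The gauge `c(s, t)^a`. -/
noncomputable def gau {ι : Type*} (c : ℝ → ℝ → ℝ) (a : ℝ) (x : ι × ℝ × ℝ) : ℝ := c x.2.1 x.2.2 ^ a

/-- The gauge `c(s, t)^a` for triples `s ≤ u ≤ t`. -/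
noncomputable def gau3 {ι : Type*} (c : ℝ → ℝ → ℝ) (a : ℝ) (x : ι × ℝ × ℝ × ℝ) : ℝ :=
  c x.2.1 x.2.2.2 ^ a

variable {ι X E : Type*} [NormedAddCommGroup E] {T a : ℝ} {c : ℝ → ℝ → ℝ} {l : Filter X} {h : X → ℝ}

lemma bigO_mul {f g : X → ℝ} {n m : ℕ} (hf : f =O[l] fun x => h x ^ n)
    (hg : g =O[l] fun x => h x ^ m) : (fun x => f x * g x) =O[l] fun x => h x ^ (n + m) := by
  simp only [pow_add]; exact hf.mul hg

lemma bigO_one_mul {f g : X → ℝ} {k : X → ℝ} (hf : f =O[l] fun _ => (1 : ℝ)) (hg : g =O[l] k) :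
    (fun x => f x * g x) =O[l] k := by
  simpa using hf.mul hg

lemma bigO_mul_one {f g : X → ℝ} {k : X → ℝ} (hf : f =O[l] k) (hg : g =O[l] fun _ => (1 : ℝ)) :
    (fun x => f x * g x) =O[l] k := by
  simpa using hf.mul hg

lemma bigO_pow_mono (hh : h =O[l] fun _ => (1 : ℝ)) {n m : ℕ} (hnm : n ≤ m) :
    (fun x => h x ^ m) =O[l] fun x => h x ^ n := by
  obtain ⟨k, rfl⟩ := Nat.exists_eq_add_of_le hnm
  simp only [pow_add]
  have h1 : (fun x => h x ^ k) =O[l] fun _ => (1 : ℝ) := by simpa using hh.pow k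
  simpa using (isBigO_refl (fun x => h x ^ n) l).mul h1

lemma bigO_tri_iff {f : ι → ℝ → ℝ → E} {g : ι → ℝ → ℝ → ℝ} :
    (fun x : ι × ℝ × ℝ => f x.1 x.2.1 x.2.2) =O[tri ι T] (fun x => g x.1 x.2.1 x.2.2) ↔
      ∃ C, ∀ i s t, 0 ≤ s → s ≤ t → t ≤ T → ‖f i s t‖ ≤ C * ‖g i s t‖ := by
  rw [tri, isBigO_principal]
  exact ⟨fun ⟨C, hC⟩ => ⟨C, fun i s t h1 h2 h3 => hC (i, s, t) ⟨h1, h2, h3⟩⟩,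
    fun ⟨C, hC⟩ => ⟨C, fun x hx => hC _ _ _ hx.1 hx.2.1 hx.2.2⟩⟩

lemma bigO_tri3_iff {f : ι → ℝ → ℝ → ℝ → E} {g : ι → ℝ → ℝ → ℝ → ℝ} :
    (fun x : ι × ℝ × ℝ × ℝ => f x.1 x.2.1 x.2.2.1 x.2.2.2) =O[tri3 ι T]
        (fun x => g x.1 x.2.1 x.2.2.1 x.2.2.2) ↔
      ∃ C, ∀ i s u t, 0 ≤ s → s ≤ u → u ≤ t → t ≤ T → ‖f i s u t‖ ≤ C * ‖g i s u t‖ := by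
  rw [tri3, isBigO_principal]
  exact ⟨fun ⟨C, hC⟩ => ⟨C, fun i s u t h1 h2 h3 h4 => hC (i, s, u, t) ⟨h1, h2, h3, h4⟩⟩,
    fun ⟨C, hC⟩ => ⟨C, fun x hx => hC _ _ _ _ hx.1 hx.2.1 hx.2.2.1 hx.2.2.2⟩⟩

lemma bigO_of_le {f : ℝ → ℝ → E} {g : ℝ → ℝ → ℝ}
    (h : ∀ s t, 0 ≤ s → s ≤ t → t ≤ T → ‖f s t‖ ≤ g s t) :
    (fun x : ι × ℝ × ℝ => f x.2.1 x.2.2) =O[tri ι T] fun x => g x.2.1 x.2.2 :=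
  (bigO_tri_iff (f := fun _ => f) (g := fun _ => g)).2
    ⟨1, fun _ s t h1 h2 h3 => (h s t h1 h2 h3).trans (by rw [one_mul]; exact le_abs_self _)⟩

lemma gau_bounded (hc : IsControl T c) (ha : 0 ≤ a) :
    gau (ι := ι) c a =O[tri ι T] fun _ => (1 : ℝ) := by
  refine bigO_tri_iff (f := fun _ s t => c s t ^ a) (g := fun _ _ _ => 1) |>.2
    ⟨c 0 T ^ a, fun _ s t h1 h2 h3 => ?_⟩
  have := hc.1 s t h1 h2 h3
  rw [Real.norm_of_nonneg (by positivity), norm_one, mul_one]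
  exact Real.rpow_le_rpow this (hc.mono le_rfl h1 h2 h3 le_rfl) ha

lemma gau3_bounded (hc : IsControl T c) (ha : 0 ≤ a) :
    gau3 (ι := ι) c a =O[tri3 ι T] fun _ => (1 : ℝ) := by
  refine bigO_tri3_iff (f := fun _ s _ t => c s t ^ a) (g := fun _ _ _ _ => 1) |>.2
    ⟨c 0 T ^ a, fun _ s u t h1 h2 h3 h4 => ?_⟩
  have := hc.1 s t h1 (h2.trans h3) h4
  rw [Real.norm_of_nonneg (by positivity), norm_one, mul_one]
  exact Real.rpow_le_rpow this (hc.mono le_rfl h1 (h2.trans h3) h4 le_rfl) ha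

/-- Bounds on `(s, u)` give bounds on triples. -/
lemma bigO_left {f : ι × ℝ × ℝ → E} {g : ι × ℝ × ℝ → ℝ} (hf : f =O[tri ι T] g) :
    (fun x : ι × ℝ × ℝ × ℝ => f (x.1, x.2.1, x.2.2.1)) =O[tri3 ι T]
      fun x => g (x.1, x.2.1, x.2.2.1) := by
  refine hf.comp_tendsto (tendsto_principal_principal.2 fun x hx => ?_)
  exact ⟨hx.1, hx.2.1, hx.2.2.1.trans hx.2.2.2⟩

lemma bigO_right {f : ι × ℝ × ℝ → E} {g : ι × ℝ × ℝ → ℝ} (hf : f =O[tri ι T] g) :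
    (fun x : ι × ℝ × ℝ × ℝ => f (x.1, x.2.2.1, x.2.2.2)) =O[tri3 ι T]
      fun x => g (x.1, x.2.2.1, x.2.2.2) := by
  refine hf.comp_tendsto (tendsto_principal_principal.2 fun x hx => ?_)
  exact ⟨hx.1.trans hx.2.1, hx.2.2.1, hx.2.2.2⟩

lemma gau_left (hc : IsControl T c) (ha : 0 ≤ a) :
    (fun x : ι × ℝ × ℝ × ℝ => gau c a (x.1, x.2.1, x.2.2.1)) =O[tri3 ι T] gau3 c a := by
  refine (bigO_tri3_iff (f := fun _ s u _ => c s u ^ a) (g := fun _ s _ t => c s t ^ a)).2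
    ⟨1, fun _ s u t h1 h2 h3 h4 => ?_⟩
  have e1 := hc.1 s u h1 h2 (h3.trans h4)
  have e2 := hc.1 s t h1 (h2.trans h3) h4
  rw [Real.norm_of_nonneg (by positivity), Real.norm_of_nonneg (by positivity), one_mul]
  exact Real.rpow_le_rpow e1 (hc.mono h1 le_rfl h2 h3 h4) ha

lemma gau_right (hc : IsControl T c) (ha : 0 ≤ a) :
    (fun x : ι × ℝ × ℝ × ℝ => gau c a (x.1, x.2.2.1, x.2.2.2)) =O[tri3 ι T] gau3 c a := by
  refine (bigO_tri3_iff (f := fun _ _ u t => c u t ^ a) (g := fun _ s _ t => c s t ^ a)).2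
    ⟨1, fun _ s u t h1 h2 h3 h4 => ?_⟩
  have e1 := hc.1 u t (h1.trans h2) h3 h4
  have e2 := hc.1 s t h1 (h2.trans h3) h4
  rw [Real.norm_of_nonneg (by positivity), Real.norm_of_nonneg (by positivity), one_mul]
  exact Real.rpow_le_rpow e1 (hc.mono h1 h2 h3 le_rfl h4) ha

lemma gau_mono_exp (hc : IsControl T c) {b : ℝ} (ha : 0 ≤ a) (hab : a ≤ b) :
    gau (ι := ι) c b =O[tri ι T] gau c a := by
  refine (bigO_tri_iff (f := fun _ s t => c s t ^ b) (g := fun _ s t => c s t ^ a)).2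
    ⟨c 0 T ^ (b - a), fun _ s t h1 h2 h3 => ?_⟩
  have e := hc.1 s t h1 h2 h3
  rw [Real.norm_of_nonneg (by positivity), Real.norm_of_nonneg (by positivity)]
  calc c s t ^ b = c s t ^ (b - a) * c s t ^ a := by
        rw [← Real.rpow_add_of_nonneg e (by linarith) ha]; ring_nf
    _ ≤ _ := mul_le_mul_of_nonneg_right
      (Real.rpow_le_rpow e (hc.mono le_rfl h1 h2 h3 le_rfl) (by linarith)) (by positivity)

lemma bigO_start {f : ℝ → E} (hf : ContinuousOn f (Icc 0 T)) :
    (fun x : ι × ℝ × ℝ => f x.2.1) =O[tri ι T] fun _ => (1 : ℝ) := by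
  obtain ⟨C, hC⟩ := isCompact_Icc.exists_bound_of_continuousOn hf
  exact (bigO_tri_iff (f := fun _ s _ => f s) (g := fun _ _ _ => 1)).2
    ⟨C, fun _ s t h1 h2 h3 => by simpa using hC s ⟨h1, h2.trans h3⟩⟩

lemma bigO_end {f : ℝ → E} (hf : ContinuousOn f (Icc 0 T)) :
    (fun x : ι × ℝ × ℝ => f x.2.2) =O[tri ι T] fun _ => (1 : ℝ) := by
  obtain ⟨C, hC⟩ := isCompact_Icc.exists_bound_of_continuousOn hf
  exact (bigO_tri_iff (f := fun _ _ t => f t) (g := fun _ _ _ => 1)).2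
    ⟨C, fun _ s t h1 h2 h3 => by simpa using hC t ⟨h1.trans h2, h3⟩⟩

/-- A path with increments of order `g`. -/
def IncO (T : ℝ) (g : Unit × ℝ × ℝ → ℝ) (f : ℝ → ℝ) : Prop :=
  (fun x : Unit × ℝ × ℝ => f x.2.2 - f x.2.1) =O[tri Unit T] g

variable {g : Unit × ℝ × ℝ → ℝ} {f f' : ℝ → ℝ}

lemma IncO.add (hf : IncO T g f) (hf' : IncO T g f') : IncO T g fun t => f t + f' t :=
  (IsBigO.add hf hf').congr_left fun x => by ring

lemma IncO.neg (hf : IncO T g f) : IncO T g fun t => - f t :=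
  (IsBigO.neg_left hf).congr_left fun x => by ring

lemma IncO.const (a : ℝ) : IncO T g fun _ => a := by
  simp only [IncO, sub_self]; exact isBigO_zero _ _

lemma IncO.sum {κ : Type*} (s : Finset κ) {f : κ → ℝ → ℝ} (hf : ∀ k ∈ s, IncO T g (f k)) :
    IncO T g fun t => ∑ k ∈ s, f k t := by
  refine (IsBigO.fun_sum (A := fun k (x : Unit × ℝ × ℝ) => f k x.2.2 - f k x.2.1) hf).congr_left
    fun x => by simp only [Finset.sum_sub_distrib]

lemma IncO.mul (hf : IncO T g f) (hf' : IncO T g f') (hc : ContinuousOn f (Icc 0 T))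
    (hc' : ContinuousOn f' (Icc 0 T)) : IncO T g fun t => f t * f' t := by
  have h1 := (bigO_mul_one hf (bigO_end (ι := Unit) hc')).add
    (bigO_one_mul (bigO_start (ι := Unit) hc) hf')
  exact h1.congr_left fun x => by ring

lemma IncO.inv (hf : IncO T g f) (hc : ContinuousOn f (Icc 0 T)) (h0 : ∀ t ∈ Icc 0 T, f t ≠ 0) :
    IncO T g fun t => (f t)⁻¹ := by
  have hi := hc.inv₀ h0
  have h1 := bigO_mul_one (bigO_mul_one (IsBigO.neg_left hf) (bigO_end (ι := Unit) hi))
    (bigO_start (ι := Unit) hi)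
  refine h1.congr' ?_ EventuallyEq.rfl
  refine eventually_principal.2 fun x hx => ?_
  have a1 := h0 x.2.1 ⟨hx.1, hx.2.1.trans hx.2.2⟩
  have a2 := h0 x.2.2 ⟨hx.1.trans hx.2.1, hx.2.2⟩
  simp only [Pi.inv_apply]
  field_simp
  ring

lemma IncO.mono {g' : Unit × ℝ × ℝ → ℝ} (hf : IncO T g f) (hg : g =O[tri Unit T] g') :
    IncO T g' f := IsBigO.trans hf hg

lemma IncO.exists_control {κ : ℝ} (hκ : 0 < κ) (hc : IsControl T c) (hf : IncO T (gau c κ) f) :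
    ∃ c', IsControl T c' ∧ ∀ s t, 0 ≤ s → s ≤ t → t ≤ T → |f t - f s| ≤ c' s t ^ κ := by
  obtain ⟨C, hC⟩ := (bigO_tri_iff (f := fun (_ : Unit) s t => f t - f s)
    (g := fun _ s t => c s t ^ κ)).1 hf
  refine ⟨fun s t => |C| ^ (1 / κ) * c s t, hc.const_mul (by positivity), fun s t h1 h2 h3 => ?_⟩
  have := hc.1 s t h1 h2 h3
  have h4 := hC () s t h1 h2 h3
  rw [Real.norm_eq_abs, Real.norm_of_nonneg (by positivity)] at h4
  rw [Real.mul_rpow (by positivity) this, ← Real.rpow_mul (abs_nonneg _),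
    one_div_mul_cancel hκ.ne', Real.rpow_one]
  exact h4.trans (mul_le_mul_of_nonneg_right (le_abs_self C) (by positivity))

end Landau

/-! ### Controlled paths and the wealth of a portfolio -/

section Controlled

variable {ι : Type*} {d : ℕ} {p q T : ℝ} {S : ℝ → Vec d} {P : ℕ → ℕ → ℝ} {ω : ℝ → ℝ → ℝ}

/-- The control function `ω` bounds the rough path of `S` on `[0, T]`. -/
structure RoughCtl (p T : ℝ) (S : ℝ → Vec d) (P : ℕ → ℕ → ℝ) (ω : ℝ → ℝ → ℝ) : Prop where
  reg : IsRegularControl T ω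
  path : ∀ s t, 0 ≤ s → s ≤ t → t ≤ T → ‖inc S s t‖ ≤ ω s t ^ (1 / p)
  level : ∀ s t, 0 ≤ s → s ≤ t → t ≤ T → ‖secondLevel S P s t‖ ≤ ω s t ^ (2 / p)

lemma RoughCtl.add (hp : 0 < p) (h : RoughCtl p T S P ω) {c : ℝ → ℝ → ℝ} (hc : IsRegularControl T c) :
    RoughCtl p T S P (fun s t => ω s t + c s t) := by
  refine ⟨h.reg.add hc, fun s t h1 h2 h3 => (h.path s t h1 h2 h3).trans ?_,
    fun s t h1 h2 h3 => (h.level s t h1 h2 h3).trans ?_⟩ <;>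
  exact Real.rpow_le_rpow (h.reg.1.1 s t h1 h2 h3) (by linarith [hc.1.1 s t h1 h2 h3])
    (by positivity)

lemma RoughCtl.restrict {T' : ℝ} (hT : T' ≤ T) (h : RoughCtl p T S P ω) : RoughCtl p T' S P ω :=
  ⟨h.reg.restrict hT, fun s t h1 h2 h3 => h.path s t h1 h2 (h3.trans hT),
    fun s t h1 h2 h3 => h.level s t h1 h2 (h3.trans hT)⟩

lemma exists_roughCtl (hp : 0 < p) (hS : IsPricePath p S P) (hT : 0 ≤ T) :
    ∃ ω, RoughCtl p T S P ω := by
  have hT1 : 0 < T + 1 := by linarith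
  have f1 := pVar_path_lt_top hp hS hT1
  have f2 := pVar_secondLevel_lt_top hp hS hT1
  have hp2 : 0 < p / 2 := by linarith
  have r1 := isRegularControl_varControl hp f1 (contOnSq_inc hS.continuousOn_Icc) (by simp [inc])
  have r2 := isRegularControl_varControl hp2 f2 (contOnSq_secondLevel hS hT1) secondLevel_self
  refine ⟨_, RoughCtl.restrict (T := T + 1) (by linarith) ⟨r1.add r2, fun s t h1 h2 h3 => ?_,
    fun s t h1 h2 h3 => ?_⟩⟩
  · refine (norm_le_varControl hp f1 h1 h2 h3).trans (Real.rpow_le_rpow (r1.1.1 _ _ h1 h2 h3) ?_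
      (by positivity))
    linarith [r2.1.1 s t h1 h2 h3]
  · have := norm_le_varControl hp2 f2 h1 h2 h3
    rw [one_div_div] at this
    refine this.trans (Real.rpow_le_rpow (r2.1.1 _ _ h1 h2 h3) ?_ (by positivity))
    linarith [r1.1.1 s t h1 h2 h3]

lemma RoughCtl.path_bigO (h : RoughCtl p T S P ω) (i : Fin d) :
    (fun x : ι × ℝ × ℝ => S x.2.2 i - S x.2.1 i) =O[tri ι T] gau ω (1 / p) := by
  refine bigO_of_le (f := fun s t => S t i - S s i) (g := fun s t => ω s t ^ (1 / p))
    fun s t h1 h2 h3 => ?_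
  exact (PiLp.norm_apply_le (inc S s t) i).trans (h.path s t h1 h2 h3)

lemma RoughCtl.level_bigO (h : RoughCtl p T S P ω) (ij : Fin d × Fin d) :
    (fun x : ι × ℝ × ℝ => secondLevel S P x.2.1 x.2.2 ij) =O[tri ι T]
      fun x => gau ω (1 / p) x ^ 2 := by
  refine bigO_of_le (f := fun s t => secondLevel S P s t ij)
    (g := fun s t => (ω s t ^ (1 / p)) ^ 2) fun s t h1 h2 h3 => ?_
  rw [← Real.rpow_natCast, ← Real.rpow_mul (h.reg.1.1 s t h1 h2 h3)]
  refine (PiLp.norm_apply_le (secondLevel S P s t) ij).trans ((h.level s t h1 h2 h3).trans ?_)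
  apply le_of_eq; congr 1; push_cast; ring

lemma continuousOn_coord {κ : Type*} [Fintype κ] {X : ℝ → EuclideanSpace ℝ κ} {s : Set ℝ}
    (h : ContinuousOn X s) (i : κ) : ContinuousOn (fun t => X t i) s :=
  (PiLp.continuous_apply 2 _ i).comp_continuousOn h

lemma continuousOn_of_coord {κ : Type*} [Fintype κ] {X : ℝ → EuclideanSpace ℝ κ} {s : Set ℝ}
    (h : ∀ i, ContinuousOn (fun t => X t i) s) : ContinuousOn X s := by
  have h1 : ContinuousOn (fun t => WithLp.toLp 2 fun i => X t i) s :=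
    (PiLp.continuous_toLp 2 _).comp_continuousOn (continuousOn_pi.2 h)
  exact h1

lemma secondLevel_chen (s u t : ℝ) (i j : Fin d) : secondLevel S P s t (i, j) =
    secondLevel S P s u (i, j) + secondLevel S P u t (i, j)
      + (S u i - S s i) * (S t j - S u j) := by
  simp only [secondLevel, inc, tensor, PiLp.sub_apply]
  ring

lemma inc_bracket (s t : ℝ) (i j : Fin d) : inc (bracket S (secondLevel S P) i j) s t =
    (S t i - S s i) * (S t j - S s j) - secondLevel S P s t (i, j)
      - secondLevel S P s t (j, i) := by
  simp only [inc, bracket, PiLp.sub_apply]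
  rw [secondLevel_chen 0 s t i j, secondLevel_chen 0 s t j i]
  ring

/-- A scalar path controlled by `S`, with a Gubinelli derivative of order `k` and a remainder of
order `h * k`. -/
structure SCtl (T : ℝ) (h k : Unit × ℝ × ℝ → ℝ) (S : ℝ → Vec d) (y : ℝ → ℝ)
    (y' : Fin d → ℝ → ℝ) : Prop where
  cont : ContinuousOn y (Icc 0 T)
  cont_deriv : ∀ j, ContinuousOn (y' j) (Icc 0 T)
  deriv : ∀ j, IncO T k (y' j)
  rem : (fun x : Unit × ℝ × ℝ => y x.2.2 - y x.2.1
    - ∑ j, y' j x.2.1 * (S x.2.2 j - S x.2.1 j)) =O[tri Unit T] fun x => h x * k x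

/-- The compatibility of the gauges for controlled paths. -/
structure Gauges (T : ℝ) (h k : Unit × ℝ × ℝ → ℝ) (S : ℝ → Vec d) : Prop where
  path : ∀ i, IncO T h (fun t => S t i)
  cont : ContinuousOn S (Icc 0 T)
  bdd : k =O[tri Unit T] fun _ => (1 : ℝ)
  le : h =O[tri Unit T] k

variable {h k : Unit × ℝ × ℝ → ℝ} {y z : ℝ → ℝ} {y' z' : Fin d → ℝ → ℝ}

lemma RoughCtl.gauges (hp : 0 < p) (hq : p ≤ q) (hr : RoughCtl p T S P ω)
    (hS : IsPricePath p S P) : Gauges T (gau ω (1 / p)) (gau ω (1 / q)) S :=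
  ⟨fun i => hr.path_bigO i, hS.continuousOn_Icc,
    gau_bounded hr.reg.1 (by have := hp.trans_le hq; positivity),
    gau_mono_exp hr.reg.1 (by have := hp.trans_le hq; positivity)
      (one_div_le_one_div_of_le hp hq)⟩

lemma SCtl.inc (hg : Gauges T h k S) (hy : SCtl T h k S y y') : IncO T h y := by
  have h1 : (fun x : Unit × ℝ × ℝ => ∑ j, y' j x.2.1 * (S x.2.2 j - S x.2.1 j)) =O[tri Unit T] h :=
    IsBigO.fun_sum fun j _ => bigO_one_mul (bigO_start (hy.cont_deriv j)) (hg.path j)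
  exact ((hy.rem.trans (bigO_mul_one (isBigO_refl h _) hg.bdd)).add h1).congr_left
    fun x => by ring

lemma SCtl.const (a : ℝ) : SCtl T h k S (fun _ => a) (fun _ _ => 0) :=
  ⟨continuousOn_const, fun _ => continuousOn_const, fun _ => IncO.const 0, by
    simpa using isBigO_zero _ _⟩

lemma SCtl.coord (hg : Gauges T h k S) (i : Fin d) :
    SCtl T h k S (fun t => S t i) (fun j _ => if i = j then 1 else 0) :=
  ⟨continuousOn_coord hg.cont i, fun _ => continuousOn_const, fun _ => IncO.const _, by
    simpa using isBigO_zero _ _⟩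

lemma SCtl.add (hy : SCtl T h k S y y') (hz : SCtl T h k S z z') :
    SCtl T h k S (fun t => y t + z t) (fun j t => y' j t + z' j t) :=
  ⟨hy.cont.add hz.cont, fun j => (hy.cont_deriv j).add (hz.cont_deriv j),
    fun j => (hy.deriv j).add (hz.deriv j), (hy.rem.add hz.rem).congr_left fun x => by
      simp only [add_mul, Finset.sum_add_distrib]; ring⟩

lemma SCtl.sum {κ : Type*} (s : Finset κ) {y : κ → ℝ → ℝ} {y' : κ → Fin d → ℝ → ℝ}
    (hy : ∀ a ∈ s, SCtl T h k S (y a) (y' a)) :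
    SCtl T h k S (fun t => ∑ a ∈ s, y a t) (fun j t => ∑ a ∈ s, y' a j t) := by
  classical
  induction s using Finset.induction_on with
  | empty => simpa using SCtl.const 0
  | insert a s ha ih =>
    simp only [Finset.sum_insert ha]
    exact (hy a (Finset.mem_insert_self a s)).add
      (ih fun b hb => hy b (Finset.mem_insert_of_mem hb))

lemma SCtl.mul (hg : Gauges T h k S) (hy : SCtl T h k S y y') (hz : SCtl T h k S z z') :
    SCtl T h k S (fun t => y t * z t) (fun j t => y t * z' j t + z t * y' j t) := by
  refine ⟨hy.cont.mul hz.cont, fun j => (hy.cont.mul (hz.cont_deriv j)).add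
    (hz.cont.mul (hy.cont_deriv j)), fun j => ?_, ?_⟩
  · exact (((hy.inc hg).mono hg.le).mul (hz.deriv j) hy.cont (hz.cont_deriv j)).add
      (((hz.inc hg).mono hg.le).mul (hy.deriv j) hz.cont (hy.cont_deriv j))
  · have h1 := bigO_one_mul (bigO_start (ι := Unit) hy.cont) hz.rem
    have h2 := bigO_one_mul (bigO_start (ι := Unit) hz.cont) hy.rem
    have h3 := IsBigO.mul (hy.inc hg) ((hz.inc hg).mono hg.le)
    refine ((h1.add h2).add h3).congr_left fun x => ?_
    simp only [add_mul, Finset.sum_add_distrib, mul_sub (y x.2.1), mul_sub (z x.2.1),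
      Finset.mul_sum, mul_assoc]
    ring

lemma SCtl.inv (hg : Gauges T h k S) (hy : SCtl T h k S y y') (h0 : ∀ t ∈ Icc 0 T, y t ≠ 0) :
    SCtl T h k S (fun t => (y t)⁻¹) (fun j t => -((y t)⁻¹ * (y t)⁻¹ * y' j t)) := by
  have hic := hy.cont.inv₀ h0
  have hii := (hy.inc hg).inv hy.cont h0
  have hik := hii.mono hg.le
  refine ⟨hic, fun j => ((hic.mul hic).mul (hy.cont_deriv j)).neg,
    fun j => ((hik.mul hik hic hic).mul (hy.deriv j) (hic.mul hic) (hy.cont_deriv j)).neg, ?_⟩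
  have h1 := bigO_one_mul (bigO_start (ι := Unit) (hic.mul hic).neg) hy.rem
  have h2 := bigO_one_mul (bigO_start (ι := Unit) hic) (IsBigO.mul (hy.inc hg) hik)
  refine (h1.sub h2).congr' ?_ EventuallyEq.rfl
  refine eventually_principal.2 fun x hx => ?_
  have a1 := h0 x.2.1 ⟨hx.1, hx.2.1.trans hx.2.2⟩
  have a2 := h0 x.2.2 ⟨hx.1.trans hx.2.1, hx.2.2⟩
  have e : ∑ j, -((y x.2.1)⁻¹ * (y x.2.1)⁻¹ * y' j x.2.1) * (S x.2.2 j - S x.2.1 j) =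
      -((y x.2.1)⁻¹ * (y x.2.1)⁻¹) * ∑ j, y' j x.2.1 * (S x.2.2 j - S x.2.1 j) := by
    rw [Finset.mul_sum]
    exact Finset.sum_congr rfl fun j _ => by ring
  simp only [e, Pi.mul_apply, Pi.inv_apply, Pi.neg_apply]
  generalize ∑ j, y' j x.2.1 * (S x.2.2 j - S x.2.1 j) = σ
  field_simp
  ring

lemma SCtl.congr_deriv {y'' : Fin d → ℝ → ℝ} (hy : SCtl T h k S y y')
    (he : ∀ j, ∀ t ∈ Icc 0 T, y'' j t = y' j t) : SCtl T h k S y y'' := by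
  refine ⟨hy.cont, fun j => (hy.cont_deriv j).congr (he j), fun j => ?_, ?_⟩
  · refine IsBigO.congr' (hy.deriv j) ?_ EventuallyEq.rfl
    exact eventually_principal.2 fun x hx => by
      simp only [he j x.2.1 ⟨hx.1, hx.2.1.trans hx.2.2⟩, he j x.2.2 ⟨hx.1.trans hx.2.1, hx.2.2⟩]
  · refine IsBigO.congr' hy.rem ?_ EventuallyEq.rfl
    exact eventually_principal.2 fun x hx => by
      simp only [fun j => he j x.2.1 ⟨hx.1, hx.2.1.trans hx.2.2⟩]

lemma SCtl.congr_path {z : ℝ → ℝ} (hy : SCtl T h k S y y') (he : ∀ t, z t = y t) :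
    SCtl T h k S z y' := by
  rw [funext he]; exact hy

lemma inc_apply {κ : Type*} [Fintype κ] (X : ℝ → EuclideanSpace ℝ κ) (s t : ℝ) (i : κ) :
    inc X s t i = X t i - X s i := rfl

lemma IsControlled.exists_control (hp : 0 < p) (hq : p ≤ q) {π : ℝ → Vec d} {π' : ℝ → Mat d}
    (hS : ContinuousOn S (Icc 0 T)) (hπ : IsControlled p q T S π π') :
    ∃ c, IsRegularControl T c ∧ ∀ s t, 0 ≤ s → s ≤ t → t ≤ T →
      ‖inc π' s t‖ ≤ c s t ^ (1 / q) ∧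
      ‖inc π s t - act (π' s) (inc S s t)‖ ≤ c s t ^ (1 / p + 1 / q) := by
  have hq0 : 0 < q := hp.trans_le hq
  have hr : 0 < 1 / (1 / p + 1 / q) := by positivity
  have r1 := isRegularControl_varControl hq0 hπ.deriv_var (contOnSq_inc hπ.continuousOn_deriv)
    (by simp [inc])
  have hcont : ContOnSq T (fun s t => inc π s t - act (π' s) (inc S s t)) := by
    refine (contOnSq_inc hπ.continuousOn).sub ?_
    have h2 : ContinuousOn (fun x : ℝ × ℝ => π' x.1) (Icc 0 T ×ˢ Icc 0 T) :=
      hπ.continuousOn_deriv.comp continuousOn_fst fun _ hx => hx.1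
    have h3 := contOnSq_inc hS
    refine (PiLp.continuous_toLp 2 _).comp_continuousOn (continuousOn_pi.2 fun i => ?_)
    refine continuousOn_finsetSum _ fun j _ => ?_
    exact ((PiLp.continuous_apply 2 _ (i, j)).comp_continuousOn h2).mul
      ((PiLp.continuous_apply 2 _ j).comp_continuousOn h3)
  have r2 := isRegularControl_varControl hr hπ.remainder_var hcont
    (fun t => by ext i; simp [inc, act])
  refine ⟨_, r1.add r2, fun s t h1 h2 h3 => ⟨?_, ?_⟩⟩
  · refine (norm_le_varControl hq0 hπ.deriv_var h1 h2 h3).trans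
      (Real.rpow_le_rpow (r1.1.1 _ _ h1 h2 h3) ?_ (by positivity))
    linarith [r2.1.1 s t h1 h2 h3]
  · have := norm_le_varControl hr hπ.remainder_var h1 h2 h3
    rw [one_div_one_div] at this
    refine this.trans (Real.rpow_le_rpow (r2.1.1 _ _ h1 h2 h3) ?_ (by positivity))
    linarith [r1.1.1 s t h1 h2 h3]

/-- The coordinates of a controlled path are controlled scalar paths. -/
lemma IsControlled.sctl (hp : 0 < p) (hq : p ≤ q) {π : ℝ → Vec d} {π' : ℝ → Mat d}
    (hπ : IsControlled p q T S π π') (hω : IsControl T ω)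
    (hc : ∀ s t, 0 ≤ s → s ≤ t → t ≤ T → ‖inc π' s t‖ ≤ ω s t ^ (1 / q) ∧
      ‖inc π s t - act (π' s) (inc S s t)‖ ≤ ω s t ^ (1 / p + 1 / q)) (i : Fin d) :
    SCtl T (gau ω (1 / p)) (gau ω (1 / q)) S (fun t => π t i) (fun j t => π' t (i, j)) := by
  have hq0 : 0 < q := hp.trans_le hq
  refine ⟨continuousOn_coord hπ.continuousOn i, fun j => continuousOn_coord hπ.continuousOn_deriv _,
    fun j => ?_, ?_⟩
  · refine bigO_of_le (f := fun s t => π' t (i, j) - π' s (i, j))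
      (g := fun s t => ω s t ^ (1 / q)) fun s t h1 h2 h3 => ?_
    exact (PiLp.norm_apply_le (inc π' s t) (i, j)).trans (hc s t h1 h2 h3).1
  · refine bigO_of_le (f := fun s t => π t i - π s i - ∑ j, π' s (i, j) * (S t j - S s j))
      (g := fun s t => ω s t ^ (1 / p) * ω s t ^ (1 / q)) fun s t h1 h2 h3 => ?_
    rw [← Real.rpow_add_of_nonneg (hω.1 s t h1 h2 h3) (by positivity) (by positivity)]
    exact (PiLp.norm_apply_le (inc π s t - act (π' s) (inc S s t)) i).trans (hc s t h1 h2 h3).2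

lemma isGerm_of_bigO {E : Type*} [NormedAddCommGroup E] {Ξ : ℝ → ℝ → E} {θ : ℝ} (hω : IsControl T ω)
    (h0 : ∀ t, 0 ≤ t → t ≤ T → Ξ t t = 0)
    (h : (fun x : Unit × ℝ × ℝ × ℝ => Ξ x.2.1 x.2.2.2 - Ξ x.2.1 x.2.2.1 - Ξ x.2.2.1 x.2.2.2)
      =O[tri3 Unit T] gau3 ω θ) : ∃ K, 0 ≤ K ∧ IsGerm T θ K ω Ξ := by
  obtain ⟨C, hC⟩ := (bigO_tri3_iff (f := fun _ s u t => Ξ s t - Ξ s u - Ξ u t)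
    (g := fun _ s _ t => ω s t ^ θ)).1 h
  refine ⟨|C|, abs_nonneg C, h0, fun s u t h1 h2 h3 h4 => (hC () s u t h1 h2 h3 h4).trans ?_⟩
  have := hω.1 s t h1 (h2.trans h3) h4
  rw [Real.norm_of_nonneg (by positivity)]
  exact mul_le_mul_of_nonneg_right (le_abs_self C) (by positivity)

lemma norm_le_sum_coord {κ : Type*} [Fintype κ] (v : EuclideanSpace ℝ κ) : ‖v‖ ≤ ∑ i, |v i| := by
  rw [EuclideanSpace.norm_eq]
  refine Real.sqrt_le_iff.2 ⟨Finset.sum_nonneg fun i _ => abs_nonneg _, ?_⟩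
  simp only [Real.norm_eq_abs]
  exact Finset.sum_sq_le_sq_sum_of_nonneg fun i _ => abs_nonneg _

lemma bigO_of_coord {κ X : Type*} [Fintype κ] {l : Filter X} {v : X → EuclideanSpace ℝ κ} {g : X → ℝ}
    (h : ∀ i, (fun x => v x i) =O[l] g) : v =O[l] g := by
  have h1 : (fun x => ∑ i, |v x i|) =O[l] g := IsBigO.fun_sum fun i _ => (h i).abs_left
  refine IsBigO.trans (IsBigO.of_bound 1 (Eventually.of_forall fun x => ?_)) h1
  rw [one_mul]
  exact (norm_le_sum_coord _).trans (le_abs_self _)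

lemma psum_coord {κ : Type*} [Fintype κ] (Ξ : ℝ → ℝ → EuclideanSpace ℝ κ) (ij : κ) (n : ℕ) :
    psum P T Ξ n ij = psum P T (fun s t => Ξ s t ij) n := by
  simp [psum]

/-- Sums of a coordinate of the second level against a path of complementary variation vanish in
the limit. -/
lemma psum_mul_secondLevel_tendsto (hp : 2 < p) (hS : IsPricePath p S P) (hT : 0 ≤ T)
    {κ : ℝ} (hκ : 0 < κ) (hκ1 : κ < 1) (hκp : 1 < 2 / p + κ) (hω : IsControl T ω)
    {b : ℝ → ℝ} (hb : IncO T (gau ω κ) b) (ij : Fin d × Fin d) :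
    Tendsto (psum P T fun s t => b s * secondLevel S P s t ij) atTop (𝓝 0) := by
  obtain ⟨c, hc, hbc⟩ := hb.exists_control hκ hω
  have h1 := psum_smul_secondLevel_tendsto hp hS hT hκ hκ1 hκp hc hbc
  have h2 := ((PiLp.continuous_apply 2 (fun _ : Fin d × Fin d => ℝ) ij).tendsto 0).comp h1
  refine h2.congr fun n => ?_
  simp only [Function.comp_apply, psum_coord]
  rfl

/-- A two-parameter function bounded by a power of a control function has finite variation. -/
lemma pVar_lt_top_of_bigO {E : Type*} [NormedAddCommGroup E] {A : ℝ → ℝ → E} {a ρ : ℝ}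
    (hρ : 0 < ρ) (haρ : 1 ≤ a * ρ) (hω : IsControl T ω)
    (h : (fun x : Unit × ℝ × ℝ => A x.2.1 x.2.2) =O[tri Unit T] gau ω a) : pVar ρ A 0 T < ⊤ := by
  have h1 : (fun x : Unit × ℝ × ℝ => ‖A x.2.1 x.2.2‖ ^ ρ) =O[tri Unit T] gau ω 1 := by
    have h2 : (fun x : Unit × ℝ × ℝ => gau ω a x ^ ρ) =ᶠ[tri Unit T] gau ω (a * ρ) :=
      eventually_principal.2 fun x hx => by
        simp only [gau]
        rw [Real.rpow_mul (hω.1 _ _ hx.1 hx.2.1 hx.2.2)]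
    have h3 := h.norm_left.rpow hρ.le (eventually_principal.2 fun x hx => by
      have := hω.1 _ _ hx.1 hx.2.1 hx.2.2
      simp only [gau, Pi.zero_apply]; positivity)
    exact (h3.congr' EventuallyEq.rfl h2).trans (gau_mono_exp hω zero_le_one haρ)
  obtain ⟨C, hC⟩ := (bigO_tri_iff (f := fun (_ : Unit) s t => ‖A s t‖ ^ ρ)
    (g := fun _ s t => ω s t ^ (1 : ℝ))).1 h1
  refine pVar_lt_top_of_control hρ (hω.const_mul (abs_nonneg C)) fun s t a b c => ?_
  have h4 := hC () s t a b c
  have h5 := hω.1 s t a b c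
  rw [Real.norm_of_nonneg (by positivity), Real.rpow_one, Real.norm_of_nonneg h5] at h4
  exact h4.trans (mul_le_mul_of_nonneg_right (le_abs_self C) h5)

lemma IncO.continuousOn {a : ℝ} (ha : 0 < a) (hω : IsRegularControl T ω) {f : ℝ → ℝ}
    (hf : IncO T (gau ω a) f) : ContinuousOn f (Icc 0 T) := by
  obtain ⟨C, hC⟩ := (bigO_tri_iff (f := fun (_ : Unit) s t => f t - f s)
    (g := fun _ s t => ω s t ^ a)).1 hf
  rw [Metric.continuousOn_iff]
  intro b hb ε hε
  obtain ⟨δ, hδ, H⟩ := hω.2 ((ε / (|C| + 1)) ^ (1 / a)) (by positivity)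
  have key : ∀ s t, 0 ≤ s → s ≤ t → t ≤ T → t - s < δ → |f t - f s| < ε := by
    intro s t h1 h2 h3 h4
    have h5 := hC () s t h1 h2 h3
    have h6 := hω.1.1 s t h1 h2 h3
    have h7 := Real.rpow_le_rpow h6 (H s t h1 h2 h3 h4) ha.le
    rw [← Real.rpow_mul (by positivity), one_div_mul_cancel ha.ne', Real.rpow_one] at h7
    rw [Real.norm_eq_abs, Real.norm_of_nonneg (by positivity)] at h5
    calc _ ≤ _ := h5
      _ ≤ |C| * (ε / (|C| + 1)) := mul_le_mul (le_abs_self C) h7 (by positivity) (abs_nonneg C)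
      _ < (|C| + 1) * (ε / (|C| + 1)) := mul_lt_mul_of_pos_right (by linarith) (by positivity)
      _ = ε := by field_simp
  refine ⟨δ, hδ, fun t ht hd => ?_⟩
  rw [Real.dist_eq] at hd ⊢
  rw [abs_lt] at hd
  rcases le_total b t with h1 | h1
  · exact key b t hb.1 h1 ht.2 (by linarith)
  · rw [abs_sub_comm]
    exact key t b ht.1 h1 hb.2 (by linarith)

lemma gau3_mul {a b : ℝ} (hω : IsControl T ω) (ha : 0 ≤ a) (hb : 0 ≤ b) :
    (fun x : ι × ℝ × ℝ × ℝ => gau3 ω a x * gau3 ω b x) =O[tri3 ι T] gau3 ω (a + b) := by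
  refine (bigO_tri3_iff (f := fun _ s _ t => ω s t ^ a * ω s t ^ b)
    (g := fun _ s _ t => ω s t ^ (a + b))).2 ⟨1, fun _ s u t h1 h2 h3 h4 => ?_⟩
  rw [Real.rpow_add_of_nonneg (hω.1 s t h1 (h2.trans h3) h4) ha hb, one_mul]

/-- The rough integral of a controlled path exists, as a germ. -/
lemma roughGerm_bigO (hp : 0 < p) (hq : p ≤ q) (hr : RoughCtl p T S P ω) {Y : ℝ → Vec d}
    {Y' : ℝ → Mat d}
    (hY : ∀ i, SCtl T (gau ω (1 / p)) (gau ω (1 / q)) S (fun t => Y t i) (fun j t => Y' t (i, j))) :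
    (fun x : Unit × ℝ × ℝ × ℝ => roughGerm S (secondLevel S P) Y Y' x.2.1 x.2.2.2
      - roughGerm S (secondLevel S P) Y Y' x.2.1 x.2.2.1
      - roughGerm S (secondLevel S P) Y Y' x.2.2.1 x.2.2.2) =O[tri3 Unit T]
        gau3 ω (2 / p + 1 / q) := by
  have hq0 : 0 < q := hp.trans_le hq
  have hω := hr.reg.1
  have hhk : (fun x : Unit × ℝ × ℝ × ℝ => gau3 ω (1 / p) x * (gau3 ω (1 / p) x * gau3 ω (1 / q) x))
      =O[tri3 Unit T] gau3 ω (2 / p + 1 / q) := by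
    have h1 := ((isBigO_refl (gau3 ω (1 / p)) (tri3 Unit T)).mul
      (gau3_mul hω (by positivity : 0 ≤ 1 / p) (by positivity : 0 ≤ 1 / q))).trans
      (gau3_mul hω (by positivity : 0 ≤ 1 / p) (by positivity : 0 ≤ 1 / p + 1 / q))
    rwa [show 1 / p + (1 / p + 1 / q) = 2 / p + 1 / q by ring] at h1
  have hpos : 0 ≤ 1 / p := by positivity
  have hpos' : 0 ≤ 1 / q := by positivity
  have key : ∀ i, (fun x : Unit × ℝ × ℝ × ℝ =>
      (Y x.2.2.1 i - Y x.2.1 i - ∑ j, Y' x.2.1 (i, j) * (S x.2.2.1 j - S x.2.1 j))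
        * (S x.2.2.2 i - S x.2.2.1 i)
      + ∑ j, (Y' x.2.2.1 (i, j) - Y' x.2.1 (i, j)) * secondLevel S P x.2.2.1 x.2.2.2 (j, i))
      =O[tri3 Unit T] gau3 ω (2 / p + 1 / q) := by
    intro i
    refine IsBigO.trans (IsBigO.add ?_ (IsBigO.fun_sum fun j _ => ?_)) hhk
    · have h1 := (bigO_left (hY i).rem).trans
        ((gau_left hω hpos).mul (gau_left hω hpos'))
      have h2 := (bigO_right (hr.path_bigO (ι := Unit) i)).trans (gau_right hω hpos)
      exact (h1.mul h2).congr_right fun x => by ring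
    · have h1 := (bigO_left ((hY i).deriv j)).trans (gau_left hω hpos')
      have h2 := (bigO_right (hr.level_bigO (ι := Unit) (j, i))).trans ((gau_right hω hpos).pow 2)
      exact (h1.mul h2).congr_right fun x => by ring
  refine (IsBigO.neg_left (IsBigO.fun_sum (s := Finset.univ) fun i _ => key i)).congr_left fun x => ?_
  obtain ⟨-, s, u, t⟩ := x
  simp only [roughGerm, ← Finset.sum_add_distrib, ← Finset.sum_sub_distrib,
    ← Finset.sum_neg_distrib]
  refine Finset.sum_congr rfl fun i _ => ?_
  have e : ∑ j, Y' s (i, j) * secondLevel S P s t (j, i)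
      - ∑ j, Y' s (i, j) * secondLevel S P s u (j, i)
      - ∑ j, Y' u (i, j) * secondLevel S P u t (j, i)
      = (∑ j, Y' s (i, j) * (S u j - S s j)) * (S t i - S u i)
        - ∑ j, (Y' u (i, j) - Y' s (i, j)) * secondLevel S P u t (j, i) := by
    rw [Finset.sum_mul, ← Finset.sum_sub_distrib, ← Finset.sum_sub_distrib,
      ← Finset.sum_sub_distrib]
    refine Finset.sum_congr rfl fun j _ => ?_
    rw [secondLevel_chen s u t j i]
    ring
  simp only [inc_apply]
  linear_combination -e

lemma bracketGerm_bigO (hp : 0 < p) (hq : p ≤ q) (hr : RoughCtl p T S P ω) {f : ℝ → ℝ}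
    (hf : IncO T (gau ω (1 / p)) f) (i j : Fin d) :
    (fun x : Unit × ℝ × ℝ × ℝ =>
      f x.2.1 * inc (bracket S (secondLevel S P) i j) x.2.1 x.2.2.2
      - f x.2.1 * inc (bracket S (secondLevel S P) i j) x.2.1 x.2.2.1
      - f x.2.2.1 * inc (bracket S (secondLevel S P) i j) x.2.2.1 x.2.2.2) =O[tri3 Unit T]
        gau3 ω (2 / p + 1 / q) := by
  have hq0 : 0 < q := hp.trans_le hq
  have hω := hr.reg.1
  have hpos : 0 ≤ 1 / p := by positivity
  have hpos' : 0 ≤ 1 / q := by positivity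
  have hB : (fun x : Unit × ℝ × ℝ => inc (bracket S (secondLevel S P) i j) x.2.1 x.2.2)
      =O[tri Unit T] fun x => gau ω (1 / p) x ^ 2 := by
    have h1 := ((hr.path_bigO (ι := Unit) i).mul (hr.path_bigO (ι := Unit) j)).congr_right
      (fun x => (pow_two _).symm)
    exact ((h1.sub (hr.level_bigO (i, j))).sub (hr.level_bigO (j, i))).congr_left
      fun x => (inc_bracket _ _ _ _).symm
  have h1 := (bigO_left (hf.mono (gau_mono_exp hω hpos' (one_div_le_one_div_of_le hp hq)))).trans
    (gau_left hω hpos')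
  have h2 := (bigO_right hB).trans ((gau_right hω hpos).pow 2)
  have h3 := (gau3_mul (ι := Unit) hω hpos hpos)
  have h4 := ((isBigO_refl (gau3 ω (1 / q)) (tri3 Unit T)).mul h3).trans
    (gau3_mul hω hpos' (add_nonneg hpos hpos))
  rw [show 1 / q + (1 / p + 1 / p) = 2 / p + 1 / q by ring] at h4
  refine (((h1.mul h2).congr_right fun x => by rw [pow_two]).trans h4).neg_left.congr_left fun x => ?_
  simp only [inc]
  ring

lemma quot_sctl (hp : 0 < p) (hq : p ≤ q) (hS : IsPricePath p S P) (hr : RoughCtl p T S P ω)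
    {π : ℝ → Vec d} {π' : ℝ → Mat d}
    (hπ : ∀ i, SCtl T (gau ω (1 / p)) (gau ω (1 / q)) S (fun t => π t i) (fun j t => π' t (i, j)))
    (i : Fin d) : SCtl T (gau ω (1 / p)) (gau ω (1 / q)) S (fun t => quot S π t i)
      (fun j t => quotDeriv S π π' t (i, j)) := by
  have hg := hr.gauges hp hq hS
  have h0 : ∀ t ∈ Icc 0 T, S t i ≠ 0 := fun t ht => (hS.pos t ht.1 i).ne'
  have h1 := (hπ i).mul hg ((SCtl.coord hg i).inv hg h0)
  refine SCtl.congr_deriv (y := fun t => quot S π t i) h1 fun j t ht => ?_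
  have := h0 t ht
  simp only [quotDeriv]
  split_ifs with hij <;> field_simp <;> ring

/-- The wealth of a portfolio is the limit of expressions along the given partitions. In particular
it does not depend on the Gubinelli derivative. -/
theorem wealth_spec (hp : 2 < p) (hq : p ≤ q) (hpq : 1 < 2 / p + 1 / q)
    (hS : IsPricePath p S P) (hT : 0 ≤ T) {π : ℝ → Vec d}
    (hπ : ∃ π' : ℝ → Mat d, IsControlled p q T S π π') :
    ∃ ℓ, wealth p q S P π T = Real.exp ℓ ∧
      Tendsto (psum P T fun s t => (∑ i, quot S π s i * (S t i - S s i))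
        - 1 / 2 * (∑ i, quot S π s i * (S t i - S s i)) ^ 2) atTop (𝓝 ℓ) := by
  have hp0 : 0 < p := by linarith
  have hq0 : 0 < q := hp0.trans_le hq
  have hP := hS.gridSeq
  unfold wealth
  rw [dif_pos hπ]
  set π' := hπ.choose
  have hπ' : IsControlled p q T S π π' := hπ.choose_spec
  obtain ⟨ω₀, hω₀⟩ := exists_roughCtl hp0 hS hT
  obtain ⟨c, hc, hcb⟩ := hπ'.exists_control hp0 hq hS.continuousOn_Icc
  have hr := hω₀.add hp0 hc
  set ω := fun s t => ω₀ s t + c s t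
  have hω := hr.reg.1
  have hcω : ∀ s t, 0 ≤ s → s ≤ t → t ≤ T → ‖inc π' s t‖ ≤ ω s t ^ (1 / q) ∧
      ‖inc π s t - act (π' s) (inc S s t)‖ ≤ ω s t ^ (1 / p + 1 / q) := by
    intro s t h1 h2 h3
    have a1 := hc.1.1 s t h1 h2 h3
    have a2 := hω₀.reg.1.1 s t h1 h2 h3
    exact ⟨(hcb s t h1 h2 h3).1.trans (Real.rpow_le_rpow a1 (by simp only [ω]; linarith)
      (by positivity)), (hcb s t h1 h2 h3).2.trans (Real.rpow_le_rpow a1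
      (by simp only [ω]; linarith) (by positivity))⟩
  have hg := hr.gauges hp0 hq hS
  have hY := quot_sctl hp0 hq hS hr (hπ'.sctl hp0 hq hω hcω)
  set Y := quot S π
  set Y' := quotDeriv S π π'
  have hκ0 : 0 < 1 / q := by positivity
  have hκ1 : 1 / q < 1 := by rw [div_lt_one hq0]; linarith
  obtain ⟨K, hK, hgerm⟩ := isGerm_of_bigO hω (fun t _ _ => by
    simp [roughGerm, inc, secondLevel_self]) (roughGerm_bigO hp0 hq hr hY)
  have hM := (hgerm.hasMeshLimit hpq hK hr.reg le_rfl hT le_rfl).psum hP hT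
  have hinc : ∀ i j, IncO T (gau ω (1 / p)) (fun t => Y t i * Y t j) := fun i j =>
    ((hY i).inc hg).mul ((hY j).inc hg) (hY i).cont (hY j).cont
  have hB : ∀ i j, Tendsto (psum P T fun s t =>
      π s i * π s j / (S s i * S s j) * inc (bracket S (secondLevel S P) i j) s t) atTop
      (𝓝 (meshLimit (fun u v =>
        π u i * π u j / (S u i * S u j) * inc (bracket S (secondLevel S P) i j) u v) 0 T)) := by
    intro i j
    have e : (fun t => π t i * π t j / (S t i * S t j)) = fun t => Y t i * Y t j := by
      funext t; simp only [Y, quot]; exact (div_mul_div_comm _ _ _ _).symm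
    have h1 := bracketGerm_bigO hp0 hq hr (hinc i j) i j
    simp only [← fun t => congrFun e t] at h1
    obtain ⟨K, hK, hgerm⟩ := isGerm_of_bigO
      (Ξ := fun u v => π u i * π u j / (S u i * S u j) * inc (bracket S (secondLevel S P) i j) u v)
      hω (fun t _ _ => by simp [inc]) h1
    exact (hgerm.hasMeshLimit hpq hK hr.reg le_rfl hT le_rfl).psum hP hT
  have hL1 : ∀ i j, Tendsto (psum P T fun s t => Y' s (i, j) * secondLevel S P s t (j, i))
      atTop (𝓝 0) := fun i j =>
    psum_mul_secondLevel_tendsto hp hS hT hκ0 hκ1 hpq hω ((hY i).deriv j) _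
  have hL2 : ∀ i j ij, Tendsto (psum P T fun s t => Y s i * Y s j * secondLevel S P s t ij)
      atTop (𝓝 0) := fun i j ij =>
    psum_mul_secondLevel_tendsto hp hS hT hκ0 hκ1 hpq hω ((hinc i j).mono hg.le) _
  refine ⟨_, rfl, ?_⟩
  have hS1 : Tendsto (fun n => ∑ i, ∑ j, psum P T
      (fun s t => Y' s (i, j) * secondLevel S P s t (j, i)) n) atTop (𝓝 0) := by
    simpa using tendsto_finsetSum (Finset.univ : Finset (Fin d)) fun i _ =>
      tendsto_finsetSum (Finset.univ : Finset (Fin d)) fun j _ => hL1 i j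
  have hS2 : Tendsto (fun n => ∑ i, ∑ j, (psum P T (fun s t =>
      π s i * π s j / (S s i * S s j) * inc (bracket S (secondLevel S P) i j) s t) n
      + psum P T (fun s t => Y s i * Y s j * secondLevel S P s t (i, j)) n
      + psum P T (fun s t => Y s i * Y s j * secondLevel S P s t (j, i)) n)) atTop
      (𝓝 (∑ i, ∑ j, meshLimit (fun u v =>
        π u i * π u j / (S u i * S u j) * inc (bracket S (secondLevel S P) i j) u v) 0 T)) := by
    simpa using tendsto_finsetSum (Finset.univ : Finset (Fin d)) fun i _ =>
      tendsto_finsetSum (Finset.univ : Finset (Fin d)) fun j _ =>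
        ((hB i j).add (hL2 i j (i, j))).add (hL2 i j (j, i))
  have hfin := (hM.sub hS1).sub (hS2.const_mul (1 / 2))
  rw [sub_zero] at hfin
  refine hfin.congr fun n => ?_
  simp only [← psum_add, ← psum_sum, ← psum_mul, ← psum_sub]
  refine hP.psum_congr hT (fun s t _ _ _ => ?_) n
  have e1 : (∑ i, Y s i * (S t i - S s i)) ^ 2 = ∑ i, ∑ j,
      (π s i * π s j / (S s i * S s j) * inc (bracket S (secondLevel S P) i j) s t
      + Y s i * Y s j * secondLevel S P s t (i, j)
      + Y s i * Y s j * secondLevel S P s t (j, i)) := by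
    rw [pow_two, Finset.sum_mul_sum]
    refine Finset.sum_congr rfl fun i _ => Finset.sum_congr rfl fun j _ => ?_
    rw [inc_bracket, ← div_mul_div_comm]
    simp only [Y, quot]
    ring
  rw [e1]
  simp only [roughGerm, inc_apply]
  ring

end Controlled

/-! ### The market portfolio and its rough path lift -/

section Market

variable {ι : Type*} {d : ℕ} {p q T : ℝ} {S : ℝ → Vec d} {P : ℕ → ℕ → ℝ} {ω : ℝ → ℝ → ℝ}

lemma IsPricePath.sum_pos (hd : 0 < d) (hS : IsPricePath p S P) {t : ℝ} (ht : 0 ≤ t) :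
    0 < ∑ j, S t j := by
  have : Nonempty (Fin d) := ⟨⟨0, hd⟩⟩
  exact Finset.sum_pos (fun i _ => hS.pos t ht i) Finset.univ_nonempty

lemma market_pos (hd : 0 < d) (hS : IsPricePath p S P) {t : ℝ} (ht : 0 ≤ t) (i : Fin d) :
    0 < market S t i := div_pos (hS.pos t ht i) (hS.sum_pos hd ht)

lemma market_sum (hd : 0 < d) (hS : IsPricePath p S P) {t : ℝ} (ht : 0 ≤ t) :
    ∑ i, market S t i = 1 := by
  simp only [market, ← Finset.sum_div]
  exact div_self (hS.sum_pos hd ht).ne'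

lemma market_mem (hd : 0 < d) (hS : IsPricePath p S P) {t : ℝ} (ht : 0 ≤ t) :
    market S t ∈ simplex d :=
  ⟨fun i => (market_pos hd hS ht i).le, market_sum hd hS ht⟩

lemma market_sctl (hd : 0 < d) (hS : IsPricePath p S P) {h k : Unit × ℝ × ℝ → ℝ}
    (hg : Gauges T h k S) (i : Fin d) :
    SCtl T h k S (fun t => market S t i) (fun j t => marketDeriv S t (i, j)) := by
  have h0 : ∀ t ∈ Icc 0 T, ∑ j, S t j ≠ 0 := fun t ht => (hS.sum_pos hd ht.1).ne'
  have h1 := (SCtl.coord hg i).mul hg ((SCtl.sum Finset.univ fun j _ => SCtl.coord hg j).inv hg h0)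
  refine SCtl.congr_deriv (y := fun t => market S t i) h1 fun j t ht => ?_
  have := h0 t ht
  simp only [marketDeriv, Finset.sum_ite_eq', Finset.mem_univ, if_true]
  split_ifs <;> field_simp <;> ring

lemma market_bigO (hd : 0 < d) (hp : 0 < p) (hS : IsPricePath p S P) (hr : RoughCtl p T S P ω)
    (i : Fin d) : (fun x : ι × ℝ × ℝ => market S x.2.2 i - market S x.2.1 i) =O[tri ι T]
      gau ω (1 / p) := by
  have hg := hr.gauges hp le_rfl hS
  have h1 := (market_sctl hd hS hg i).inc hg
  obtain ⟨C, hC⟩ := (bigO_tri_iff (f := fun (_ : Unit) s t => market S t i - market S s i)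
    (g := fun _ s t => ω s t ^ (1 / p))).1 h1
  exact (bigO_tri_iff (f := fun _ s t => market S t i - market S s i)
    (g := fun _ s t => ω s t ^ (1 / p))).2 ⟨C, fun _ => hC ()⟩

/-- The product `∑ M^{ik} M^{jl} A^{kl}` of the derivative of `μ` and a matrix. -/
noncomputable def pushLevel (S : ℝ → Vec d) (P : ℕ → ℕ → ℝ) (i j : Fin d) (s t : ℝ) : ℝ :=
  ∑ k, ∑ l, marketDeriv S s (i, k) * marketDeriv S s (j, l) * secondLevel S P s t (k, l)

lemma gau3_pow (hω : IsControl T ω) (a : ℝ) (n : ℕ) :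
    (fun x : ι × ℝ × ℝ × ℝ => gau3 ω a x ^ n) =ᶠ[tri3 ι T] gau3 ω (a * n) :=
  eventually_principal.2 fun x hx => by
    simp only [gau3]
    rw [Real.rpow_mul (hω.1 _ _ hx.1 (hx.2.1.trans hx.2.2.1) hx.2.2.2), Real.rpow_natCast]

lemma gau_pow (hω : IsControl T ω) (a : ℝ) (n : ℕ) :
    (fun x : ι × ℝ × ℝ => gau ω a x ^ n) =ᶠ[tri ι T] gau ω (a * n) :=
  eventually_principal.2 fun x hx => by
    simp only [gau]
    rw [Real.rpow_mul (hω.1 _ _ hx.1 hx.2.1 hx.2.2), Real.rpow_natCast]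

lemma tensorGerm_bigO (hd : 0 < d) (hp : 0 < p) (hS : IsPricePath p S P) (hr : RoughCtl p T S P ω)
    (i j : Fin d) :
    (fun x : Unit × ℝ × ℝ × ℝ =>
      tensorGerm (secondLevel S P) (market S) (marketDeriv S) (market S) (marketDeriv S)
          x.2.1 x.2.2.2 (i, j)
      - tensorGerm (secondLevel S P) (market S) (marketDeriv S) (market S) (marketDeriv S)
          x.2.1 x.2.2.1 (i, j)
      - tensorGerm (secondLevel S P) (market S) (marketDeriv S) (market S) (marketDeriv S)
          x.2.2.1 x.2.2.2 (i, j)) =O[tri3 Unit T] fun x => gau3 ω (1 / p) x ^ 3 := by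
  have hω := hr.reg.1
  have hpos : 0 ≤ 1 / p := by positivity
  have hg := hr.gauges hp le_rfl hS
  have hM := market_sctl hd hS hg
  set h3 : Unit × ℝ × ℝ × ℝ → ℝ := gau3 ω (1 / p)
  have hb : h3 =O[tri3 Unit T] fun _ => (1 : ℝ) := gau3_bounded hω hpos
  have hL := gau_left (ι := Unit) hω hpos
  have hR := gau_right (ι := Unit) hω hpos
  have m1 : ∀ i, (fun x : Unit × ℝ × ℝ × ℝ => market S x.2.2.1 i - market S x.2.1 i)
      =O[tri3 Unit T] fun x => h3 x ^ 1 := fun i =>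
    ((bigO_left ((hM i).inc hg)).trans hL).congr_right fun x => (pow_one _).symm
  have m2 : ∀ i, (fun x : Unit × ℝ × ℝ × ℝ => market S x.2.2.2 i - market S x.2.2.1 i)
      =O[tri3 Unit T] fun x => h3 x ^ 1 := fun i =>
    ((bigO_right ((hM i).inc hg)).trans hR).congr_right fun x => (pow_one _).symm
  have r1 : ∀ i, (fun x : Unit × ℝ × ℝ × ℝ => market S x.2.2.1 i - market S x.2.1 i
      - ∑ k, marketDeriv S x.2.1 (i, k) * (S x.2.2.1 k - S x.2.1 k))
      =O[tri3 Unit T] fun x => h3 x ^ 2 := fun i =>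
    ((bigO_left (hM i).rem).trans (hL.mul hL)).congr_right fun x => (pow_two _).symm
  have r2 : ∀ i, (fun x : Unit × ℝ × ℝ × ℝ => market S x.2.2.2 i - market S x.2.2.1 i
      - ∑ k, marketDeriv S x.2.2.1 (i, k) * (S x.2.2.2 k - S x.2.2.1 k))
      =O[tri3 Unit T] fun x => h3 x ^ 2 := fun i =>
    ((bigO_right (hM i).rem).trans (hR.mul hR)).congr_right fun x => (pow_two _).symm
  have dM : ∀ i k, (fun x : Unit × ℝ × ℝ × ℝ => marketDeriv S x.2.2.1 (i, k)
      - marketDeriv S x.2.1 (i, k)) =O[tri3 Unit T] fun x => h3 x ^ 1 := fun i k =>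
    ((bigO_left ((hM i).deriv k)).trans hL).congr_right fun x => (pow_one _).symm
  have s2 : ∀ k, (fun x : Unit × ℝ × ℝ × ℝ => S x.2.2.2 k - S x.2.2.1 k)
      =O[tri3 Unit T] fun x => h3 x ^ 1 := fun k =>
    ((bigO_right (hg.path k)).trans hR).congr_right fun x => (pow_one _).symm
  have l2 : ∀ kl, (fun x : Unit × ℝ × ℝ × ℝ => secondLevel S P x.2.2.1 x.2.2.2 kl)
      =O[tri3 Unit T] fun x => h3 x ^ 2 := fun kl =>
    ((bigO_right (hr.level_bigO kl)).trans (hR.pow 2))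
  have r2' : ∀ i, (fun x : Unit × ℝ × ℝ × ℝ => market S x.2.2.2 i - market S x.2.2.1 i
      - ∑ k, marketDeriv S x.2.1 (i, k) * (S x.2.2.2 k - S x.2.2.1 k))
      =O[tri3 Unit T] fun x => h3 x ^ 2 := by
    intro i
    refine ((r2 i).add (IsBigO.fun_sum (s := Finset.univ)
      fun k _ => bigO_mul (dM i k) (s2 k))).congr_left fun x => ?_
    simp only [sub_mul, Finset.sum_sub_distrib]
    ring
  have dMM : ∀ k l, (fun x : Unit × ℝ × ℝ × ℝ =>
      marketDeriv S x.2.2.1 (i, k) * marketDeriv S x.2.2.1 (j, l)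
      - marketDeriv S x.2.1 (i, k) * marketDeriv S x.2.1 (j, l))
      =O[tri3 Unit T] fun x => h3 x ^ 1 := fun k l =>
    ((bigO_left (((hM i).deriv k).mul ((hM j).deriv l) ((hM i).cont_deriv k)
      ((hM j).cont_deriv l))).trans hL).congr_right fun x => (pow_one _).symm
  have t1 := bigO_mul (m1 i) (r2' j)
  have t2 := bigO_mul (r1 i) ((m2 j).sub ((r2' j).trans (bigO_pow_mono hb one_le_two)))
  have t3 := IsBigO.fun_sum (s := (Finset.univ : Finset (Fin d))) fun k _ =>
    IsBigO.fun_sum (s := (Finset.univ : Finset (Fin d))) fun l _ => bigO_mul (dMM k l) (l2 (k, l))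
  refine ((t1.add t2).add t3).neg_left.congr_left fun x => ?_
  obtain ⟨-, s, u, t⟩ := x
  simp only [tensorGerm, inc_apply]
  have e : ∑ k, ∑ l, marketDeriv S s (i, k) * marketDeriv S s (j, l) * secondLevel S P s t (k, l)
      = ∑ k, ∑ l, marketDeriv S s (i, k) * marketDeriv S s (j, l) * secondLevel S P s u (k, l)
      + ∑ k, ∑ l, marketDeriv S u (i, k) * marketDeriv S u (j, l) * secondLevel S P u t (k, l)
      - ∑ k, ∑ l, (marketDeriv S u (i, k) * marketDeriv S u (j, l)
        - marketDeriv S s (i, k) * marketDeriv S s (j, l)) * secondLevel S P u t (k, l)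
      + (∑ k, marketDeriv S s (i, k) * (S u k - S s k))
        * ∑ l, marketDeriv S s (j, l) * (S t l - S u l) := by
    rw [Finset.sum_mul_sum]
    simp only [← Finset.sum_add_distrib, ← Finset.sum_sub_distrib]
    refine Finset.sum_congr rfl fun k _ => Finset.sum_congr rfl fun l _ => ?_
    rw [secondLevel_chen s u t k l]
    ring
  rw [e]
  ring

lemma tensorGerm_isGerm (hd : 0 < d) (hp : 0 < p) (hS : IsPricePath p S P)
    (hr : RoughCtl p T S P ω) : ∃ K, 0 ≤ K ∧ IsGerm T (3 / p) K ω
      (tensorGerm (secondLevel S P) (market S) (marketDeriv S) (market S) (marketDeriv S)) := by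
  refine isGerm_of_bigO hr.reg.1 (fun t _ _ => ?_) ?_
  · ext ij; simp [tensorGerm, inc, secondLevel_self]
  · have h1 := gau3_pow (ι := Unit) hr.reg.1 (1 / p) 3
    rw [show 1 / p * ((3 : ℕ) : ℝ) = 3 / p by push_cast; ring] at h1
    refine IsBigO.congr' ?_ EventuallyEq.rfl h1
    exact bigO_of_coord fun ij => tensorGerm_bigO hd hp hS hr ij.1 ij.2

lemma one_lt_three_div (hp : 0 < p) (hp' : p < 3) : 1 < 3 / p := by rwa [one_lt_div hp]

lemma marketLift_chen (hd : 0 < d) (hp : 0 < p) (hp' : p < 3) (hS : IsPricePath p S P)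
    {s u t : ℝ} (hs : 0 ≤ s) (hsu : s ≤ u) (hut : u ≤ t) (i j : Fin d) :
    marketLift S P s t (i, j) = marketLift S P s u (i, j) + marketLift S P u t (i, j)
      + (market S u i - market S s i) * (market S t j - market S u j) := by
  obtain ⟨ω, hr⟩ := exists_roughCtl hp hS (hs.trans (hsu.trans hut))
  obtain ⟨K, hK, hG⟩ := tensorGerm_isGerm hd hp hS hr
  have := hG.meshLimit_add (one_lt_three_div hp hp') hK hr.reg hs hsu hut le_rfl
  simp only [marketLift, canonicalLift, ← this, tensor, inc, PiLp.sub_apply, PiLp.add_apply]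
  ring

lemma marketLift_self (hd : 0 < d) (hp : 0 < p) (hp' : p < 3) (hS : IsPricePath p S P)
    {t : ℝ} (ht : 0 ≤ t) (ij : Fin d × Fin d) : marketLift S P t t ij = 0 := by
  have := marketLift_chen hd hp hp' hS ht le_rfl le_rfl ij.1 ij.2
  simp only [sub_self, mul_zero, add_zero] at this
  exact left_eq_add.1 this

lemma marketLift_sub_bigO (hd : 0 < d) (hp : 0 < p) (hp' : p < 3) (hS : IsPricePath p S P)
    (hr : RoughCtl p T S P ω) (i j : Fin d) :
    (fun x : ι × ℝ × ℝ => marketLift S P x.2.1 x.2.2 (i, j) - pushLevel S P i j x.2.1 x.2.2)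
      =O[tri ι T] fun x => gau ω (1 / p) x ^ 3 := by
  obtain ⟨K, hK, hG⟩ := tensorGerm_isGerm hd hp hS hr
  have h1 := gau_pow (ι := ι) hr.reg.1 (1 / p) 3
  rw [show 1 / p * ((3 : ℕ) : ℝ) = 3 / p by push_cast; ring] at h1
  refine IsBigO.congr' ?_ EventuallyEq.rfl h1.symm
  refine IsBigO.trans (bigO_of_le (f := fun s t => marketLift S P s t (i, j)
    - pushLevel S P i j s t) (g := fun s t => K * sewC (3 / p) * ω s t ^ (3 / p))
    fun s t hs hst ht => ?_) (isBigO_const_mul_self _ _ _)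
  have := hG.norm_meshLimit_sub_le (one_lt_three_div hp hp') hK hr.reg hs hst ht
  refine le_trans (le_of_eq ?_) ((PiLp.norm_apply_le _ (i, j)).trans this)
  simp only [marketLift, canonicalLift, pushLevel, tensorGerm, tensor, inc_apply, PiLp.sub_apply]
  congr 1
  ring

lemma marketDeriv_continuousOn (hd : 0 < d) (hS : IsPricePath p S P) (i j : Fin d) :
    ContinuousOn (fun t => marketDeriv S t (i, j)) (Icc 0 T) := by
  have hc : ∀ i, ContinuousOn (fun t => S t i) (Icc 0 T) := continuousOn_coord hS.continuousOn_Icc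
  have hsum : ContinuousOn (fun t => ∑ k, S t k) (Icc 0 T) := continuousOn_finsetSum _ fun k _ => hc k
  have h0 : ∀ t ∈ Icc 0 T, ∑ j, S t j ≠ 0 := fun t ht => (hS.sum_pos hd ht.1).ne'
  simp only [marketDeriv]
  refine ContinuousOn.sub ?_ ((hc i).div (hsum.pow 2) fun t ht => pow_ne_zero 2 (h0 t ht))
  split_ifs
  · exact continuousOn_const.div hsum h0
  · exact continuousOn_const

lemma marketLift_bigO (hd : 0 < d) (hp : 0 < p) (hp' : p < 3) (hS : IsPricePath p S P)
    (hr : RoughCtl p T S P ω) (ij : Fin d × Fin d) :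
    (fun x : ι × ℝ × ℝ => marketLift S P x.2.1 x.2.2 ij)
      =O[tri ι T] fun x => gau ω (1 / p) x ^ 2 := by
  have hb : gau ω (1 / p) =O[tri ι T] fun _ => (1 : ℝ) := gau_bounded hr.reg.1 (by positivity)
  have h1 := (marketLift_sub_bigO (ι := ι) hd hp hp' hS hr ij.1 ij.2).trans
    (bigO_pow_mono hb (by norm_num : 2 ≤ 3))
  have h2 : (fun x : ι × ℝ × ℝ => pushLevel S P ij.1 ij.2 x.2.1 x.2.2)
      =O[tri ι T] fun x => gau ω (1 / p) x ^ 2 := by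
    refine IsBigO.fun_sum fun k _ => IsBigO.fun_sum fun l _ => bigO_one_mul ?_ (hr.level_bigO _)
    exact bigO_start ((marketDeriv_continuousOn hd hS ij.1 k).mul
      (marketDeriv_continuousOn hd hS ij.2 l))
  exact (h1.add h2).congr_left fun x => by ring

lemma pVar_market_lt_top (hd : 0 < d) (hp : 0 < p) (hS : IsPricePath p S P) (hT : 0 ≤ T) :
    pVar p (inc (market S)) 0 T < ⊤ := by
  obtain ⟨ω, hr⟩ := exists_roughCtl hp hS hT
  exact pVar_lt_top_of_bigO hp (one_div_mul_cancel hp.ne').ge hr.reg.1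
    (bigO_of_coord fun i => market_bigO hd hp hS hr i)

lemma pVar_marketLift_lt_top (hd : 0 < d) (hp : 0 < p) (hp' : p < 3) (hS : IsPricePath p S P)
    (hT : 0 ≤ T) : pVar (p / 2) (marketLift S P) 0 T < ⊤ := by
  obtain ⟨ω, hr⟩ := exists_roughCtl hp hS hT
  have h1 := gau_pow (ι := Unit) hr.reg.1 (1 / p) 2
  rw [show 1 / p * ((2 : ℕ) : ℝ) = 2 / p by push_cast; ring] at h1
  refine pVar_lt_top_of_bigO (by positivity) ?_ hr.reg.1
    (IsBigO.congr' (bigO_of_coord fun ij => marketLift_bigO hd hp hp' hS hr ij)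
      EventuallyEq.rfl h1)
  rw [div_mul_div_cancel₀ hp.ne', div_self two_ne_zero]

/-- Germs of order three are negligible along the given partitions. -/
lemma psum_tendsto_zero_of_bigO (hp : 0 < p) (hp' : p < 3) (hP : GridSeq P) (hT : 0 ≤ T)
    (hω : IsRegularControl T ω) {Ξ : ℝ → ℝ → ℝ}
    (h : (fun x : Unit × ℝ × ℝ => Ξ x.2.1 x.2.2) =O[tri Unit T] fun x => gau ω (1 / p) x ^ 3) :
    Tendsto (psum P T Ξ) atTop (𝓝 0) := by
  have h1 := gau_pow (ι := Unit) hω.1 (1 / p) 3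
  rw [show 1 / p * ((3 : ℕ) : ℝ) = 3 / p by push_cast; ring] at h1
  obtain ⟨C, hC⟩ := (bigO_tri_iff (f := fun (_ : Unit) s t => Ξ s t)
    (g := fun _ s t => ω s t ^ (3 / p))).1 (h.congr' EventuallyEq.rfl h1)
  refine hP.psum_tendsto_zero hT hω (one_lt_three_div hp hp') (C := C) fun s t a b c => ?_
  have := hω.1.1 s t a b c
  have h2 := hC () s t a b c
  rwa [Real.norm_of_nonneg (r := ω s t ^ (3 / p)) (by positivity)] at h2

lemma psum_mul_marketLift_tendsto (hd : 0 < d) (hp : 2 < p) (hp' : p < 3) (hS : IsPricePath p S P)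
    (hT : 0 ≤ T) (hr : RoughCtl p T S P ω) {b : ℝ → ℝ} (hb : IncO T (gau ω (1 / p)) b)
    (hbc : ContinuousOn b (Icc 0 T)) (ij : Fin d × Fin d) :
    Tendsto (psum P T fun s t => b s * marketLift S P s t ij) atTop (𝓝 0) := by
  have hp0 : 0 < p := by linarith
  have hg := hr.gauges hp0 le_rfl hS
  have hM := market_sctl hd hS hg
  have h1 := psum_tendsto_zero_of_bigO hp0 hp' hS.gridSeq hT hr.reg
    (Ξ := fun s t => b s * (marketLift S P s t ij - pushLevel S P ij.1 ij.2 s t))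
    (bigO_one_mul (bigO_start hbc) (marketLift_sub_bigO hd hp0 hp' hS hr ij.1 ij.2))
  have h2 : ∀ k l, Tendsto (psum P T fun s t => (b s * (marketDeriv S s (ij.1, k)
      * marketDeriv S s (ij.2, l))) * secondLevel S P s t (k, l)) atTop (𝓝 0) := by
    intro k l
    refine psum_mul_secondLevel_tendsto (κ := 1 / p) hp hS hT (by positivity)
      (by rw [div_lt_one hp0]; linarith) ?_ hr.reg.1 ?_ _
    · rw [← add_div, one_lt_div hp0]; linarith
    · exact hb.mul (((hM _).deriv k).mul ((hM _).deriv l) ((hM _).cont_deriv k)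
        ((hM _).cont_deriv l)) hbc (((hM _).cont_deriv k).mul ((hM _).cont_deriv l))
  have h3 := tendsto_finsetSum (Finset.univ : Finset (Fin d)) fun k _ =>
      tendsto_finsetSum (Finset.univ : Finset (Fin d)) fun l _ => h2 k l
  simp only [Finset.sum_const_zero] at h3
  have h4 := h1.add h3
  rw [add_zero] at h4
  refine h4.congr fun n => ?_
  simp only [← psum_sum, ← psum_add]
  congr 1
  funext s t
  simp only [pushLevel, mul_sub, Finset.mul_sum]
  have : ∀ k l, b s * (marketDeriv S s (ij.1, k) * marketDeriv S s (ij.2, l)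
      * secondLevel S P s t (k, l)) = b s * (marketDeriv S s (ij.1, k) * marketDeriv S s (ij.2, l))
      * secondLevel S P s t (k, l) := fun k l => by ring
  simp only [this]
  ring

/-- The bracket of the market portfolio is the quadratic variation along the given partitions. -/
lemma psum_sq_tendsto (hd : 0 < d) (hp : 2 < p) (hp' : p < 3) (hS : IsPricePath p S P)
    (hT : 0 ≤ T) (i : Fin d) : Tendsto (psum P T fun s t => (market S t i - market S s i) ^ 2) atTop
      (𝓝 (bracket (market S) (marketLift S P) i i T)) := by
  have hp0 : 0 < p := by linarith
  obtain ⟨ω, hr⟩ := exists_roughCtl hp0 hS hT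
  have h1 := psum_mul_marketLift_tendsto hd hp hp' hS hT hr (IncO.const 2) continuousOn_const (i, i)
  have h2 := (h1.const_add (bracket (market S) (marketLift S P) i i T))
  rw [add_zero] at h2
  refine h2.congr fun n => ?_
  have h3 : bracket (market S) (marketLift S P) i i T
      = psum P T (inc (bracket (market S) (marketLift S P) i i)) n := by
    rw [hS.gridSeq.psum_inc hT]
    simp [bracket, inc, marketLift_self hd hp0 hp' hS le_rfl]
  rw [h3, ← psum_add]
  refine hS.gridSeq.psum_congr hT (fun s t h0 hst _ => ?_) n
  simp only [inc, bracket, PiLp.sub_apply]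
  rw [marketLift_chen hd hp0 hp' hS le_rfl h0 hst]
  ring

end Market

/-! ### Twice differentiable functions on the simplex -/

section Jets

variable {d : ℕ} {G : Type*} [NormedAddCommGroup G] [NormedSpace ℝ G]

lemma convex_simplex (d : ℕ) : Convex ℝ (simplex d) := by
  intro x hx y hy a b ha hb hab
  refine ⟨fun i => ?_, ?_⟩
  · simp only [PiLp.add_apply, PiLp.smul_apply, smul_eq_mul]
    have := hx.1 i; have := hy.1 i
    positivity
  · simp only [PiLp.add_apply, PiLp.smul_apply, smul_eq_mul, Finset.sum_add_distrib,
      ← Finset.mul_sum, hx.2, hy.2, mul_one, hab]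

/-- The segment from `x` to `y` in the simplex. -/
noncomputable def seg (x y : simplex d) (τ : ℝ) : simplex d :=
  ⟨(x : Vec d) + (projIcc (0 : ℝ) 1 zero_le_one τ : ℝ) • ((y : Vec d) - x),
    (convex_simplex d).add_smul_sub_mem x.2 y.2 (projIcc (0 : ℝ) 1 zero_le_one τ).2⟩

lemma seg_coe (x y : simplex d) {τ : ℝ} (hτ : τ ∈ Icc (0 : ℝ) 1) :
    (seg x y τ : Vec d) = (x : Vec d) + τ • ((y : Vec d) - x) := by
  simp only [seg, projIcc_of_mem zero_le_one hτ]

lemma continuous_seg (x y : simplex d) : Continuous (seg x y) := by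
  refine Continuous.subtype_mk ?_ _
  have : Continuous fun τ : ℝ => ((projIcc (0 : ℝ) 1 zero_le_one τ : Icc (0:ℝ) 1) : ℝ) :=
    continuous_subtype_val.comp continuous_projIcc
  fun_prop

lemma seg_zero (x y : simplex d) : seg x y 0 = x :=
  Subtype.ext (by rw [seg_coe x y ⟨le_rfl, zero_le_one⟩]; simp)

lemma seg_one (x y : simplex d) : seg x y 1 = y :=
  Subtype.ext (by rw [seg_coe x y ⟨zero_le_one, le_rfl⟩]; simp)

lemma HasSimplexFDeriv.hasDerivWithinAt_seg {f : simplex d → G} {f' : simplex d → Vec d →L[ℝ] G}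
    (h : HasSimplexFDeriv f f') (x y : simplex d) {τ : ℝ} (hτ : τ ∈ Icc (0 : ℝ) 1) :
    HasDerivWithinAt (fun τ => f (seg x y τ)) (f' (seg x y τ) ((y : Vec d) - x)) (Icc 0 1) τ := by
  rw [hasDerivWithinAt_iff_isLittleO]
  have h1 := (h (seg x y τ)).2.comp_tendsto
    (((continuous_seg x y).tendsto τ).mono_left nhdsWithin_le_nhds : Tendsto _ (𝓝[Icc 0 1] τ) _)
  have h2 : ∀ σ ∈ Icc (0 : ℝ) 1, (seg x y σ : Vec d) - seg x y τ = (σ - τ) • ((y : Vec d) - x) := by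
    intro σ hσ
    rw [seg_coe x y hσ, seg_coe x y hτ, sub_smul]
    abel
  have h3 : ((fun z : simplex d => (z : Vec d) - (seg x y τ : Vec d)) ∘ seg x y)
      =O[𝓝[Icc 0 1] τ] fun σ => σ - τ := by
    refine IsBigO.of_bound ‖(y : Vec d) - x‖ ?_
    filter_upwards [self_mem_nhdsWithin] with σ hσ
    simp only [Function.comp_apply, h2 σ hσ, norm_smul, mul_comm, le_refl]
  refine (h1.trans_isBigO h3).congr' ?_ EventuallyEq.rfl
  filter_upwards [self_mem_nhdsWithin] with σ hσ
  simp only [Function.comp_apply, h2 σ hσ, map_smul]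

lemma HasSimplexFDeriv.norm_sub_le {f : simplex d → G} {f' : simplex d → Vec d →L[ℝ] G}
    (h : HasSimplexFDeriv f f') {D : ℝ} (hD : ∀ x, ‖f' x‖ ≤ D) (x y : simplex d) :
    ‖f y - f x‖ ≤ D * ‖(y : Vec d) - x‖ := by
  have := norm_image_sub_le_of_norm_deriv_le_segment_01'
    (fun τ hτ => h.hasDerivWithinAt_seg x y hτ) (C := D * ‖(y : Vec d) - x‖)
    (fun τ _ => (ContinuousLinearMap.le_opNorm _ _).trans
      (mul_le_mul_of_nonneg_right (hD _) (norm_nonneg _)))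
  simpa only [seg_zero, seg_one] using this

lemma HasSimplexFDeriv.norm_taylor_le {f : simplex d → G} {f' : simplex d → Vec d →L[ℝ] G}
    (h : HasSimplexFDeriv f f') {D : ℝ} (hD0 : 0 ≤ D)
    (hD : ∀ x y : simplex d, ‖f' y - f' x‖ ≤ D * ‖(y : Vec d) - x‖) (x y : simplex d) :
    ‖f y - f x - f' x ((y : Vec d) - x)‖ ≤ D * ‖(y : Vec d) - x‖ ^ 2 := by
  have h1 : ∀ τ ∈ Icc (0 : ℝ) 1, HasDerivWithinAt
      (fun τ => f (seg x y τ) - τ • f' x ((y : Vec d) - x))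
      (f' (seg x y τ) ((y : Vec d) - x) - f' x ((y : Vec d) - x)) (Icc 0 1) τ := by
    intro τ hτ
    refine (h.hasDerivWithinAt_seg x y hτ).sub ?_
    simpa using (hasDerivWithinAt_id τ (Icc (0 : ℝ) 1)).smul_const (f' x ((y : Vec d) - x))
  have := norm_image_sub_le_of_norm_deriv_le_segment_01' h1 (C := D * ‖(y : Vec d) - x‖ ^ 2)
    (fun τ hτ => by
      rw [← _root_.sub_apply]
      refine (ContinuousLinearMap.le_opNorm _ _).trans ?_
      rw [pow_two, ← mul_assoc]
      refine mul_le_mul_of_nonneg_right ((hD _ _).trans ?_) (norm_nonneg _)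
      have h2 : (seg x y τ : Vec d) - x = τ • ((y : Vec d) - x) := by
        rw [seg_coe x y ⟨hτ.1, hτ.2.le⟩]; abel
      rw [h2, norm_smul, Real.norm_of_nonneg hτ.1]
      refine mul_le_mul_of_nonneg_left ?_ hD0
      exact mul_le_of_le_one_left (norm_nonneg _) hτ.2.le)
  simp only [seg_zero, seg_one, one_smul, zero_smul, sub_zero] at this
  rwa [sub_right_comm] at this

lemma HasSimplexFDeriv.sub {f g : simplex d → G} {f' g' : simplex d → Vec d →L[ℝ] G}
    (hf : HasSimplexFDeriv f f') (hg : HasSimplexFDeriv g g') :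
    HasSimplexFDeriv (f - g) (f' - g') := by
  refine fun x => ⟨by simp [(hf x).1, (hg x).1], ?_⟩
  refine ((hf x).2.sub (hg x).2).congr_left fun y => ?_
  simp only [Pi.sub_apply, _root_.sub_apply]
  abel

/-- The jet of a twice differentiable function. -/
structure IsJet (J : Jet d) : Prop where
  fst : HasSimplexFDeriv J.1 J.2.1
  snd : HasSimplexFDeriv J.2.1 J.2.2

lemma IsJet.sub {J J' : Jet d} (h : IsJet J) (h' : IsJet J') : IsJet (J - J') :=
  ⟨h.fst.sub h'.fst, h.snd.sub h'.snd⟩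

open Classical in
/-- The coordinates of the value of a jet. -/
noncomputable def jval (J : Jet d) (i : Fin d) (x : Vec d) : ℝ :=
  (if h : x ∈ simplex d then J.1 ⟨x, h⟩ else 0) i

open Classical in
/-- The partial derivatives of a jet. -/
noncomputable def jder (J : Jet d) (i j : Fin d) (x : Vec d) : ℝ :=
  if h : x ∈ simplex d then J.2.1 ⟨x, h⟩ (EuclideanSpace.single j 1) i else 0

variable {J J' : Jet d} {D : ℝ} {x y : Vec d}

lemma jval_sub (i : Fin d) : jval (J - J') i x = jval J i x - jval J' i x := by
  unfold jval
  split_ifs <;> simp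

lemma abs_jval_le (hJ : ‖J‖ ≤ D) (hx : x ∈ simplex d) (i : Fin d) : |jval J i x| ≤ D := by
  rw [jval, dif_pos hx]
  exact (PiLp.norm_apply_le _ i).trans ((J.1.norm_coe_le_norm _).trans ((norm_fst_le J).trans hJ))

lemma abs_jder_le (hJ : ‖J‖ ≤ D) (hx : x ∈ simplex d) (i j : Fin d) : |jder J i j x| ≤ D := by
  rw [jder, dif_pos hx]
  have h := (J.2.1 ⟨x, hx⟩).le_opNorm (EuclideanSpace.single j 1)
  rw [PiLp.norm_single, norm_one, mul_one] at h
  refine (PiLp.norm_apply_le (J.2.1 ⟨x, hx⟩ (EuclideanSpace.single j 1)) i).trans (h.trans ?_)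
  exact (J.2.1.norm_coe_le_norm _).trans ((norm_fst_le J.2).trans ((norm_snd_le J).trans hJ))

lemma norm_second_le (hJ : ‖J‖ ≤ D) (z : simplex d) : ‖J.2.2 z‖ ≤ D :=
  (J.2.2.norm_coe_le_norm _).trans ((norm_snd_le J.2).trans ((norm_snd_le J).trans hJ))

lemma norm_first_le (hJ : ‖J‖ ≤ D) (z : simplex d) : ‖J.2.1 z‖ ≤ D :=
  (J.2.1.norm_coe_le_norm _).trans ((norm_fst_le J.2).trans ((norm_snd_le J).trans hJ))

lemma IsJet.abs_jder_sub_le (h : IsJet J) (hJ : ‖J‖ ≤ D) (hx : x ∈ simplex d) (hy : y ∈ simplex d)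
    (i j : Fin d) : |jder J i j y - jder J i j x| ≤ D * ‖y - x‖ := by
  rw [jder, jder, dif_pos hx, dif_pos hy]
  have h1 := h.snd.norm_sub_le (norm_second_le hJ) ⟨x, hx⟩ ⟨y, hy⟩
  refine le_trans ?_ h1
  have h2 := (J.2.1 ⟨y, hy⟩ - J.2.1 ⟨x, hx⟩).le_opNorm (EuclideanSpace.single j 1)
  rw [PiLp.norm_single, norm_one, mul_one] at h2
  exact (PiLp.norm_apply_le ((J.2.1 ⟨y, hy⟩ - J.2.1 ⟨x, hx⟩) (EuclideanSpace.single j 1)) i).trans h2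

lemma sum_jder_mul (hx : x ∈ simplex d) (i : Fin d) (v : Vec d) :
    ∑ j, jder J i j x * v j = J.2.1 ⟨x, hx⟩ v i := by
  have h1 : v = ∑ j, v j • EuclideanSpace.single j (1 : ℝ) := by
    ext k
    simp [Pi.single_apply]
  conv_rhs => rw [h1]
  simp only [map_sum, map_smul, WithLp.ofLp_sum, Finset.sum_apply, PiLp.smul_apply, smul_eq_mul,
    jder, dif_pos hx]
  exact Finset.sum_congr rfl fun j _ => mul_comm _ _

lemma IsJet.abs_taylor_le (h : IsJet J) (hJ : ‖J‖ ≤ D) (hx : x ∈ simplex d) (hy : y ∈ simplex d)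
    (i : Fin d) :
    |jval J i y - jval J i x - ∑ j, jder J i j x * (y j - x j)| ≤ D * ‖y - x‖ ^ 2 := by
  have h1 := h.fst.norm_taylor_le ((norm_nonneg J).trans hJ)
    (h.snd.norm_sub_le (norm_second_le hJ)) ⟨x, hx⟩ ⟨y, hy⟩
  have h2 := sum_jder_mul (J := J) hx i (y - x)
  simp only [PiLp.sub_apply] at h2
  rw [h2, jval, jval, dif_pos hx, dif_pos hy]
  exact (PiLp.norm_apply_le (J.1 ⟨y, hy⟩ - J.1 ⟨x, hx⟩ - J.2.1 ⟨x, hx⟩ (y - x)) i).trans h1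

variable {α : ℝ≥0} {K : ℝ}

lemma HolderBall.isJet (F : HolderBall d α K) : IsJet F.1 := ⟨F.2.1, F.2.2.1⟩

lemma HolderBall.norm_le (F : HolderBall d α K) : ‖F.1‖ ≤ K := by
  have := F.2.2.2.2
  have h : (0 : ℝ) ≤ nnHolderNorm α F.1.2.2 := NNReal.coe_nonneg _
  linarith

lemma HolderBall.eval_apply (F : HolderBall d α K) (x : Vec d) (i : Fin d) :
    F.eval x i = jval F.1 i x := by
  unfold HolderBall.eval jval
  split_ifs <;> rfl

lemma HolderBall.norm_sub (F G : HolderBall d α K) : ‖F.1 - G.1‖ = dist F G :=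
  (dist_eq_norm F.1 G.1).symm

end Jets

/-! ### Portfolios generated by controlled paths -/

section Generated

variable {ι : Type*} {d : ℕ} {p q T : ℝ} {S : ℝ → Vec d} {P : ℕ → ℕ → ℝ} {ω : ℝ → ℝ → ℝ}

lemma isControlled_of_sctl (hp : 0 < p) (hq : p ≤ q) (hω : IsControl T ω) {Y : ℝ → Vec d}
    {y' : Fin d → Fin d → ℝ → ℝ}
    (hY : ∀ i, SCtl T (gau ω (1 / p)) (gau ω (1 / p)) S (fun t => Y t i) (y' i)) :
    ∃ Y' : ℝ → Mat d, IsControlled p q T S Y Y' := by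
  have hq0 := hp.trans_le hq
  refine ⟨fun t => WithLp.toLp 2 fun ij => y' ij.1 ij.2 t,
    continuousOn_of_coord fun i => (hY i).cont,
    continuousOn_of_coord fun ij => (hY ij.1).cont_deriv ij.2, ?_, ?_⟩
  · refine pVar_lt_top_of_bigO (a := 1 / p) hq0 ?_ hω
      (bigO_of_coord fun ij => (hY ij.1).deriv ij.2)
    rwa [one_div_mul_eq_div, one_le_div hp]
  · refine pVar_lt_top_of_bigO (a := 1 / p + 1 / p) (by positivity) ?_ hω
      (bigO_of_coord fun i => (hY i).rem.trans ?_)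
    · rw [mul_one_div, one_le_div (by positivity)]
      have := one_div_le_one_div_of_le hp hq
      linarith
    · refine EventuallyEq.isBigO (eventually_principal.2 fun x hx => ?_)
      simp only [gau]
      rw [Real.rpow_add_of_nonneg (hω.1 _ _ hx.1 hx.2.1 hx.2.2) (by positivity) (by positivity)]

lemma pVar_congr {E : Type*} [NormedAddCommGroup E] {r s t : ℝ} {A B : ℝ → ℝ → E}
    (h : ∀ u ∈ Icc s t, ∀ v ∈ Icc s t, A u v = B u v) : pVar r A s t = pVar r B s t := by
  refine iSup_congr fun w => ?_
  congr 1
  exact Finset.sum_congr rfl fun i _ => by rw [h _ (w.2.2.2 i) _ (w.2.2.2 (i + 1))]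

lemma IsControlled.congr {Y Z : ℝ → Vec d} {Y' : ℝ → Mat d} (hY : IsControlled p q T S Y Y')
    (h : ∀ t ∈ Icc 0 T, Z t = Y t) : IsControlled p q T S Z Y' := by
  refine ⟨hY.continuousOn.congr h, hY.continuousOn_deriv, hY.deriv_var, ?_⟩
  rw [pVar_congr (B := fun s t => inc Y s t - act (Y' s) (inc S s t))
    fun u hu v hv => by simp only [inc, h u hu, h v hv]]
  exact hY.remainder_var

/-- A scalar path controlled by the market portfolio. -/
structure MCtl (p T : ℝ) (ω : ℝ → ℝ → ℝ) (S : ℝ → Vec d) (y : ℝ → ℝ) (y' : Fin d → ℝ → ℝ) :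
    Prop where
  deriv : ∀ j, IncO T (gau ω (1 / p)) (y' j)
  rem : (fun x : Unit × ℝ × ℝ => y x.2.2 - y x.2.1
    - ∑ j, y' j x.2.1 * (market S x.2.2 j - market S x.2.1 j)) =O[tri Unit T]
      fun x => gau ω (1 / p) x ^ 2

lemma MCtl.sctl (hd : 0 < d) (hp : 0 < p) (hS : IsPricePath p S P) (hr : RoughCtl p T S P ω)
    {y : ℝ → ℝ} {y' : Fin d → ℝ → ℝ} (hy : MCtl p T ω S y y') :
    SCtl T (gau ω (1 / p)) (gau ω (1 / p)) S y
      (fun l t => ∑ j, y' j t * marketDeriv S t (j, l)) := by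
  have hpos : 0 < 1 / p := by positivity
  have hg := hr.gauges hp le_rfl hS
  have hM := market_sctl hd hS hg
  have hc' : ∀ j, ContinuousOn (y' j) (Icc 0 T) := fun j => (hy.deriv j).continuousOn hpos hr.reg
  have hsum : (fun x : Unit × ℝ × ℝ => ∑ j, y' j x.2.1 * (market S x.2.2 j - market S x.2.1 j))
      =O[tri Unit T] gau ω (1 / p) :=
    IsBigO.fun_sum fun j _ => bigO_one_mul (bigO_start (hc' j)) (market_bigO hd hp hS hr j)
  have hinc : IncO T (gau ω (1 / p)) y := by
    have h1 := hy.rem.trans (bigO_pow_mono (gau_bounded hr.reg.1 hpos.le) one_le_two)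
    simp only [pow_one] at h1
    exact (h1.add hsum).congr_left fun x => by ring
  refine ⟨hinc.continuousOn hpos hr.reg,
    fun l => continuousOn_finsetSum _ fun j _ => (hc' j).mul ((hM j).cont_deriv l),
    fun l => IncO.sum _ fun j _ => (hy.deriv j).mul ((hM j).deriv l) (hc' j) ((hM j).cont_deriv l),
    ?_⟩
  have h2 : (fun x : Unit × ℝ × ℝ => ∑ j, y' j x.2.1 * (market S x.2.2 j - market S x.2.1 j
      - ∑ l, marketDeriv S x.2.1 (j, l) * (S x.2.2 l - S x.2.1 l))) =O[tri Unit T]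
      fun x => gau ω (1 / p) x * gau ω (1 / p) x :=
    IsBigO.fun_sum fun j _ => bigO_one_mul (bigO_start (hc' j)) (hM j).rem
  refine ((hy.rem.congr_right fun x => pow_two _).add h2).congr_left fun x => ?_
  simp only [mul_sub, Finset.sum_sub_distrib, Finset.mul_sum, Finset.sum_mul]
  rw [Finset.sum_comm (f := fun l j => y' j x.2.1 * marketDeriv S x.2.1 (j, l) * S x.2.2 l),
    Finset.sum_comm (f := fun l j => y' j x.2.1 * marketDeriv S x.2.1 (j, l) * S x.2.1 l)]
  simp only [mul_assoc]
  ring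

/-- The portfolio `μ^i (G^i + 1 - ∑_j μ^j G^j)` generated by the path `G`. -/
noncomputable def gen (S G : ℝ → Vec d) (t : ℝ) : Vec d :=
  WithLp.toLp 2 fun i => market S t i * (G t i + 1 - ∑ j, market S t j * G t j)

lemma gen_sum (hd : 0 < d) (hS : IsPricePath p S P) (G : ℝ → Vec d) {t : ℝ} (ht : 0 ≤ t) :
    ∑ i, gen S G t i = 1 := by
  have h1 := market_sum hd hS ht
  simp only [gen, mul_sub, mul_add, Finset.sum_sub_distrib, Finset.sum_add_distrib,
    ← Finset.sum_mul, h1, mul_one]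
  ring

lemma gen_isControlled (hd : 0 < d) (hp : 0 < p) (hq : p ≤ q) (hS : IsPricePath p S P)
    (hr : RoughCtl p T S P ω) {G : ℝ → Vec d} {g' : Fin d → Fin d → ℝ → ℝ}
    (hG : ∀ i, SCtl T (gau ω (1 / p)) (gau ω (1 / p)) S (fun t => G t i) (g' i)) :
    ∃ π' : ℝ → Mat d, IsControlled p q T S (gen S G) π' := by
  have hg := hr.gauges hp le_rfl hS
  have hM := market_sctl hd hS hg
  have h1 := SCtl.sum Finset.univ fun j _ => (hM j).mul hg (hG j)
  exact isControlled_of_sctl hp hq hr.reg.1 fun i =>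
    (hM i).mul hg (((hG i).add (SCtl.const 1)).add ((SCtl.const (-1)).mul hg h1)) |>.congr_path
      fun t => by simp only [gen]; ring

lemma market_isControlled (hd : 0 < d) (hp : 0 < p) (hq : p ≤ q) (hS : IsPricePath p S P)
    (hT : 0 ≤ T) : ∃ π' : ℝ → Mat d, IsControlled p q T S (market S) π' := by
  obtain ⟨ω, hr⟩ := exists_roughCtl hp hS hT
  exact isControlled_of_sctl hp hq hr.reg.1 fun i => market_sctl hd hS (hr.gauges hp le_rfl hS) i

/-- The log-wealth increment of a generated portfolio relative to the market portfolio is, to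
second order, `z - z² / 2` with `z = G_s · μ_{s,t}`. -/
theorem relWealth_gen (hd : 0 < d) (hp : 2 < p) (hp' : p < 3) (hq : p ≤ q)
    (hpq : 1 < 2 / p + 1 / q) (hS : IsPricePath p S P) (hT : 0 ≤ T) {G π : ℝ → Vec d}
    (hGc : ContinuousOn G (Icc 0 T)) (hπ : ∃ π' : ℝ → Mat d, IsControlled p q T S π π')
    (hG : ∀ t ∈ Icc 0 T, π t = gen S G t) :
    ∃ ℓ, relWealth p q S P π T = Real.exp ℓ ∧
      Tendsto (psum P T fun s t => (∑ i, G s i * (market S t i - market S s i))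
        - 1 / 2 * (∑ i, G s i * (market S t i - market S s i)) ^ 2) atTop (𝓝 ℓ) := by
  have hp0 : 0 < p := by linarith
  obtain ⟨ω, hr⟩ := exists_roughCtl hp0 hS hT
  have hpos : 0 ≤ 1 / p := by positivity
  obtain ⟨ℓ₁, e1, l1⟩ := wealth_spec hp hq hpq hS hT hπ
  obtain ⟨ℓ₂, e2, l2⟩ := wealth_spec hp hq hpq hS hT (market_isControlled hd hp0 hq hS hT)
  refine ⟨ℓ₁ - ℓ₂, by rw [relWealth, e1, e2, Real.exp_sub], ?_⟩
  have hi : ContinuousOn (fun t => (∑ k, S t k)⁻¹) (Icc 0 T) :=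
    (continuousOn_finsetSum _ fun k _ => continuousOn_coord hS.continuousOn_Icc k).inv₀
      fun t ht => (hS.sum_pos hd ht.1).ne'
  have hxm : (fun x : Unit × ℝ × ℝ => (∑ k, S x.2.1 k)⁻¹ * ∑ k, (S x.2.2 k - S x.2.1 k))
      =O[tri Unit T] fun x => gau ω (1 / p) x ^ 1 := by
    simp only [pow_one]
    exact bigO_one_mul (bigO_start hi) (IsBigO.fun_sum fun k _ => hr.path_bigO k)
  have hz : (fun x : Unit × ℝ × ℝ => ∑ i, G x.2.1 i * (market S x.2.2 i - market S x.2.1 i))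
      =O[tri Unit T] fun x => gau ω (1 / p) x ^ 1 := by
    simp only [pow_one]
    exact IsBigO.fun_sum fun k _ => bigO_one_mul (bigO_start (continuousOn_coord hGc k))
      (market_bigO hd hp0 hS hr k)
  have hb : gau ω (1 / p) =O[tri Unit T] fun _ => (1 : ℝ) := gau_bounded hr.reg.1 hpos
  have hxz := bigO_mul hxm hz
  have h3 := bigO_mul (hxm.add hz) hxz
  have h4 := (bigO_mul hxz hxz).trans (bigO_pow_mono hb (by norm_num : 1 + (1 + 1) ≤ 1 + 1 + (1 + 1)))
  have h0 := psum_tendsto_zero_of_bigO hp0 hp' hS.gridSeq hT hr.reg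
    (Ξ := fun s t => ((∑ k, S s k)⁻¹ * ∑ k, (S t k - S s k)
        + ∑ i, G s i * (market S t i - market S s i))
      * ((∑ k, S s k)⁻¹ * ∑ k, (S t k - S s k) * ∑ i, G s i * (market S t i - market S s i))
      + 1 / 2 * ((∑ k, S s k)⁻¹ * ∑ k, (S t k - S s k)
        * ∑ i, G s i * (market S t i - market S s i)) ^ 2) (by
      refine (h3.add (h4.const_mul_left (1 / 2))).congr_left fun x => ?_
      simp only [← Finset.sum_mul]
      ring)
  have hlim := (l1.sub l2).add h0
  rw [add_zero] at hlim
  refine hlim.congr fun n => ?_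
  rw [← psum_sub, ← psum_add]
  refine hS.gridSeq.psum_congr hT (fun s t hs hst hsT => ?_) n
  have hss := (hS.sum_pos hd hs).ne'
  have hst' := (hS.sum_pos hd (hs.trans hst)).ne'
  have q1 : ∑ i, quot S (market S) s i * (S t i - S s i)
      = (∑ k, S s k)⁻¹ * ∑ k, (S t k - S s k) := by
    rw [Finset.mul_sum]
    refine Finset.sum_congr rfl fun i _ => ?_
    have := (hS.pos s hs i).ne'
    simp only [quot, market]
    field_simp
  have q2 : ∑ i, quot S π s i * (S t i - S s i)
      = (∑ k, S s k)⁻¹ * (∑ i, G s i * S t i - ∑ i, G s i * S s i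
        + (1 - (∑ k, S s k)⁻¹ * ∑ i, G s i * S s i) * ∑ k, (S t k - S s k)) := by
    have : ∑ j, market S s j * G s j = (∑ k, S s k)⁻¹ * ∑ i, G s i * S s i := by
      rw [Finset.mul_sum]
      refine Finset.sum_congr rfl fun i _ => ?_
      simp only [market]
      ring
    rw [Finset.mul_sum (a := 1 - _), ← Finset.sum_sub_distrib, ← Finset.sum_add_distrib,
      Finset.mul_sum]
    refine Finset.sum_congr rfl fun i _ => ?_
    have := (hS.pos s hs i).ne'
    simp only [quot, hG s ⟨hs, hst.trans hsT⟩, gen]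
    rw [‹∑ j, market S s j * G s j = _›]
    simp only [market]
    field_simp
    ring
  have q3 : ∑ i, G s i * (market S t i - market S s i)
      = (∑ k, S t k)⁻¹ * ∑ i, G s i * S t i - (∑ k, S s k)⁻¹ * ∑ i, G s i * S s i := by
    rw [Finset.mul_sum, Finset.mul_sum, ← Finset.sum_sub_distrib]
    refine Finset.sum_congr rfl fun i _ => ?_
    simp only [market]
    ring
  have q4 : ∑ k, (S t k - S s k) = ∑ k, S t k - ∑ k, S s k := Finset.sum_sub_distrib _ _
  simp only [← Finset.sum_mul]
  rw [q1, q2, q3, q4]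
  generalize ∑ i, G s i * S t i = a
  generalize ∑ i, G s i * S s i = b
  generalize ∑ k, S t k = σt at *
  generalize ∑ k, S s k = σs at *
  field_simp
  ring

section FamilyOfJets

variable {J : ι → Jet d} {D : ℝ}

lemma norm_market_bigO (hd : 0 < d) (hp : 0 < p) (hS : IsPricePath p S P) (hr : RoughCtl p T S P ω) :
    (fun x : ι × ℝ × ℝ => ‖market S x.2.2 - market S x.2.1‖) =O[tri ι T] gau ω (1 / p) :=
  IsBigO.norm_left (bigO_of_coord fun i => market_bigO hd hp hS hr i)

lemma jval_rem_bigO (hd : 0 < d) (hp : 0 < p) (hS : IsPricePath p S P) (hr : RoughCtl p T S P ω)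
    (hJ : ∀ a, IsJet (J a)) (hD : ∀ a, ‖J a‖ ≤ D) (i : Fin d) :
    (fun x : ι × ℝ × ℝ => jval (J x.1) i (market S x.2.2) - jval (J x.1) i (market S x.2.1)
      - ∑ j, jder (J x.1) i j (market S x.2.1) * (market S x.2.2 j - market S x.2.1 j))
      =O[tri ι T] fun x => gau ω (1 / p) x ^ 2 := by
  refine IsBigO.trans ?_ ((norm_market_bigO (ι := ι) hd hp hS hr).pow 2)
  refine IsBigO.of_bound D (eventually_principal.2 fun x hx => ?_)
  rw [Real.norm_of_nonneg (r := ‖_‖ ^ 2) (by positivity)]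
  exact (hJ x.1).abs_taylor_le (hD x.1) (market_mem hd hS hx.1)
    (market_mem hd hS (hx.1.trans hx.2.1)) i

lemma jder_inc_bigO (hd : 0 < d) (hp : 0 < p) (hS : IsPricePath p S P) (hr : RoughCtl p T S P ω)
    (hJ : ∀ a, IsJet (J a)) (hD : ∀ a, ‖J a‖ ≤ D) (i j : Fin d) :
    (fun x : ι × ℝ × ℝ => jder (J x.1) i j (market S x.2.2) - jder (J x.1) i j (market S x.2.1))
      =O[tri ι T] gau ω (1 / p) := by
  refine IsBigO.trans ?_ (norm_market_bigO (ι := ι) hd hp hS hr)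
  refine IsBigO.of_bound D (eventually_principal.2 fun x hx => ?_)
  rw [norm_norm]
  exact (hJ x.1).abs_jder_sub_le (hD x.1) (market_mem hd hS hx.1)
    (market_mem hd hS (hx.1.trans hx.2.1)) i j

lemma jval_bigO (hd : 0 < d) (hS : IsPricePath p S P) (hD : ∀ a, ‖J a‖ ≤ D) (i : Fin d) :
    (fun x : ι × ℝ × ℝ => jval (J x.1) i (market S x.2.1)) =O[tri ι T] fun _ => (1 : ℝ) :=
  IsBigO.of_bound D (eventually_principal.2 fun x hx => by
    rw [norm_one, mul_one]; exact abs_jval_le (hD x.1) (market_mem hd hS hx.1) i)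

lemma jder_bigO (hd : 0 < d) (hS : IsPricePath p S P) (hD : ∀ a, ‖J a‖ ≤ D) (i j : Fin d) :
    (fun x : ι × ℝ × ℝ => jder (J x.1) i j (market S x.2.1)) =O[tri ι T] fun _ => (1 : ℝ) :=
  IsBigO.of_bound D (eventually_principal.2 fun x hx => by
    rw [norm_one, mul_one]; exact abs_jder_le (hD x.1) (market_mem hd hS hx.1) i j)

lemma jval_inc_bigO (hd : 0 < d) (hp : 0 < p) (hS : IsPricePath p S P) (hr : RoughCtl p T S P ω)
    (hJ : ∀ a, IsJet (J a)) (hD : ∀ a, ‖J a‖ ≤ D) (i : Fin d) :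
    (fun x : ι × ℝ × ℝ => jval (J x.1) i (market S x.2.2) - jval (J x.1) i (market S x.2.1))
      =O[tri ι T] gau ω (1 / p) := by
  have h1 := (jval_rem_bigO hd hp hS hr hJ hD i).trans
    (bigO_pow_mono (gau_bounded hr.reg.1 (by positivity)) one_le_two)
  simp only [pow_one] at h1
  have h2 : (fun x : ι × ℝ × ℝ => ∑ j, jder (J x.1) i j (market S x.2.1)
      * (market S x.2.2 j - market S x.2.1 j)) =O[tri ι T] gau ω (1 / p) :=
    IsBigO.fun_sum fun j _ => bigO_one_mul (jder_bigO hd hS hD i j) (market_bigO hd hp hS hr j)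
  exact (h1.add h2).congr_left fun x => by ring

end FamilyOfJets

variable {α : ℝ≥0} {K : ℝ}

lemma jet_mctl (hd : 0 < d) (hp : 0 < p) (hS : IsPricePath p S P) (hr : RoughCtl p T S P ω)
    {J : Jet d} (hJ : IsJet J) (i : Fin d) :
    MCtl p T ω S (fun t => jval J i (market S t)) (fun j t => jder J i j (market S t)) :=
  ⟨fun j => jder_inc_bigO hd hp hS hr (fun _ => hJ) (fun _ => le_refl ‖J‖) i j,
    jval_rem_bigO hd hp hS hr (fun _ => hJ) (fun _ => le_refl ‖J‖) i⟩

lemma eval_sctl (hd : 0 < d) (hp : 0 < p) (hS : IsPricePath p S P) (hr : RoughCtl p T S P ω)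
    (F : HolderBall d α K) (i : Fin d) :
    SCtl T (gau ω (1 / p)) (gau ω (1 / p)) S (fun t => F.eval (market S t) i)
      (fun l t => ∑ j, jder F.1 i j (market S t) * marketDeriv S t (j, l)) := by
  simp only [HolderBall.eval_apply]
  exact (jet_mctl hd hp hS hr F.isJet i).sctl hd hp hS hr

lemma eval_continuousOn (hd : 0 < d) (hp : 0 < p) (hS : IsPricePath p S P) (hT : 0 ≤ T)
    (F : HolderBall d α K) : ContinuousOn (fun t => F.eval (market S t)) (Icc 0 T) := by
  obtain ⟨ω, hr⟩ := exists_roughCtl hp hS hT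
  exact continuousOn_of_coord fun i => (eval_sctl hd hp hS hr F i).cont

lemma controlledPortfolio_isControlled (hd : 0 < d) (hp : 0 < p) (hq : p ≤ q)
    (hS : IsPricePath p S P) (hT : 0 ≤ T) (F : HolderBall d α K) :
    ∃ π' : ℝ → Mat d, IsControlled p q T S (controlledPortfolio S F) π' := by
  obtain ⟨ω, hr⟩ := exists_roughCtl hp hS hT
  exact gen_isControlled hd hp hq hS hr fun i => eval_sctl hd hp hS hr F i

lemma controlledPortfolio_isPortfolio (hd : 0 < d) (hp : 0 < p) (hq : p ≤ q)
    (hS : IsPricePath p S P) (F : HolderBall d α K) :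
    IsPortfolio p q S (controlledPortfolio S F) :=
  ⟨fun _ ht => gen_sum hd hS (fun t => F.eval (market S t)) ht,
    fun _ hT => controlledPortfolio_isControlled hd hp hq hS hT.le F⟩

end Generated

/-! ### The logarithmic relative wealth of functionally controlled portfolios -/

section LogWealth

variable {ι : Type*} {d : ℕ} {p q T : ℝ} {S : ℝ → Vec d} {P : ℕ → ℕ → ℝ} {ω : ℝ → ℝ → ℝ}

/-- The increment `F(μ_s) · μ_{s,t}`. -/
noncomputable def zinc (S : ℝ → Vec d) (J : Jet d) (s t : ℝ) : ℝ :=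
  ∑ i, jval J i (market S s) * (market S t i - market S s i)

/-- The second-order term `DF(μ_s) A_{s,t}`. -/
noncomputable def derLevel (S : ℝ → Vec d) (P : ℕ → ℕ → ℝ) (J : Jet d) (s t : ℝ) : ℝ :=
  ∑ i, ∑ j, jder J i j (market S s) * marketLift S P s t (j, i)

/-- The second-order term `(F ⊗ F)(μ_s) A_{s,t}`. -/
noncomputable def sqLevel (S : ℝ → Vec d) (P : ℕ → ℕ → ℝ) (J : Jet d) (s t : ℝ) : ℝ :=
  ∑ i, ∑ j, jval J i (market S s) * jval J j (market S s) * marketLift S P s t (i, j)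

/-- The germ of the logarithmic relative wealth. -/
noncomputable def logGerm (S : ℝ → Vec d) (P : ℕ → ℕ → ℝ) (J : Jet d) (s t : ℝ) : ℝ :=
  zinc S J s t - 1 / 2 * zinc S J s t ^ 2 + derLevel S P J s t + sqLevel S P J s t

/-- The logarithmic relative wealth. -/
noncomputable def logV (S : ℝ → Vec d) (P : ℕ → ℕ → ℝ) (J : Jet d) (t : ℝ) : ℝ :=
  meshLimit (logGerm S P J) 0 t

lemma zinc_split (J : Jet d) (s u t : ℝ) : zinc S J s t = zinc S J s u
    + ∑ i, jval J i (market S s) * (market S t i - market S u i) := by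
  simp only [zinc, ← Finset.sum_add_distrib]
  exact Finset.sum_congr rfl fun i _ => by ring

lemma derLevel_split (hd : 0 < d) (hp : 0 < p) (hp' : p < 3) (hS : IsPricePath p S P) (J : Jet d)
    {s u t : ℝ} (hs : 0 ≤ s) (hsu : s ≤ u) (hut : u ≤ t) :
    derLevel S P J s t = derLevel S P J s u + derLevel S P J u t
      - ∑ i, ∑ j, (jder J i j (market S u) - jder J i j (market S s)) * marketLift S P u t (j, i)
      + ∑ i, (∑ j, jder J i j (market S s) * (market S u j - market S s j))
        * (market S t i - market S u i) := by
  simp only [derLevel, Finset.sum_mul, ← Finset.sum_add_distrib, ← Finset.sum_sub_distrib]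
  refine Finset.sum_congr rfl fun i _ => Finset.sum_congr rfl fun j _ => ?_
  rw [marketLift_chen hd hp hp' hS hs hsu hut j i]
  ring

lemma sqLevel_split (hd : 0 < d) (hp : 0 < p) (hp' : p < 3) (hS : IsPricePath p S P) (J : Jet d)
    {s u t : ℝ} (hs : 0 ≤ s) (hsu : s ≤ u) (hut : u ≤ t) :
    sqLevel S P J s t = sqLevel S P J s u + sqLevel S P J u t
      - ∑ i, ∑ j, (jval J i (market S u) * jval J j (market S u)
        - jval J i (market S s) * jval J j (market S s)) * marketLift S P u t (i, j)
      + zinc S J s u * ∑ i, jval J i (market S s) * (market S t i - market S u i) := by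
  simp only [sqLevel, zinc, Finset.sum_mul_sum, ← Finset.sum_add_distrib,
    ← Finset.sum_sub_distrib]
  refine Finset.sum_congr rfl fun i _ => Finset.sum_congr rfl fun j _ => ?_
  rw [marketLift_chen hd hp hp' hS hs hsu hut i j]
  ring

variable {J : ι → Jet d} {D : ℝ}

lemma zinc_bigO (hd : 0 < d) (hp : 0 < p) (hS : IsPricePath p S P) (hr : RoughCtl p T S P ω)
    (hD : ∀ a, ‖J a‖ ≤ D) :
    (fun x : ι × ℝ × ℝ => zinc S (J x.1) x.2.1 x.2.2) =O[tri ι T] gau ω (1 / p) :=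
  IsBigO.fun_sum fun i _ => bigO_one_mul (jval_bigO hd hS hD i) (market_bigO hd hp hS hr i)

lemma logGerm_bigO (hd : 0 < d) (hp : 0 < p) (hp' : p < 3) (hS : IsPricePath p S P)
    (hr : RoughCtl p T S P ω) (hJ : ∀ a, IsJet (J a)) (hD : ∀ a, ‖J a‖ ≤ D) :
    (fun x : ι × ℝ × ℝ × ℝ => logGerm S P (J x.1) x.2.1 x.2.2.2
      - logGerm S P (J x.1) x.2.1 x.2.2.1 - logGerm S P (J x.1) x.2.2.1 x.2.2.2)
      =O[tri3 ι T] fun x => gau3 ω (1 / p) x ^ 3 := by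
  have hω := hr.reg.1
  have hpos : 0 ≤ 1 / p := by positivity
  set h3 : ι × ℝ × ℝ × ℝ → ℝ := gau3 ω (1 / p)
  have hL := gau_left (ι := ι) hω hpos
  have hR := gau_right (ι := ι) hω hpos
  have m2 : ∀ i, (fun x : ι × ℝ × ℝ × ℝ => market S x.2.2.2 i - market S x.2.2.1 i)
      =O[tri3 ι T] fun x => h3 x ^ 1 := fun i =>
    ((bigO_right (market_bigO hd hp hS hr i)).trans hR).congr_right fun x => (pow_one _).symm
  have a2 : ∀ ij, (fun x : ι × ℝ × ℝ × ℝ => marketLift S P x.2.2.1 x.2.2.2 ij)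
      =O[tri3 ι T] fun x => h3 x ^ 2 := fun ij =>
    (bigO_right (marketLift_bigO hd hp hp' hS hr ij)).trans (hR.pow 2)
  have f1 : ∀ i, (fun x : ι × ℝ × ℝ × ℝ => jval (J x.1) i (market S x.2.2.1)
      - jval (J x.1) i (market S x.2.1)) =O[tri3 ι T] fun x => h3 x ^ 1 := fun i =>
    ((bigO_left (jval_inc_bigO hd hp hS hr hJ hD i)).trans hL).congr_right fun x => (pow_one _).symm
  have d1 : ∀ i j, (fun x : ι × ℝ × ℝ × ℝ => jder (J x.1) i j (market S x.2.2.1)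
      - jder (J x.1) i j (market S x.2.1)) =O[tri3 ι T] fun x => h3 x ^ 1 := fun i j =>
    ((bigO_left (jder_inc_bigO hd hp hS hr hJ hD i j)).trans hL).congr_right
      fun x => (pow_one _).symm
  have r1 : ∀ i, (fun x : ι × ℝ × ℝ × ℝ => jval (J x.1) i (market S x.2.2.1)
      - jval (J x.1) i (market S x.2.1)
      - ∑ j, jder (J x.1) i j (market S x.2.1) * (market S x.2.2.1 j - market S x.2.1 j))
      =O[tri3 ι T] fun x => h3 x ^ 2 := fun i =>
    (bigO_left (jval_rem_bigO hd hp hS hr hJ hD i)).trans (hL.pow 2)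
  have fs : ∀ i, (fun x : ι × ℝ × ℝ × ℝ => jval (J x.1) i (market S x.2.1))
      =O[tri3 ι T] fun _ => (1 : ℝ) := fun i => bigO_left (jval_bigO hd hS hD i)
  have fu : ∀ i, (fun x : ι × ℝ × ℝ × ℝ => jval (J x.1) i (market S x.2.2.1))
      =O[tri3 ι T] fun _ => (1 : ℝ) := fun i => bigO_right (jval_bigO hd hS hD i)
  have t1 := IsBigO.fun_sum (s := (Finset.univ : Finset (Fin d))) fun i _ => bigO_mul (r1 i) (m2 i)
  have t2 := IsBigO.fun_sum (s := (Finset.univ : Finset (Fin d))) fun i _ =>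
    IsBigO.fun_sum (s := (Finset.univ : Finset (Fin d))) fun j _ => bigO_mul (d1 i j) (a2 (j, i))
  have ff : ∀ i j, (fun x : ι × ℝ × ℝ × ℝ =>
      jval (J x.1) i (market S x.2.2.1) * jval (J x.1) j (market S x.2.2.1)
      - jval (J x.1) i (market S x.2.1) * jval (J x.1) j (market S x.2.1))
      =O[tri3 ι T] fun x => h3 x ^ 1 := fun i j =>
    ((bigO_mul_one (f1 i) (fu j)).add (bigO_one_mul (fs i) (f1 j))).congr_left fun x => by ring
  have t3 := IsBigO.fun_sum (s := (Finset.univ : Finset (Fin d))) fun i _ =>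
    IsBigO.fun_sum (s := (Finset.univ : Finset (Fin d))) fun j _ => bigO_mul (ff i j) (a2 (i, j))
  have c1 := IsBigO.fun_sum (s := (Finset.univ : Finset (Fin d))) fun i _ => bigO_mul (f1 i) (m2 i)
  have b1 := IsBigO.fun_sum (s := (Finset.univ : Finset (Fin d))) fun i _ =>
    bigO_one_mul ((fu i).add (fs i)) (m2 i)
  have t4 := (bigO_mul c1 b1).const_mul_left (1 / 2)
  refine (((t4.sub t1).sub t2).sub t3).congr' ?_ EventuallyEq.rfl
  refine eventually_principal.2 fun x hx => ?_
  obtain ⟨a, s, u, t⟩ := x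
  obtain ⟨hs, hsu, hut, -⟩ := hx
  simp only at hs hsu hut ⊢
  simp only [logGerm]
  rw [zinc_split (J a) s u t, derLevel_split hd hp hp' hS (J a) hs hsu hut,
    sqLevel_split hd hp hp' hS (J a) hs hsu hut]
  simp only [sub_mul, add_mul, Finset.sum_sub_distrib, Finset.sum_add_distrib]
  simp only [zinc]
  ring

lemma logGerm_self (hd : 0 < d) (hp : 0 < p) (hp' : p < 3) (hS : IsPricePath p S P) (J : Jet d)
    {t : ℝ} (ht : 0 ≤ t) : logGerm S P J t t = 0 := by
  simp [logGerm, zinc, derLevel, sqLevel, marketLift_self hd hp hp' hS ht]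

lemma logGerm_isGerm (hd : 0 < d) (hp : 0 < p) (hp' : p < 3) (hS : IsPricePath p S P)
    (hr : RoughCtl p T S P ω) (hJ : ∀ a, IsJet (J a)) (hD : ∀ a, ‖J a‖ ≤ D) :
    ∃ C, 0 ≤ C ∧ ∀ a, IsGerm T (3 / p) C ω (logGerm S P (J a)) := by
  have h1 := gau3_pow (ι := ι) hr.reg.1 (1 / p) 3
  rw [show 1 / p * ((3 : ℕ) : ℝ) = 3 / p by push_cast; ring] at h1
  obtain ⟨C, hC⟩ := (bigO_tri3_iff (f := fun a s u t => logGerm S P (J a) s t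
      - logGerm S P (J a) s u - logGerm S P (J a) u t) (g := fun _ s _ t => ω s t ^ (3 / p))).1
    ((logGerm_bigO hd hp hp' hS hr hJ hD).congr' EventuallyEq.rfl h1)
  refine ⟨|C|, abs_nonneg C, fun a => ⟨fun t ht _ => logGerm_self hd hp hp' hS (J a) ht,
    fun s u t a1 a2 a3 a4 => (hC a s u t a1 a2 a3 a4).trans ?_⟩⟩
  have := hr.reg.1.1 s t a1 (a2.trans a3) a4
  rw [Real.norm_of_nonneg (by positivity)]
  exact mul_le_mul_of_nonneg_right (le_abs_self C) (by positivity)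

/-- The local expansion of the logarithmic relative wealth. -/
lemma logV_sub_bigO (hd : 0 < d) (hp : 0 < p) (hp' : p < 3) (hS : IsPricePath p S P)
    (hr : RoughCtl p T S P ω) (hJ : ∀ a, IsJet (J a)) (hD : ∀ a, ‖J a‖ ≤ D) :
    (fun x : ι × ℝ × ℝ => logV S P (J x.1) x.2.2 - logV S P (J x.1) x.2.1
      - logGerm S P (J x.1) x.2.1 x.2.2) =O[tri ι T] fun x => gau ω (1 / p) x ^ 3 := by
  obtain ⟨C, hC, hG⟩ := logGerm_isGerm hd hp hp' hS hr hJ hD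
  have hθ := one_lt_three_div hp hp'
  have h1 := gau_pow (ι := ι) hr.reg.1 (1 / p) 3
  rw [show 1 / p * ((3 : ℕ) : ℝ) = 3 / p by push_cast; ring] at h1
  refine IsBigO.congr' ?_ EventuallyEq.rfl h1.symm
  refine (bigO_tri_iff (f := fun a s t => logV S P (J a) t - logV S P (J a) s
    - logGerm S P (J a) s t) (g := fun _ s t => ω s t ^ (3 / p))).2
    ⟨C * sewC (3 / p), fun a s t hs hst ht => ?_⟩
  have := hr.reg.1.1 s t hs hst ht
  rw [Real.norm_of_nonneg (r := ω s t ^ (3 / p)) (by positivity)]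
  have h2 := (hG a).meshLimit_add hθ hC hr.reg le_rfl hs hst ht
  have h3 := (hG a).norm_meshLimit_sub_le hθ hC hr.reg hs hst ht
  rwa [← sub_eq_iff_eq_add'.2 h2.symm] at h3

lemma logV_zero (hd : 0 < d) (hp : 0 < p) (hp' : p < 3) (hS : IsPricePath p S P) {J : Jet d}
    (hJ : IsJet J) : logV S P J 0 = 0 := by
  obtain ⟨ω, hr⟩ := exists_roughCtl hp hS (le_refl 0)
  obtain ⟨C, hC, hG⟩ := logGerm_isGerm (ι := Unit) hd hp hp' hS hr (fun _ => hJ)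
    (fun _ => le_refl ‖J‖)
  exact (hG ()).meshLimit_self (one_lt_three_div hp hp') hC hr.reg le_rfl le_rfl

lemma psum_derLevel_tendsto (hd : 0 < d) (hp : 2 < p) (hp' : p < 3) (hS : IsPricePath p S P)
    (hT : 0 ≤ T) {J : Jet d} (hJ : IsJet J) :
    Tendsto (psum P T (derLevel S P J)) atTop (𝓝 0) := by
  have hp0 : 0 < p := by linarith
  obtain ⟨ω, hr⟩ := exists_roughCtl hp0 hS hT
  have h1 := tendsto_finsetSum (Finset.univ : Finset (Fin d)) fun i _ =>
    tendsto_finsetSum (Finset.univ : Finset (Fin d)) fun j _ =>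
      psum_mul_marketLift_tendsto hd hp hp' hS hT hr ((jet_mctl hd hp0 hS hr hJ i).deriv j)
        (((jet_mctl hd hp0 hS hr hJ i).deriv j).continuousOn (by positivity) hr.reg) (j, i)
  simp only [Finset.sum_const_zero, ← psum_sum] at h1
  exact h1

lemma psum_sqLevel_tendsto (hd : 0 < d) (hp : 2 < p) (hp' : p < 3) (hS : IsPricePath p S P)
    (hT : 0 ≤ T) {J : Jet d} (hJ : IsJet J) :
    Tendsto (psum P T (sqLevel S P J)) atTop (𝓝 0) := by
  have hp0 : 0 < p := by linarith
  obtain ⟨ω, hr⟩ := exists_roughCtl hp0 hS hT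
  have hg := hr.gauges hp0 le_rfl hS
  have hc := fun i => (jet_mctl hd hp0 hS hr hJ i).sctl hd hp0 hS hr
  have h1 := tendsto_finsetSum (Finset.univ : Finset (Fin d)) fun i _ =>
    tendsto_finsetSum (Finset.univ : Finset (Fin d)) fun j _ =>
      psum_mul_marketLift_tendsto hd hp hp' hS hT hr
        (((hc i).inc hg).mul ((hc j).inc hg) (hc i).cont (hc j).cont)
        ((hc i).cont.mul (hc j).cont) (i, j)
  simp only [Finset.sum_const_zero, ← psum_sum] at h1
  exact h1

/-- The logarithmic relative wealth as a limit along the given partitions. -/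
lemma psum_zinc_tendsto (hd : 0 < d) (hp : 2 < p) (hp' : p < 3) (hS : IsPricePath p S P)
    (hT : 0 ≤ T) {J : Jet d} (hJ : IsJet J) :
    Tendsto (psum P T fun s t => zinc S J s t - 1 / 2 * zinc S J s t ^ 2) atTop
      (𝓝 (logV S P J T)) := by
  have hp0 : 0 < p := by linarith
  obtain ⟨ω, hr⟩ := exists_roughCtl hp0 hS hT
  obtain ⟨C, hC, hG⟩ := logGerm_isGerm (ι := Unit) hd hp0 hp' hS hr (fun _ => hJ)
    (fun _ => le_refl ‖J‖)
  have h1 := ((hG ()).hasMeshLimit (one_lt_three_div hp0 hp') hC hr.reg le_rfl hT le_rfl).psum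
    hS.gridSeq hT
  have h2 := (h1.sub (psum_derLevel_tendsto hd hp hp' hS hT hJ)).sub
    (psum_sqLevel_tendsto hd hp hp' hS hT hJ)
  rw [sub_zero, sub_zero] at h2
  refine h2.congr fun n => ?_
  rw [← psum_sub, ← psum_sub]
  congr 1
  funext s t
  simp only [logGerm]
  ring

variable {α : ℝ≥0} {K : ℝ}

lemma controlledWealth_eq (hd : 0 < d) (hp : 2 < p) (hp' : p < 3) (hq : p ≤ q)
    (hpq : 1 < 2 / p + 1 / q) (hS : IsPricePath p S P) (hT : 0 ≤ T) (F : HolderBall d α K) :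
    controlledWealth p q S P F T = Real.exp (logV S P F.1 T) := by
  have hp0 : 0 < p := by linarith
  obtain ⟨ℓ, h1, h2⟩ := relWealth_gen hd hp hp' hq hpq hS hT (eval_continuousOn hd hp0 hS hT F)
    (controlledPortfolio_isControlled hd hp0 hq hS hT F) fun _ _ => rfl
  simp only [HolderBall.eval_apply] at h2
  rw [tendsto_nhds_unique (psum_zinc_tendsto hd hp hp' hS hT F.isJet) h2]
  exact h1

lemma abs_coord_le (v : Vec d) (i : Fin d) : |v i| ≤ ‖v‖ := PiLp.norm_apply_le v i

lemma abs_zinc_le (hd : 0 < d) (hS : IsPricePath p S P) {J : Jet d} (hJ : ‖J‖ ≤ D) {s : ℝ}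
    (hs : 0 ≤ s) (t : ℝ) : |zinc S J s t| ≤ D * ∑ i, |market S t i - market S s i| := by
  rw [zinc, Finset.mul_sum]
  refine (Finset.abs_sum_le_sum_abs _ _).trans (Finset.sum_le_sum fun i _ => ?_)
  rw [abs_mul]
  exact mul_le_mul_of_nonneg_right (abs_jval_le hJ (market_mem hd hS hs) i) (abs_nonneg _)

lemma zinc_sub (J J' : Jet d) (s t : ℝ) : zinc S (J - J') s t = zinc S J s t - zinc S J' s t := by
  simp only [zinc, jval_sub, sub_mul, Finset.sum_sub_distrib]

/-- The germ of the rough integral `∫ F(μ) dμ` is almost additive, with the exact dependence on the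
variation of `μ` and of its lift. -/
lemma intGerm_isGerm (hd : 0 < d) (hp : 2 < p) (hp' : p < 3) (hS : IsPricePath p S P)
    (hT : 0 ≤ T) {J : Jet d} (hJ : IsJet J) {a b : ℝ}
    (ha : (pVar p (inc (market S)) 0 T).toReal = a)
    (hb : (pVar (p / 2) (marketLift S P) 0 T).toReal = b) :
    ∃ w, IsControl T w ∧ w 0 T ≤ 2 ∧ IsGerm T (3 / p) ((d : ℝ) ^ 2 * ‖J‖ * (a ^ 3 + a * b)) w
      (fun s t => zinc S J s t + derLevel S P J s t) := by
  have hp0 : 0 < p := by linarith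
  have hp2 : 0 < p / 2 := by linarith
  have fμ := pVar_market_lt_top hd hp0 hS hT
  have fA := pVar_marketLift_lt_top hd hp0 hp' hS hT
  have ha0 : 0 ≤ a := ha ▸ ENNReal.toReal_nonneg
  have hb0 : 0 ≤ b := hb ▸ ENNReal.toReal_nonneg
  have cμ := isControl_varControl hp0 fμ
  have cA := isControl_varControl hp2 fA
  have eμ : varControl p (inc (market S)) 0 T = a ^ p := by rw [varControl_eq hp0, ha]
  have eA : varControl (p / 2) (marketLift S P) 0 T = b ^ (p / 2) := by rw [varControl_eq hp2, hb]
  set ωμ := varControl p (inc (market S))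
  set ωA := varControl (p / 2) (marketLift S P)
  set w : ℝ → ℝ → ℝ := fun s t => (a ^ p)⁻¹ * ωμ s t + (b ^ (p / 2))⁻¹ * ωA s t with hw
  have hwc : IsControl T w := (cμ.const_mul (by positivity)).add (cA.const_mul (by positivity))
  have nμ : ∀ s t, 0 ≤ s → s ≤ t → t ≤ T → ‖inc (market S) s t‖ ≤ a * w s t ^ (1 / p) := by
    intro s t hs hst ht
    have h1 := norm_le_varControl hp0 fμ hs hst ht
    have h2 := cμ.1 s t hs hst ht
    have h3 := cA.1 s t hs hst ht
    have h4 := cμ.mono le_rfl hs hst ht le_rfl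
    rw [eμ] at h4
    rcases ha0.eq_or_lt with h5 | h5
    · rw [← h5, Real.zero_rpow hp0.ne'] at h4
      have h6 : ωμ s t = 0 := le_antisymm h4 h2
      refine h1.trans ?_
      rw [show varControl p (inc (market S)) s t = 0 from h6, Real.zero_rpow (by positivity), ← h5,
        zero_mul]
    · have h6 : ωμ s t ≤ a ^ p * w s t := by
        have : 0 < a ^ p := by positivity
        simp only [hw]
        rw [mul_add, mul_inv_cancel_left₀ this.ne']
        have : 0 ≤ a ^ p * ((b ^ (p / 2))⁻¹ * ωA s t) := by positivity
        linarith
      have h7 := Real.rpow_le_rpow h2 h6 (by positivity : 0 ≤ 1 / p)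
      rw [Real.mul_rpow (by positivity) (hwc.1 s t hs hst ht), ← Real.rpow_mul ha0,
        mul_one_div_cancel hp0.ne', Real.rpow_one] at h7
      exact h1.trans h7
  have nA : ∀ s t, 0 ≤ s → s ≤ t → t ≤ T → ‖marketLift S P s t‖ ≤ b * w s t ^ (2 / p) := by
    intro s t hs hst ht
    have h1 := norm_le_varControl hp2 fA hs hst ht
    rw [one_div_div] at h1
    have h2 := cA.1 s t hs hst ht
    have h3 := cμ.1 s t hs hst ht
    have h4 := cA.mono le_rfl hs hst ht le_rfl
    rw [eA] at h4
    rcases hb0.eq_or_lt with h5 | h5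
    · rw [← h5, Real.zero_rpow hp2.ne'] at h4
      have h6 : ωA s t = 0 := le_antisymm h4 h2
      refine h1.trans ?_
      rw [show varControl (p / 2) (marketLift S P) s t = 0 from h6, Real.zero_rpow (by positivity),
        ← h5, zero_mul]
    · have h6 : ωA s t ≤ b ^ (p / 2) * w s t := by
        have : 0 < b ^ (p / 2) := by positivity
        simp only [hw]
        rw [mul_add, mul_inv_cancel_left₀ this.ne']
        have : 0 ≤ b ^ (p / 2) * ((a ^ p)⁻¹ * ωμ s t) := by positivity
        linarith
      have h7 := Real.rpow_le_rpow h2 h6 (by positivity : 0 ≤ 2 / p)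
      rw [Real.mul_rpow (by positivity) (hwc.1 s t hs hst ht), ← Real.rpow_mul hb0,
        div_mul_div_cancel₀ two_ne_zero, div_self hp0.ne', Real.rpow_one] at h7
      exact h1.trans h7
  refine ⟨w, hwc, ?_, fun t ht _ => ?_, fun s u t hs hsu hut ht => ?_⟩
  · simp only [hw, eμ, eA]
    have h1 : (a ^ p)⁻¹ * a ^ p ≤ 1 := inv_mul_le_one
    have h2 : (b ^ (p / 2))⁻¹ * b ^ (p / 2) ≤ 1 := inv_mul_le_one
    linarith
  · simp [zinc, derLevel, marketLift_self hd hp0 hp' hS ht]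
  · have hu := hs.trans hsu
    have hW0 := hwc.1 s t hs (hsu.trans hut) ht
    set W := w s t
    have hx0 : 0 ≤ W ^ (1 / p) := by positivity
    set x := W ^ (1 / p) with hx
    have hx2 : W ^ (2 / p) = x ^ 2 := by
      rw [hx, ← Real.rpow_natCast, ← Real.rpow_mul hW0]; congr 1; push_cast; ring
    have hx3 : W ^ (3 / p) = x ^ 3 := by
      rw [hx, ← Real.rpow_natCast, ← Real.rpow_mul hW0]; congr 1; push_cast; ring
    have n1 : ‖market S u - market S s‖ ≤ a * x := (nμ s u hs hsu (hut.trans ht)).trans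
      (mul_le_mul_of_nonneg_left (Real.rpow_le_rpow (hwc.1 s u hs hsu (hut.trans ht))
        (hwc.mono hs le_rfl hsu hut ht) (by positivity)) ha0)
    have n2 : ‖market S t - market S u‖ ≤ a * x := (nμ u t hu hut ht).trans
      (mul_le_mul_of_nonneg_left (Real.rpow_le_rpow (hwc.1 u t hu hut ht)
        (hwc.mono hs hsu hut le_rfl ht) (by positivity)) ha0)
    have n3 : ‖marketLift S P u t‖ ≤ b * x ^ 2 := (nA u t hu hut ht).trans (by
      rw [← hx2]
      exact mul_le_mul_of_nonneg_left (Real.rpow_le_rpow (hwc.1 u t hu hut ht)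
        (hwc.mono hs hsu hut le_rfl ht) (by positivity)) hb0)
    have e : zinc S J s t + derLevel S P J s t - (zinc S J s u + derLevel S P J s u)
        - (zinc S J u t + derLevel S P J u t)
        = -(∑ i, (jval J i (market S u) - jval J i (market S s)
          - ∑ j, jder J i j (market S s) * (market S u j - market S s j))
          * (market S t i - market S u i)
          + ∑ i, ∑ j, (jder J i j (market S u) - jder J i j (market S s))
            * marketLift S P u t (j, i)) := by
      rw [zinc_split J s u t, derLevel_split hd hp0 hp' hS J hs hsu hut]
      simp only [sub_mul, Finset.sum_sub_distrib]
      simp only [zinc]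
      ring
    rw [e, hx3, norm_neg, Real.norm_eq_abs]
    have ms := market_mem hd hS hs
    have mu := market_mem hd hS hu
    have b1 : |∑ i, (jval J i (market S u) - jval J i (market S s)
          - ∑ j, jder J i j (market S s) * (market S u j - market S s j))
          * (market S t i - market S u i)| ≤ d * (‖J‖ * (a * x) ^ 2 * (a * x)) := by
      refine (Finset.abs_sum_le_sum_abs _ _).trans
        ((Finset.sum_le_card_nsmul _ _ (‖J‖ * (a * x) ^ 2 * (a * x)) fun i _ => ?_).trans
          (le_of_eq (by simp)))
      rw [abs_mul]
      refine mul_le_mul ((hJ.abs_taylor_le le_rfl ms mu i).trans ?_)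
        ((abs_coord_le (market S t - market S u) i).trans n2) (abs_nonneg _) (by positivity)
      exact mul_le_mul_of_nonneg_left (pow_le_pow_left₀ (norm_nonneg _) n1 2) (norm_nonneg _)
    have b2 : |∑ i, ∑ j, (jder J i j (market S u) - jder J i j (market S s))
            * marketLift S P u t (j, i)| ≤ d * (d * (‖J‖ * (a * x) * (b * x ^ 2))) := by
      refine (Finset.abs_sum_le_sum_abs _ _).trans
        ((Finset.sum_le_card_nsmul _ _ (d * (‖J‖ * (a * x) * (b * x ^ 2))) fun i _ => ?_).trans
          (le_of_eq (by simp)))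
      refine (Finset.abs_sum_le_sum_abs _ _).trans
        ((Finset.sum_le_card_nsmul _ _ (‖J‖ * (a * x) * (b * x ^ 2)) fun j _ => ?_).trans
          (le_of_eq (by simp)))
      rw [abs_mul]
      refine mul_le_mul ((hJ.abs_jder_sub_le le_rfl ms mu i j).trans ?_)
        ((PiLp.norm_apply_le (marketLift S P u t) (j, i)).trans n3) (abs_nonneg _) (by positivity)
      exact mul_le_mul_of_nonneg_left n1 (norm_nonneg _)
    have hd1 : (1 : ℝ) ≤ d := by exact_mod_cast hd
    have b3 : (d : ℝ) * (‖J‖ * (a * x) ^ 2 * (a * x)) ≤ d * (d * (‖J‖ * (a * x) ^ 2 * (a * x))) :=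
      mul_le_mul_of_nonneg_left (le_mul_of_one_le_left (by positivity) hd1) (by positivity)
    calc _ ≤ _ := abs_add_le _ _
      _ ≤ d * (d * (‖J‖ * (a * x) ^ 2 * (a * x))) + d * (d * (‖J‖ * (a * x) * (b * x ^ 2))) :=
        add_le_add (b1.trans b3) b2
      _ = _ := by ring

lemma bracket_nonneg (hd : 0 < d) (hp : 2 < p) (hp' : p < 3) (hS : IsPricePath p S P)
    (hT : 0 ≤ T) (i : Fin d) : 0 ≤ bracket (market S) (marketLift S P) i i T :=
  ge_of_tendsto' (psum_sq_tendsto hd hp hp' hS hT i)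
    fun _ => Finset.sum_nonneg fun _ _ => sq_nonneg _

lemma clock_nonneg (hd : 0 < d) (hp : 2 < p) (hp' : p < 3) (hS : IsPricePath p S P)
    (hT : 0 ≤ T) : 0 ≤ clock p S P T := by
  have := Finset.sum_nonneg fun i (_ : i ∈ Finset.univ) => bracket_nonneg hd hp hp' hS hT i
  unfold clock xi
  positivity

/-- The constant in the Lipschitz estimate for the logarithmic relative wealth. -/
noncomputable def lipC (d : ℕ) (p K : ℝ) : ℝ :=
  (d : ℝ) ^ 2 * (sewC (3 / p) * 2 ^ (3 / p)) + (d : ℝ) ^ 2 + K * d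

lemma lipC_nonneg (hp : 0 < p) (hp' : p < 3) (hK : 0 ≤ K) : 0 ≤ lipC d p K := by
  have := sewC_pos (one_lt_three_div hp hp')
  unfold lipC; positivity

/-- The logarithmic relative wealth is Lipschitz in the generating function, with a constant
proportional to the clock. -/
theorem abs_logV_sub_le (hd : 0 < d) (hp : 2 < p) (hp' : p < 3) (hS : IsPricePath p S P)
    (hT : 0 ≤ T) {J J' : Jet d} (hJ : IsJet J) (hJ' : IsJet J') (hJK : ‖J‖ ≤ K) (hJK' : ‖J'‖ ≤ K) :
    |logV S P J T - logV S P J' T| ≤ lipC d p K * ‖J - J'‖ * clock p S P T := by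
  have hp0 : 0 < p := by linarith
  have hP := hS.gridSeq
  have hθ := one_lt_three_div hp0 hp'
  have hsew := sewC_pos hθ
  have hK0 : 0 ≤ K := (norm_nonneg J).trans hJK
  have hH := hJ.sub hJ'
  set H := J - J' with hHdef
  obtain ⟨a, ha⟩ : ∃ a, (pVar p (inc (market S)) 0 T).toReal = a := ⟨_, rfl⟩
  obtain ⟨b, hb⟩ : ∃ b, (pVar (p / 2) (marketLift S P) 0 T).toReal = b := ⟨_, rfl⟩
  have ha0 : 0 ≤ a := ha ▸ ENNReal.toReal_nonneg
  have hb0 : 0 ≤ b := hb ▸ ENNReal.toReal_nonneg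
  obtain ⟨w, hwc, hw2, hG⟩ := intGerm_isGerm hd hp hp' hS hT hH ha hb
  set β := ∑ i, bracket (market S) (marketLift S P) i i T with hβ
  have hβ0 : 0 ≤ β := Finset.sum_nonneg fun i _ => bracket_nonneg hd hp hp' hS hT i
  have hd1 : (1 : ℝ) ≤ d := by exact_mod_cast hd
  set M := (d : ℝ) ^ 2 * ‖H‖ * (a ^ 3 + a * b) * (sewC (3 / p) * 2 ^ (3 / p))
    + ((d : ℝ) ^ 2 * ‖H‖ * (a + b)) with hM
  have h1 : ∀ n, |psum P T (fun s t => zinc S H s t + derLevel S P H s t) n| ≤ M := by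
    intro n
    have h2 := hG.sum_sub_le hθ (by positivity) hwc (u := grid P T n) (N := numPts P T n)
      (fun i _ => hP.grid_mono n (Nat.le_succ i)) (hP.grid_nonneg hT n 0) (grid_le n _)
    rw [hP.grid_zero hT, hP.grid_last] at h2
    have h3 : w 0 T ^ (3 / p) ≤ 2 ^ (3 / p) :=
      Real.rpow_le_rpow (hwc.1 0 T le_rfl hT le_rfl) hw2 (by positivity)
    have h4 : |zinc S H 0 T + derLevel S P H 0 T| ≤ (d : ℝ) ^ 2 * ‖H‖ * (a + b) := by
      have m0 := market_mem hd hS (le_refl 0)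
      have n1 : ‖inc (market S) 0 T‖ ≤ a := by
        rw [← ha, ← varControl_rpow hp0]
        exact norm_le_varControl hp0 (pVar_market_lt_top hd hp0 hS hT) le_rfl hT le_rfl
      have n2 : ‖marketLift S P 0 T‖ ≤ b := by
        rw [← hb, ← varControl_rpow (by linarith : 0 < p / 2)]
        exact norm_le_varControl (by linarith) (pVar_marketLift_lt_top hd hp0 hp' hS hT) le_rfl hT
          le_rfl
      have c1 : |zinc S H 0 T| ≤ ‖H‖ * (d * a) := by
        refine (abs_zinc_le hd hS le_rfl le_rfl T).trans
          (mul_le_mul_of_nonneg_left ?_ (norm_nonneg _))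
        exact (Finset.sum_le_card_nsmul _ _ a fun i _ =>
          (abs_coord_le (inc (market S) 0 T) i).trans n1).trans (le_of_eq (by simp))
      have c2 : |derLevel S P H 0 T| ≤ d * (d * (‖H‖ * b)) := by
        refine (Finset.abs_sum_le_sum_abs _ _).trans
          ((Finset.sum_le_card_nsmul _ _ (d * (‖H‖ * b)) fun i _ => ?_).trans (le_of_eq (by simp)))
        refine (Finset.abs_sum_le_sum_abs _ _).trans
          ((Finset.sum_le_card_nsmul _ _ (‖H‖ * b) fun j _ => ?_).trans (le_of_eq (by simp)))
        rw [abs_mul]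
        exact mul_le_mul (abs_jder_le le_rfl m0 i j)
          ((PiLp.norm_apply_le (marketLift S P 0 T) (j, i)).trans n2) (abs_nonneg _) (norm_nonneg _)
      have c3 : ‖H‖ * (d * a) ≤ ‖H‖ * (d * (d * a)) := mul_le_mul_of_nonneg_left
        (mul_le_mul_of_nonneg_left (le_mul_of_one_le_left ha0 hd1) (by positivity)) (norm_nonneg _)
      calc _ ≤ _ := abs_add_le _ _
        _ ≤ ‖H‖ * (d * (d * a)) + d * (d * (‖H‖ * b)) := add_le_add (c1.trans c3) c2
        _ = _ := by ring
    have h5 : |psum P T (fun s t => zinc S H s t + derLevel S P H s t) n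
        - (zinc S H 0 T + derLevel S P H 0 T)|
        ≤ (d : ℝ) ^ 2 * ‖H‖ * (a ^ 3 + a * b) * (sewC (3 / p) * 2 ^ (3 / p)) := by
      refine le_trans h2 ?_
      rw [mul_assoc]
      exact mul_le_mul_of_nonneg_left (mul_le_mul_of_nonneg_left h3 hsew.le) (by positivity)
    calc _ = |(psum P T (fun s t => zinc S H s t + derLevel S P H s t) n
        - (zinc S H 0 T + derLevel S P H 0 T)) + (zinc S H 0 T + derLevel S P H 0 T)| := by
          rw [sub_add_cancel]
      _ ≤ _ := abs_add_le _ _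
      _ ≤ M := add_le_add h5 h4
  have h6 : ∀ s t, 0 ≤ s → s ≤ t → t ≤ T → ‖zinc S J s t ^ 2 - zinc S J' s t ^ 2‖
      ≤ (2 * K * ‖H‖ * d) * ∑ i, (market S t i - market S s i) ^ 2 := by
    intro s t hs _ _
    have e1 : zinc S J s t ^ 2 - zinc S J' s t ^ 2
        = zinc S H s t * (zinc S J s t + zinc S J' s t) := by rw [hHdef, zinc_sub]; ring
    set σ := ∑ i, |market S t i - market S s i|
    have e2 := abs_zinc_le hd hS (le_refl ‖H‖) hs t
    have e3 : |zinc S J s t + zinc S J' s t| ≤ 2 * K * σ := (abs_add_le _ _).trans (by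
      linarith [abs_zinc_le hd hS hJK hs t, abs_zinc_le hd hS hJK' hs t])
    have e4 : σ ^ 2 ≤ d * ∑ i, (market S t i - market S s i) ^ 2 := by
      have := sq_sum_le_card_mul_sum_sq (s := (Finset.univ : Finset (Fin d)))
        (f := fun i => |market S t i - market S s i|)
      simpa using this
    have hσ : 0 ≤ σ := Finset.sum_nonneg fun i _ => abs_nonneg _
    rw [e1, Real.norm_eq_abs, abs_mul]
    calc _ ≤ (‖H‖ * σ) * (2 * K * σ) := mul_le_mul e2 e3 (abs_nonneg _) (by positivity)
      _ = 2 * K * ‖H‖ * σ ^ 2 := by ring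
      _ ≤ 2 * K * ‖H‖ * (d * ∑ i, (market S t i - market S s i) ^ 2) :=
        mul_le_mul_of_nonneg_left e4 (by positivity)
      _ = _ := by ring
  have h7 : Tendsto (psum P T fun s t => (2 * K * ‖H‖ * d) * ∑ i, (market S t i - market S s i) ^ 2)
      atTop (𝓝 (2 * K * ‖H‖ * d * β)) := by
    have := (tendsto_finsetSum (Finset.univ : Finset (Fin d)) fun i _ =>
      psum_sq_tendsto hd hp hp' hS hT i).const_mul (2 * K * ‖H‖ * d)
    refine this.congr fun n => ?_
    rw [psum_mul, psum_sum]
  have h8 := ((psum_zinc_tendsto hd hp hp' hS hT hJ).sub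
    (psum_zinc_tendsto hd hp hp' hS hT hJ')).abs
  have h9 := ((psum_derLevel_tendsto hd hp hp' hS hT hH).abs.const_add M).add (h7.const_mul (1 / 2))
  rw [abs_zero, add_zero] at h9
  have h10 : |logV S P J T - logV S P J' T| ≤ M + 1 / 2 * (2 * K * ‖H‖ * d * β) := by
    refine le_of_tendsto_of_tendsto' h8 h9 fun n => ?_
    have e5 : psum P T (fun s t => zinc S J s t - 1 / 2 * zinc S J s t ^ 2) n
        - psum P T (fun s t => zinc S J' s t - 1 / 2 * zinc S J' s t ^ 2) n
        = psum P T (fun s t => zinc S H s t + derLevel S P H s t) n - psum P T (derLevel S P H) n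
          - 1 / 2 * psum P T (fun s t => zinc S J s t ^ 2 - zinc S J' s t ^ 2) n := by
      rw [← psum_mul, ← psum_sub, ← psum_sub, ← psum_sub]
      congr 1
      funext s t
      rw [hHdef, zinc_sub]
      ring
    have e6 := hP.norm_psum_le hT h6 n
    rw [Real.norm_eq_abs] at e6
    rw [e5]
    refine (abs_sub _ _).trans ?_
    rw [abs_mul, abs_of_pos (by norm_num : (0 : ℝ) < 1 / 2)]
    have e7 := abs_sub (psum P T (fun s t => zinc S H s t + derLevel S P H s t) n)
      (psum P T (derLevel S P H) n)
    linarith [h1 n]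
  refine h10.trans ?_
  have hclock : clock p S P T = (1 + a ^ 2) * (a + b + β) := by
    simp only [clock, xi, ha, hb, hβ]
  rw [hclock, lipC, hM]
  set c := sewC (3 / p) * 2 ^ (3 / p)
  have hc0 : 0 ≤ c := by positivity
  have g1 : a ^ 3 + a * b ≤ (1 + a ^ 2) * (a + b + β) := by
    nlinarith [sq_nonneg (a - 1), mul_nonneg ha0 hb0, mul_nonneg (sq_nonneg a) hβ0,
      mul_nonneg hb0 (sq_nonneg (a - 1)), mul_nonneg hb0 (sq_nonneg a)]
  have g2 : a + b ≤ (1 + a ^ 2) * (a + b + β) := by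
    nlinarith [mul_nonneg (sq_nonneg a) (add_nonneg (add_nonneg ha0 hb0) hβ0)]
  have g3 : β ≤ (1 + a ^ 2) * (a + b + β) := by
    nlinarith [mul_nonneg (sq_nonneg a) (add_nonneg (add_nonneg ha0 hb0) hβ0)]
  set Q := (1 + a ^ 2) * (a + b + β)
  calc _ ≤ (d : ℝ) ^ 2 * ‖H‖ * Q * c + (d : ℝ) ^ 2 * ‖H‖ * Q + 1 / 2 * (2 * K * ‖H‖ * d * Q) := by
        gcongr
    _ = _ := by ring

end LogWealth

/-! ### The exponential of a small function -/

section Exponential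

variable {X : Type*} {l : Filter X} {h f : X → ℝ}

lemma exp_bigO_three (hh : h =O[l] fun _ => (1 : ℝ)) (hf : f =O[l] fun x => h x ^ 1) :
    (fun x => Real.exp (f x) - 1 - f x - f x ^ 2 / 2) =O[l] fun x => h x ^ 3 := by
  have hf1 : f =O[l] fun _ => (1 : ℝ) := hf.trans (by simpa using hh)
  have hf3 : (fun x => f x ^ 3) =O[l] fun x => h x ^ 3 := by simpa using hf.pow 3
  obtain ⟨B, hB⟩ := hf1.bound
  refine IsBigO.trans (IsBigO.of_bound (Real.exp B) ?_) hf3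
  filter_upwards [hB] with x hx
  rw [norm_one, mul_one, Real.norm_eq_abs] at hx
  have h1 := Complex.norm_exp_sub_sum_le_norm_mul_exp (f x : ℂ) 3
  have h2 : Complex.exp (f x : ℂ) - ∑ m ∈ Finset.range 3, (f x : ℂ) ^ m / m.factorial
      = ((Real.exp (f x) - 1 - f x - f x ^ 2 / 2 : ℝ) : ℂ) := by
    simp only [Finset.sum_range_succ, Finset.sum_range_zero, Nat.factorial]
    push_cast
    ring
  rw [h2, Complex.norm_real, Complex.norm_real, Real.norm_eq_abs (f x)] at h1
  refine h1.trans ?_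
  rw [norm_pow, Real.norm_eq_abs (f x), mul_comm]
  gcongr

end Exponential

/-! ### Averages of functionally controlled portfolios -/

section Averages

variable {ι : Type*} {d : ℕ} {p q T : ℝ} {S : ℝ → Vec d} {P : ℕ → ℕ → ℝ} {ω : ℝ → ℝ → ℝ}
  {J : ι → Jet d} {D : ℝ}

lemma derLevel_bigO (hd : 0 < d) (hp : 0 < p) (hp' : p < 3) (hS : IsPricePath p S P)
    (hr : RoughCtl p T S P ω) (hD : ∀ a, ‖J a‖ ≤ D) :
    (fun x : ι × ℝ × ℝ => derLevel S P (J x.1) x.2.1 x.2.2) =O[tri ι T]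
      fun x => gau ω (1 / p) x ^ 2 :=
  IsBigO.fun_sum fun i _ => IsBigO.fun_sum fun j _ =>
    bigO_one_mul (jder_bigO hd hS hD i j) (marketLift_bigO hd hp hp' hS hr (j, i))

lemma sqLevel_bigO (hd : 0 < d) (hp : 0 < p) (hp' : p < 3) (hS : IsPricePath p S P)
    (hr : RoughCtl p T S P ω) (hD : ∀ a, ‖J a‖ ≤ D) :
    (fun x : ι × ℝ × ℝ => sqLevel S P (J x.1) x.2.1 x.2.2) =O[tri ι T]
      fun x => gau ω (1 / p) x ^ 2 :=
  IsBigO.fun_sum fun i _ => IsBigO.fun_sum fun j _ =>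
    bigO_one_mul (bigO_mul_one (jval_bigO hd hS hD i) (jval_bigO hd hS hD j))
      (marketLift_bigO hd hp hp' hS hr (i, j))

lemma logV_bigO (hd : 0 < d) (hp : 0 < p) (hp' : p < 3) (hS : IsPricePath p S P)
    (hr : RoughCtl p T S P ω) (hJ : ∀ a, IsJet (J a)) (hD : ∀ a, ‖J a‖ ≤ D) :
    (fun x : ι × ℝ × ℝ => logV S P (J x.1) x.2.2 - logV S P (J x.1) x.2.1
      - zinc S (J x.1) x.2.1 x.2.2) =O[tri ι T] fun x => gau ω (1 / p) x ^ 2 := by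
  have hb : gau ω (1 / p) =O[tri ι T] fun _ => (1 : ℝ) := gau_bounded hr.reg.1 (by positivity)
  have h1 := (logV_sub_bigO hd hp hp' hS hr hJ hD).trans (bigO_pow_mono hb (by norm_num : 2 ≤ 3))
  have h2 := ((zinc_bigO hd hp hS hr hD).pow 2).const_mul_left (1 / 2)
  refine (((h1.sub h2).add (derLevel_bigO hd hp hp' hS hr hD)).add
    (sqLevel_bigO hd hp hp' hS hr hD)).congr_left fun x => ?_
  simp only [logGerm]
  ring

lemma logV_inc_bigO (hd : 0 < d) (hp : 0 < p) (hp' : p < 3) (hS : IsPricePath p S P)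
    (hr : RoughCtl p T S P ω) (hJ : ∀ a, IsJet (J a)) (hD : ∀ a, ‖J a‖ ≤ D) :
    (fun x : ι × ℝ × ℝ => logV S P (J x.1) x.2.2 - logV S P (J x.1) x.2.1) =O[tri ι T]
      fun x => gau ω (1 / p) x ^ 1 := by
  have hb : gau ω (1 / p) =O[tri ι T] fun _ => (1 : ℝ) := gau_bounded hr.reg.1 (by positivity)
  have h1 := (logV_bigO hd hp hp' hS hr hJ hD).trans (bigO_pow_mono hb one_le_two)
  have h2 := (zinc_bigO hd hp hS hr hD).congr_right fun x => (pow_one _).symm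
  exact (h1.add h2).congr_left fun x => by ring

/-- The relative wealth as a function of the jet. -/
noncomputable def expV (S : ℝ → Vec d) (P : ℕ → ℕ → ℝ) (J : Jet d) (t : ℝ) : ℝ :=
  Real.exp (logV S P J t)

lemma expV_pos (J : Jet d) (t : ℝ) : 0 < expV S P J t := Real.exp_pos _

lemma exists_expV_le (hd : 0 < d) (hp : 0 < p) (hp' : p < 3) (hS : IsPricePath p S P)
    (hr : RoughCtl p T S P ω) (hJ : ∀ a, IsJet (J a)) (hD : ∀ a, ‖J a‖ ≤ D) :
    ∃ B, ∀ a, ∀ t ∈ Icc 0 T, expV S P (J a) t ≤ B := by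
  have hb : gau ω (1 / p) =O[tri ι T] fun _ => (1 : ℝ) := gau_bounded hr.reg.1 (by positivity)
  have h1 := ((logV_inc_bigO hd hp hp' hS hr hJ hD).congr_right fun x => pow_one _).trans hb
  obtain ⟨C, hC⟩ := (bigO_tri_iff (f := fun a s t => logV S P (J a) t - logV S P (J a) s)
    (g := fun _ _ _ => (1 : ℝ))).1 h1
  refine ⟨Real.exp C, fun a t ht => Real.exp_le_exp.2 ?_⟩
  have h2 := hC a 0 t le_rfl ht.1 ht.2
  rw [logV_zero hd hp hp' hS (hJ a), sub_zero, norm_one, mul_one] at h2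
  exact (le_abs_self _).trans h2

/-- A family of paths, uniformly bounded and with uniform bounds for the increments. -/
structure UnifPath [TopologicalSpace ι] (p T : ℝ) (ω : ℝ → ℝ → ℝ) (φ : ι → ℝ → ℝ) : Prop where
  cont : ∀ t ∈ Icc 0 T, Continuous fun a => φ a t
  bdd : ∃ B, ∀ a, ∀ t ∈ Icc 0 T, |φ a t| ≤ B
  inc : (fun x : ι × ℝ × ℝ => φ x.1 x.2.2 - φ x.1 x.2.1) =O[tri ι T] gau ω (1 / p)

section UnifPath

variable [TopologicalSpace ι] {φ ψ : ι → ℝ → ℝ}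

lemma UnifPath.bigO_start (hφ : UnifPath p T ω φ) :
    (fun x : ι × ℝ × ℝ => φ x.1 x.2.1) =O[tri ι T] fun _ => (1 : ℝ) := by
  obtain ⟨B, hB⟩ := hφ.bdd
  exact (bigO_tri_iff (f := fun a s _ => φ a s) (g := fun _ _ _ => (1 : ℝ))).2
    ⟨B, fun a s t h1 h2 h3 => by simpa using hB a s ⟨h1, h2.trans h3⟩⟩

lemma UnifPath.bigO_end (hφ : UnifPath p T ω φ) :
    (fun x : ι × ℝ × ℝ => φ x.1 x.2.2) =O[tri ι T] fun _ => (1 : ℝ) := by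
  obtain ⟨B, hB⟩ := hφ.bdd
  exact (bigO_tri_iff (f := fun a _ t => φ a t) (g := fun _ _ _ => (1 : ℝ))).2
    ⟨B, fun a s t h1 h2 h3 => by simpa using hB a t ⟨h1.trans h2, h3⟩⟩

lemma UnifPath.add (hφ : UnifPath p T ω φ) (hψ : UnifPath p T ω ψ) :
    UnifPath p T ω fun a t => φ a t + ψ a t := by
  obtain ⟨B, hB⟩ := hφ.bdd
  obtain ⟨C, hC⟩ := hψ.bdd
  exact ⟨fun t ht => (hφ.cont t ht).add (hψ.cont t ht),
    ⟨B + C, fun a t ht => (abs_add_le _ _).trans (add_le_add (hB a t ht) (hC a t ht))⟩,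
    (hφ.inc.add hψ.inc).congr_left fun x => by ring⟩

lemma UnifPath.mul (hφ : UnifPath p T ω φ) (hψ : UnifPath p T ω ψ) :
    UnifPath p T ω fun a t => φ a t * ψ a t := by
  obtain ⟨B, hB⟩ := hφ.bdd
  obtain ⟨C, hC⟩ := hψ.bdd
  refine ⟨fun t ht => (hφ.cont t ht).mul (hψ.cont t ht), ⟨B * C, fun a t ht => ?_⟩,
    ((bigO_mul_one hφ.inc hψ.bigO_end).add (bigO_one_mul hφ.bigO_start hψ.inc)).congr_left
      fun x => by ring⟩
  rw [abs_mul]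
  exact mul_le_mul (hB a t ht) (hC a t ht) (abs_nonneg _) ((abs_nonneg _).trans (hB a t ht))

lemma UnifPath.const (b : ℝ) : UnifPath p T ω fun (_ : ι) _ => b :=
  ⟨fun _ _ => continuous_const, ⟨|b|, fun _ _ _ => le_rfl⟩, by simpa using isBigO_zero _ _⟩

lemma continuous_jval (hJc : Continuous J) (i : Fin d) {x : Vec d} (hx : x ∈ simplex d) :
    Continuous fun a => jval (J a) i x := by
  simp only [jval, dif_pos hx]
  have h1 : Continuous fun a => (J a).1 ⟨x, hx⟩ :=
    (BoundedContinuousFunction.lipschitz_eval_const (β := Vec d)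
      (⟨x, hx⟩ : simplex d)).continuous.comp (continuous_fst.comp hJc)
  fun_prop

lemma continuous_jder (hJc : Continuous J) (i j : Fin d) {x : Vec d} (hx : x ∈ simplex d) :
    Continuous fun a => jder (J a) i j x := by
  simp only [jder, dif_pos hx]
  have h1 : Continuous fun a => (J a).2.1 ⟨x, hx⟩ :=
    (BoundedContinuousFunction.lipschitz_eval_const (β := Vec d →L[ℝ] Vec d)
      (⟨x, hx⟩ : simplex d)).continuous.comp (continuous_fst.comp (continuous_snd.comp hJc))
  fun_prop

lemma continuous_logV (hd : 0 < d) (hp : 2 < p) (hp' : p < 3) (hS : IsPricePath p S P)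
    (hJ : ∀ a, IsJet (J a)) (hD : ∀ a, ‖J a‖ ≤ D) (hJc : Continuous J) {t : ℝ} (ht : 0 ≤ t) :
    Continuous fun a => logV S P (J a) t := by
  refine continuous_iff_continuousAt.2 fun b => ?_
  refine tendsto_iff_norm_sub_tendsto_zero.2 (squeeze_zero (fun _ => norm_nonneg _)
    (fun a => abs_logV_sub_le hd hp hp' hS ht (hJ a) (hJ b) (hD a) (hD b)) ?_)
  have h1 : Tendsto (fun a => ‖J a - J b‖) (𝓝 b) (𝓝 0) :=
    tendsto_iff_norm_sub_tendsto_zero.1 (hJc.tendsto b)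
  simpa using (h1.const_mul (lipC d p D)).mul_const (clock p S P t)

lemma unifPath_jval (hd : 0 < d) (hp : 0 < p) (hS : IsPricePath p S P) (hr : RoughCtl p T S P ω)
    (hJ : ∀ a, IsJet (J a)) (hD : ∀ a, ‖J a‖ ≤ D) (hJc : Continuous J) (i : Fin d) :
    UnifPath p T ω fun a t => jval (J a) i (market S t) :=
  ⟨fun _ ht => continuous_jval hJc i (market_mem hd hS ht.1),
    ⟨D, fun a _ ht => abs_jval_le (hD a) (market_mem hd hS ht.1) i⟩,
    jval_inc_bigO hd hp hS hr hJ hD i⟩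

lemma unifPath_jder (hd : 0 < d) (hp : 0 < p) (hS : IsPricePath p S P) (hr : RoughCtl p T S P ω)
    (hJ : ∀ a, IsJet (J a)) (hD : ∀ a, ‖J a‖ ≤ D) (hJc : Continuous J) (i j : Fin d) :
    UnifPath p T ω fun a t => jder (J a) i j (market S t) :=
  ⟨fun _ ht => continuous_jder hJc i j (market_mem hd hS ht.1),
    ⟨D, fun a _ ht => abs_jder_le (hD a) (market_mem hd hS ht.1) i j⟩,
    jder_inc_bigO hd hp hS hr hJ hD i j⟩

end UnifPath

lemma integral_bigO [MeasurableSpace ι] {m : Measure ι} [IsProbabilityMeasure m] {c : ℝ → ℝ → ℝ} {b : ℝ} {n : ℕ} {f : ι × ℝ × ℝ → ℝ}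
    (hf : f =O[tri ι T] fun x => gau c b x ^ n) :
    (fun x : Unit × ℝ × ℝ => ∫ a, f (a, x.2) ∂m) =O[tri Unit T] fun x => gau c b x ^ n := by
  obtain ⟨C, hC⟩ := (bigO_tri_iff (f := fun a s t => f (a, s, t))
    (g := fun _ s t => (c s t ^ b) ^ n)).1 hf
  refine (bigO_tri_iff (f := fun (_ : Unit) s t => ∫ a, f (a, s, t) ∂m)
    (g := fun _ s t => (c s t ^ b) ^ n)).2 ⟨C, fun _ s t h1 h2 h3 => ?_⟩
  simpa using norm_integral_le_of_norm_le_const (μ := m) (.of_forall fun a => hC a s t h1 h2 h3)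

lemma expV_start_bigO (hd : 0 < d) (hp : 0 < p) (hp' : p < 3) (hS : IsPricePath p S P)
    (hr : RoughCtl p T S P ω) (hJ : ∀ a, IsJet (J a)) (hD : ∀ a, ‖J a‖ ≤ D) :
    (fun x : ι × ℝ × ℝ => expV S P (J x.1) x.2.1) =O[tri ι T] fun _ => (1 : ℝ) := by
  obtain ⟨B, hB⟩ := exists_expV_le hd hp hp' hS hr hJ hD
  exact (bigO_tri_iff (f := fun a s _ => expV S P (J a) s) (g := fun _ _ _ => (1 : ℝ))).2
    ⟨B, fun a s t h1 h2 h3 => by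
      rw [Real.norm_of_nonneg (expV_pos _ _).le, norm_one, mul_one]
      exact hB a s ⟨h1, h2.trans h3⟩⟩

/-- The third order expansion of the relative wealth. -/
lemma expV_sub_bigO (hd : 0 < d) (hp : 0 < p) (hp' : p < 3) (hS : IsPricePath p S P)
    (hr : RoughCtl p T S P ω) (hJ : ∀ a, IsJet (J a)) (hD : ∀ a, ‖J a‖ ≤ D) :
    (fun x : ι × ℝ × ℝ => expV S P (J x.1) x.2.2 - expV S P (J x.1) x.2.1
      - expV S P (J x.1) x.2.1 * (zinc S (J x.1) x.2.1 x.2.2 + derLevel S P (J x.1) x.2.1 x.2.2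
        + sqLevel S P (J x.1) x.2.1 x.2.2)) =O[tri ι T] fun x => gau ω (1 / p) x ^ 3 := by
  have hb : gau ω (1 / p) =O[tri ι T] fun _ => (1 : ℝ) := gau_bounded hr.reg.1 (by positivity)
  have h1 := logV_inc_bigO hd hp hp' hS hr hJ hD
  have h2 := logV_bigO hd hp hp' hS hr hJ hD
  have h3 := logV_sub_bigO hd hp hp' hS hr hJ hD
  have hz := (zinc_bigO hd hp hS hr hD).congr_right fun x => (pow_one _).symm
  have h4 := ((bigO_mul h2 (h1.add hz)).const_mul_left (1 / 2)).add h3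
  have h5 := bigO_one_mul (expV_start_bigO hd hp hp' hS hr hJ hD) ((exp_bigO_three hb h1).add h4)
  refine h5.congr_left fun x => ?_
  have h6 : expV S P (J x.1) x.2.2 = expV S P (J x.1) x.2.1
      * Real.exp (logV S P (J x.1) x.2.2 - logV S P (J x.1) x.2.1) := by
    rw [expV, expV, ← Real.exp_add]
    congr 1
    ring
  rw [h6]
  simp only [logGerm]
  ring

lemma expV_sub_bigO_two (hd : 0 < d) (hp : 0 < p) (hp' : p < 3) (hS : IsPricePath p S P)
    (hr : RoughCtl p T S P ω) (hJ : ∀ a, IsJet (J a)) (hD : ∀ a, ‖J a‖ ≤ D) :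
    (fun x : ι × ℝ × ℝ => expV S P (J x.1) x.2.2 - expV S P (J x.1) x.2.1
      - expV S P (J x.1) x.2.1 * zinc S (J x.1) x.2.1 x.2.2) =O[tri ι T]
        fun x => gau ω (1 / p) x ^ 2 := by
  have hb : gau ω (1 / p) =O[tri ι T] fun _ => (1 : ℝ) := gau_bounded hr.reg.1 (by positivity)
  have h1 := (expV_sub_bigO hd hp hp' hS hr hJ hD).trans (bigO_pow_mono hb (by norm_num : 2 ≤ 3))
  have h2 := bigO_one_mul (expV_start_bigO hd hp hp' hS hr hJ hD)
    ((derLevel_bigO hd hp hp' hS hr hD).add (sqLevel_bigO hd hp hp' hS hr hD))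
  exact (h1.add h2).congr_left fun x => by ring

lemma expV_inc_bigO (hd : 0 < d) (hp : 0 < p) (hp' : p < 3) (hS : IsPricePath p S P)
    (hr : RoughCtl p T S P ω) (hJ : ∀ a, IsJet (J a)) (hD : ∀ a, ‖J a‖ ≤ D) :
    (fun x : ι × ℝ × ℝ => expV S P (J x.1) x.2.2 - expV S P (J x.1) x.2.1) =O[tri ι T]
      gau ω (1 / p) := by
  have hb : gau ω (1 / p) =O[tri ι T] fun _ => (1 : ℝ) := gau_bounded hr.reg.1 (by positivity)
  have h1 := (expV_sub_bigO_two hd hp hp' hS hr hJ hD).trans (bigO_pow_mono hb one_le_two)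
  simp only [pow_one] at h1
  have h2 := bigO_one_mul (expV_start_bigO hd hp hp' hS hr hJ hD) (zinc_bigO hd hp hS hr hD)
  exact (h1.add h2).congr_left fun x => by ring

variable [TopologicalSpace ι]

lemma unifPath_expV (hd : 0 < d) (hp : 2 < p) (hp' : p < 3) (hS : IsPricePath p S P)
    (hr : RoughCtl p T S P ω) (hJ : ∀ a, IsJet (J a)) (hD : ∀ a, ‖J a‖ ≤ D) (hJc : Continuous J) :
    UnifPath p T ω fun a t => expV S P (J a) t := by
  have hp0 : 0 < p := by linarith
  refine ⟨fun t ht => Real.continuous_exp.comp (continuous_logV hd hp hp' hS hJ hD hJc ht.1), ?_,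
    expV_inc_bigO hd hp0 hp' hS hr hJ hD⟩
  obtain ⟨B, hB⟩ := exists_expV_le hd hp0 hp' hS hr hJ hD
  exact ⟨B, fun a t ht => by rw [abs_of_pos (expV_pos _ _)]; exact hB a t ht⟩

variable [MeasurableSpace ι] [OpensMeasurableSpace ι] {m : Measure ι} [IsProbabilityMeasure m]
  {φ : ι → ℝ → ℝ}

lemma UnifPath.integrable (hφ : UnifPath p T ω φ) {t : ℝ} (ht : t ∈ Icc 0 T) :
    Integrable (fun a => φ a t) m := by
  obtain ⟨B, hB⟩ := hφ.bdd
  exact Integrable.of_bound (hφ.cont t ht).aestronglyMeasurable B (.of_forall fun a => hB a t ht)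

lemma UnifPath.incO_integral (hφ : UnifPath p T ω φ) :
    IncO T (gau ω (1 / p)) fun t => ∫ a, φ a t ∂m := by
  have h1 := integral_bigO (m := m) (n := 1) (hφ.inc.congr_right fun x => (pow_one _).symm)
  simp only [pow_one] at h1
  refine h1.congr' (eventually_principal.2 fun x hx => ?_) EventuallyEq.rfl
  exact integral_sub (hφ.integrable ⟨hx.1.trans hx.2.1, hx.2.2⟩)
    (hφ.integrable ⟨hx.1, hx.2.1.trans hx.2.2⟩)

/-- The wealth-weighted average. -/
noncomputable def wavg (S : ℝ → Vec d) (P : ℕ → ℕ → ℝ) (J : ι → Jet d) (m : Measure ι)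
    (φ : ι → ℝ → ℝ) (t : ℝ) : ℝ := ∫ a, expV S P (J a) t * φ a t ∂m

lemma wavg_mctl (hd : 0 < d) (hp : 2 < p) (hp' : p < 3) (hS : IsPricePath p S P)
    (hr : RoughCtl p T S P ω) (hJ : ∀ a, IsJet (J a)) (hD : ∀ a, ‖J a‖ ≤ D) (hJc : Continuous J)
    {φ' : Fin d → ι → ℝ → ℝ} (hφ : UnifPath p T ω φ) (hφ' : ∀ j, UnifPath p T ω (φ' j))
    (hrem : (fun x : ι × ℝ × ℝ => φ x.1 x.2.2 - φ x.1 x.2.1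
      - ∑ j, φ' j x.1 x.2.1 * (market S x.2.2 j - market S x.2.1 j)) =O[tri ι T]
        fun x => gau ω (1 / p) x ^ 2) :
    MCtl p T ω S (wavg S P J m φ) (fun j => wavg S P J m
      fun a t => jval (J a) j (market S t) * φ a t + φ' j a t) := by
  have hp0 : 0 < p := by linarith
  have he := unifPath_expV hd hp hp' hS hr hJ hD hJc
  have hw : ∀ j, UnifPath p T ω fun a t =>
      expV S P (J a) t * (jval (J a) j (market S t) * φ a t + φ' j a t) := fun j =>
    he.mul (((unifPath_jval hd hp0 hS hr hJ hD hJc j).mul hφ).add (hφ' j))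
  refine ⟨fun j => (hw j).incO_integral, ?_⟩
  have h1 := bigO_mul_one (expV_sub_bigO_two hd hp0 hp' hS hr hJ hD) hφ.bigO_start
  have h2 := bigO_one_mul he.bigO_start hrem
  have h3 := (he.inc.mul hφ.inc).congr_right fun x => (pow_two _).symm
  refine (integral_bigO (m := m) ((h1.add h2).add h3)).congr'
    (eventually_principal.2 fun x hx => ?_) EventuallyEq.rfl
  have hs : x.2.1 ∈ Icc 0 T := ⟨hx.1, hx.2.1.trans hx.2.2⟩
  have ht : x.2.2 ∈ Icc 0 T := ⟨hx.1.trans hx.2.1, hx.2.2⟩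
  simp only [wavg]
  rw [← integral_sub ((he.mul hφ).integrable ht) ((he.mul hφ).integrable hs)]
  simp only [← integral_mul_const]
  rw [← integral_finsetSum _ fun j _ => ((hw j).integrable hs).mul_const _,
    ← integral_sub (f := fun a => expV S P (J a) x.2.2 * φ a x.2.2
        - expV S P (J a) x.2.1 * φ a x.2.1)
      (((he.mul hφ).integrable ht).sub ((he.mul hφ).integrable hs))
      (integrable_finsetSum _ fun j _ => ((hw j).integrable hs).mul_const _)]
  refine integral_congr_ae (.of_forall fun a => ?_)
  simp only [zinc, mul_add, add_mul, Finset.sum_add_distrib, mul_sub, sub_mul, Finset.mul_sum,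
    Finset.sum_mul, Finset.sum_sub_distrib]
  ring_nf

end Averages

/-! ### The universal portfolio -/

section Universal

variable {d : ℕ} {p q T : ℝ} {S : ℝ → Vec d} {P : ℕ → ℕ → ℝ} {ω : ℝ → ℝ → ℝ}

lemma IncO.log {g : Unit × ℝ × ℝ → ℝ} {f : ℝ → ℝ} (hf : IncO T g f)
    (hc : ContinuousOn f (Icc 0 T)) (h0 : ∀ t ∈ Icc 0 T, 0 < f t) :
    IncO T g fun t => Real.log (f t) := by
  have hi : ContinuousOn (fun t => (f t)⁻¹) (Icc 0 T) := hc.inv₀ fun t ht => (h0 t ht).ne'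
  have h1 := (bigO_mul_one hf (bigO_start (ι := Unit) hi)).norm_left.add
    (bigO_mul_one hf (bigO_end (ι := Unit) hi)).norm_left
  refine IsBigO.trans (IsBigO.of_bound 1 (eventually_principal.2 fun x hx => ?_)) h1
  have hs := h0 _ ⟨hx.1, hx.2.1.trans hx.2.2⟩
  have ht := h0 _ ⟨hx.1.trans hx.2.1, hx.2.2⟩
  have e1 := Real.log_le_sub_one_of_pos (div_pos ht hs)
  have e2 := Real.log_le_sub_one_of_pos (div_pos hs ht)
  rw [Real.log_div ht.ne' hs.ne', div_sub_one hs.ne', div_eq_mul_inv] at e1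
  rw [Real.log_div hs.ne' ht.ne', div_sub_one ht.ne', div_eq_mul_inv] at e2
  rw [one_mul, Real.norm_eq_abs]
  refine le_trans ?_ (le_abs_self _)
  have a1 := le_abs_self ((f x.2.2 - f x.2.1) * (f x.2.1)⁻¹)
  have a2 := neg_abs_le ((f x.2.2 - f x.2.1) * (f x.2.2)⁻¹)
  have b1 := abs_nonneg ((f x.2.2 - f x.2.1) * (f x.2.1)⁻¹)
  have b2 := abs_nonneg ((f x.2.2 - f x.2.1) * (f x.2.2)⁻¹)
  simp only [Real.norm_eq_abs]
  rw [abs_le]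
  constructor <;> linarith

section Family

variable {ι : Type*} [MeasurableSpace ι] {m : Measure ι} [IsProbabilityMeasure m] {J : ι → Jet d}
  {D : ℝ}

/-- The average relative wealth. -/
noncomputable def avgV (S : ℝ → Vec d) (P : ℕ → ℕ → ℝ) (J : ι → Jet d) (m : Measure ι) (t : ℝ) :
    ℝ := wavg S P J m (fun _ _ => 1) t

/-- The wealth-weighted average of the functions. -/
noncomputable def avgF (S : ℝ → Vec d) (P : ℕ → ℕ → ℝ) (J : ι → Jet d) (m : Measure ι) (t : ℝ) :
    Vec d := WithLp.toLp 2 fun i => wavg S P J m (fun a t => jval (J a) i (market S t)) t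
      * (avgV S P J m t)⁻¹

lemma avgV_zero (hd : 0 < d) (hp : 0 < p) (hp' : p < 3) (hS : IsPricePath p S P)
    (hJ : ∀ a, IsJet (J a)) : avgV S P J m 0 = 1 := by
  simp [avgV, wavg, expV, logV_zero hd hp hp' hS (hJ _)]

variable [TopologicalSpace ι] [OpensMeasurableSpace ι]

lemma avgV_pos (hd : 0 < d) (hp : 2 < p) (hp' : p < 3) (hS : IsPricePath p S P)
    (hr : RoughCtl p T S P ω) (hJ : ∀ a, IsJet (J a)) (hD : ∀ a, ‖J a‖ ≤ D) (hJc : Continuous J)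
    {t : ℝ} (ht : t ∈ Icc 0 T) : 0 < avgV S P J m t := by
  simp only [avgV, wavg, mul_one]
  exact integral_exp_pos ((unifPath_expV hd hp hp' hS hr hJ hD hJc).integrable ht)

lemma avgV_mctl (hd : 0 < d) (hp : 2 < p) (hp' : p < 3) (hS : IsPricePath p S P)
    (hr : RoughCtl p T S P ω) (hJ : ∀ a, IsJet (J a)) (hD : ∀ a, ‖J a‖ ≤ D) (hJc : Continuous J) :
    MCtl p T ω S (avgV S P J m)
      (fun j => wavg S P J m fun a t => jval (J a) j (market S t)) := by
  have h := wavg_mctl (m := m) hd hp hp' hS hr hJ hD hJc (φ := fun _ _ => 1)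
    (φ' := fun _ _ _ => 0) (UnifPath.const 1) (fun _ => UnifPath.const 0)
    (by simpa using isBigO_zero _ _)
  simp only [mul_one, add_zero] at h
  exact h

lemma wavg_jval_mctl (hd : 0 < d) (hp : 2 < p) (hp' : p < 3) (hS : IsPricePath p S P)
    (hr : RoughCtl p T S P ω) (hJ : ∀ a, IsJet (J a)) (hD : ∀ a, ‖J a‖ ≤ D) (hJc : Continuous J)
    (i : Fin d) :
    MCtl p T ω S (wavg S P J m fun a t => jval (J a) i (market S t))
      (fun j => wavg S P J m fun a t => jval (J a) j (market S t) * jval (J a) i (market S t)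
        + jder (J a) i j (market S t)) := by
  have hp0 : 0 < p := by linarith
  exact wavg_mctl hd hp hp' hS hr hJ hD hJc (φ' := fun j a t => jder (J a) i j (market S t))
    (unifPath_jval hd hp0 hS hr hJ hD hJc i) (fun j => unifPath_jder hd hp0 hS hr hJ hD hJc i j)
    (jval_rem_bigO hd hp0 hS hr hJ hD i)

lemma avgF_sctl (hd : 0 < d) (hp : 2 < p) (hp' : p < 3) (hS : IsPricePath p S P)
    (hr : RoughCtl p T S P ω) (hJ : ∀ a, IsJet (J a)) (hD : ∀ a, ‖J a‖ ≤ D) (hJc : Continuous J)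
    (i : Fin d) : ∃ g', SCtl T (gau ω (1 / p)) (gau ω (1 / p)) S
      (fun t => avgF S P J m t i) g' := by
  have hp0 : 0 < p := by linarith
  have hg := hr.gauges hp0 le_rfl hS
  exact ⟨_, ((wavg_jval_mctl hd hp hp' hS hr hJ hD hJc i).sctl hd hp0 hS hr).mul hg
    (((avgV_mctl hd hp hp' hS hr hJ hD hJc).sctl hd hp0 hS hr).inv hg fun t ht =>
      (avgV_pos hd hp hp' hS hr hJ hD hJc ht).ne')⟩

/-- The second-order term of the average relative wealth. -/
noncomputable def avgLevel (S : ℝ → Vec d) (P : ℕ → ℕ → ℝ) (J : ι → Jet d) (m : Measure ι)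
    (s t : ℝ) : ℝ :=
  ∑ i, ∑ j, ((wavg S P J m fun a t => jder (J a) i j (market S t)) s * (avgV S P J m s)⁻¹
      * marketLift S P s t (j, i)
    + (wavg S P J m fun a t => jval (J a) i (market S t) * jval (J a) j (market S t)) s
      * (avgV S P J m s)⁻¹ * marketLift S P s t (i, j))

lemma avgV_sub_bigO (hd : 0 < d) (hp : 2 < p) (hp' : p < 3) (hS : IsPricePath p S P)
    (hr : RoughCtl p T S P ω) (hJ : ∀ a, IsJet (J a)) (hD : ∀ a, ‖J a‖ ≤ D) (hJc : Continuous J) :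
    (fun x : Unit × ℝ × ℝ => (avgV S P J m x.2.2 - avgV S P J m x.2.1) * (avgV S P J m x.2.1)⁻¹
      - ∑ i, avgF S P J m x.2.1 i * (market S x.2.2 i - market S x.2.1 i)
      - avgLevel S P J m x.2.1 x.2.2) =O[tri Unit T] fun x => gau ω (1 / p) x ^ 3 := by
  have hp0 : 0 < p := by linarith
  have he := unifPath_expV hd hp hp' hS hr hJ hD hJc
  have hv := unifPath_jval hd hp0 hS hr hJ hD hJc
  have hj := unifPath_jder hd hp0 hS hr hJ hD hJc
  have hc := ((avgV_mctl (m := m) hd hp hp' hS hr hJ hD hJc).sctl hd hp0 hS hr).cont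
  have hi : ContinuousOn (fun t => (avgV S P J m t)⁻¹) (Icc 0 T) :=
    hc.inv₀ fun t ht => (avgV_pos hd hp hp' hS hr hJ hD hJc ht).ne'
  have h0 := integral_bigO (m := m) (expV_sub_bigO hd hp0 hp' hS hr hJ hD)
  refine (bigO_one_mul (bigO_start hi) h0).congr'
    (eventually_principal.2 fun x hx => ?_) EventuallyEq.rfl
  obtain ⟨u, s, t⟩ := x
  obtain ⟨h1, h2, h3⟩ := hx
  simp only at h1 h2 h3 ⊢
  have hs : s ∈ Icc 0 T := ⟨h1, h2.trans h3⟩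
  have ht : t ∈ Icc 0 T := ⟨h1.trans h2, h3⟩
  have iz : Integrable (fun a => ∑ i, expV S P (J a) s * jval (J a) i (market S s)
      * (market S t i - market S s i)) m :=
    integrable_finsetSum _ fun i _ => ((he.mul (hv i)).integrable hs).mul_const _
  have idd : ∀ i j, Integrable (fun a => expV S P (J a) s * jder (J a) i j (market S s)
      * marketLift S P s t (j, i)) m :=
    fun i j => ((he.mul (hj i j)).integrable hs).mul_const _
  have iq : ∀ i j, Integrable (fun a => expV S P (J a) s
      * (jval (J a) i (market S s) * jval (J a) j (market S s))
      * marketLift S P s t (i, j)) m :=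
    fun i j => ((he.mul ((hv i).mul (hv j))).integrable hs).mul_const _
  have idq : ∀ i j, Integrable (fun a => expV S P (J a) s * jder (J a) i j (market S s)
      * marketLift S P s t (j, i) + expV S P (J a) s
      * (jval (J a) i (market S s) * jval (J a) j (market S s))
      * marketLift S P s t (i, j)) m := fun i j => (idd i j).add (iq i j)
  have il : Integrable (fun a => ∑ i, ∑ j, (expV S P (J a) s * jder (J a) i j (market S s)
      * marketLift S P s t (j, i) + expV S P (J a) s
      * (jval (J a) i (market S s) * jval (J a) j (market S s))
      * marketLift S P s t (i, j))) m :=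
    integrable_finsetSum _ fun i _ => integrable_finsetSum _ fun j _ => idq i j
  have e1 : ∀ a, expV S P (J a) t - expV S P (J a) s
      - expV S P (J a) s * (zinc S (J a) s t + derLevel S P (J a) s t + sqLevel S P (J a) s t)
      = expV S P (J a) t - expV S P (J a) s
      - ∑ i, expV S P (J a) s * jval (J a) i (market S s) * (market S t i - market S s i)
      - ∑ i, ∑ j, (expV S P (J a) s * jder (J a) i j (market S s) * marketLift S P s t (j, i)
        + expV S P (J a) s * (jval (J a) i (market S s) * jval (J a) j (market S s))
          * marketLift S P s t (i, j)) := by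
    intro a
    simp only [zinc, derLevel, sqLevel, mul_add, Finset.mul_sum, Finset.sum_add_distrib, mul_assoc]
    ring
  simp only [e1]
  have i1 : Integrable (fun a => expV S P (J a) t - expV S P (J a) s) m :=
    (he.integrable ht).sub (he.integrable hs)
  have i2 : Integrable (fun a => expV S P (J a) t - expV S P (J a) s - ∑ i, expV S P (J a) s
    * jval (J a) i (market S s) * (market S t i - market S s i)) m := i1.sub iz
  rw [integral_sub i2 il, integral_sub i1 iz, integral_sub (he.integrable ht) (he.integrable hs),
    integral_finsetSum _ fun i _ => ((he.mul (hv i)).integrable hs).mul_const _,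
    integral_finsetSum _ fun i _ => integrable_finsetSum _ fun j _ => idq i j]
  simp only [integral_finsetSum _ fun j _ => idq _ j,
    integral_add (idd _ _) (iq _ _), integral_mul_const]
  simp only [avgLevel, avgF, wavg]
  rw [show avgV S P J m t = ∫ a, expV S P (J a) t ∂m by simp only [avgV, wavg, mul_one],
    show avgV S P J m s = ∫ a, expV S P (J a) s ∂m by simp only [avgV, wavg, mul_one]]
  rw [mul_sub, mul_sub, mul_comm, Finset.mul_sum, Finset.mul_sum]
  congr 1
  · congr 1
    exact Finset.sum_congr rfl fun i _ => by ring
  · simp only [Finset.mul_sum]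
    exact Finset.sum_congr rfl fun i _ => Finset.sum_congr rfl fun j _ => by ring

/-- The logarithm of the average relative wealth has the expansion of the log-wealth of the
weighted average portfolio, up to terms that are negligible along the given partitions. -/
lemma log_avgV_sub_bigO (hd : 0 < d) (hp : 2 < p) (hp' : p < 3) (hS : IsPricePath p S P)
    (hr : RoughCtl p T S P ω) (hJ : ∀ a, IsJet (J a)) (hD : ∀ a, ‖J a‖ ≤ D) (hJc : Continuous J) :
    (fun x : Unit × ℝ × ℝ => Real.log (avgV S P J m x.2.2) - Real.log (avgV S P J m x.2.1)
      - ((∑ i, avgF S P J m x.2.1 i * (market S x.2.2 i - market S x.2.1 i))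
        - 1 / 2 * (∑ i, avgF S P J m x.2.1 i * (market S x.2.2 i - market S x.2.1 i)) ^ 2)
      - avgLevel S P J m x.2.1 x.2.2) =O[tri Unit T] fun x => gau ω (1 / p) x ^ 3 := by
  have hp0 : 0 < p := by linarith
  have hg := hr.gauges hp0 le_rfl hS
  have hb : gau ω (1 / p) =O[tri Unit T] fun _ => (1 : ℝ) := gau_bounded hr.reg.1 (by positivity)
  have hV := (avgV_mctl (m := m) hd hp hp' hS hr hJ hD hJc).sctl hd hp0 hS hr
  have hpos := fun t ht => avgV_pos (m := m) hd hp hp' hS hr hJ hD hJc (t := t) ht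
  have hi : ContinuousOn (fun t => (avgV S P J m t)⁻¹) (Icc 0 T) :=
    hV.cont.inv₀ fun t ht => (hpos t ht).ne'
  have hx : (fun x : Unit × ℝ × ℝ => Real.log (avgV S P J m x.2.2)
      - Real.log (avgV S P J m x.2.1)) =O[tri Unit T] fun x => gau ω (1 / p) x ^ 1 :=
    ((hV.inc hg).log hV.cont hpos).congr_right fun x => (pow_one _).symm
  have hz : (fun x : Unit × ℝ × ℝ => ∑ i, avgF S P J m x.2.1 i
      * (market S x.2.2 i - market S x.2.1 i)) =O[tri Unit T] fun x => gau ω (1 / p) x ^ 1 := by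
    simp only [pow_one]
    refine IsBigO.fun_sum fun i _ => ?_
    obtain ⟨g', hG⟩ := avgF_sctl (m := m) hd hp hp' hS hr hJ hD hJc i
    exact bigO_one_mul (bigO_start hG.cont) (market_bigO hd hp0 hS hr i)
  have hv := unifPath_jval hd hp0 hS hr hJ hD hJc
  have hj := unifPath_jder hd hp0 hS hr hJ hD hJc
  have he := unifPath_expV hd hp hp' hS hr hJ hD hJc
  have hw : (fun x : Unit × ℝ × ℝ => avgLevel S P J m x.2.1 x.2.2) =O[tri Unit T]
      fun x => gau ω (1 / p) x ^ 2 :=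
    IsBigO.fun_sum fun i _ => IsBigO.fun_sum fun j _ =>
      (bigO_one_mul (bigO_start ((((he.mul (hj i j)).incO_integral (m := m)).continuousOn
        (by positivity) hr.reg).mul hi)) (marketLift_bigO hd hp0 hp' hS hr (j, i))).add
      (bigO_one_mul (bigO_start ((((he.mul ((hv i).mul (hv j))).incO_integral (m := m)).continuousOn
        (by positivity) hr.reg).mul hi)) (marketLift_bigO hd hp0 hp' hS hr (i, j)))
  have hy := avgV_sub_bigO (m := m) hd hp hp' hS hr hJ hD hJc
  have hexp : (fun x : Unit × ℝ × ℝ =>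
      (avgV S P J m x.2.2 - avgV S P J m x.2.1) * (avgV S P J m x.2.1)⁻¹
      - (Real.log (avgV S P J m x.2.2) - Real.log (avgV S P J m x.2.1))
      - (Real.log (avgV S P J m x.2.2) - Real.log (avgV S P J m x.2.1)) ^ 2 / 2)
      =O[tri Unit T] fun x => gau ω (1 / p) x ^ 3 := by
    refine (exp_bigO_three hb hx).congr' (eventually_principal.2 fun x hx => ?_) EventuallyEq.rfl
    have hs := hpos _ ⟨hx.1, hx.2.1.trans hx.2.2⟩
    have ht := hpos _ ⟨hx.1.trans hx.2.1, hx.2.2⟩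
    simp only
    rw [Real.exp_sub, Real.exp_log hs, Real.exp_log ht, div_sub_one hs.ne', div_eq_mul_inv]
  have hxz : (fun x : Unit × ℝ × ℝ => Real.log (avgV S P J m x.2.2)
      - Real.log (avgV S P J m x.2.1) - ∑ i, avgF S P J m x.2.1 i
        * (market S x.2.2 i - market S x.2.1 i)) =O[tri Unit T] fun x => gau ω (1 / p) x ^ 2 :=
    (((hy.sub hexp).trans (bigO_pow_mono hb (by norm_num : 2 ≤ 3))).add
      (hw.sub ((bigO_mul hx hx).const_mul_left (1 / 2)))).congr_left fun x => by ring
  have h3 := (bigO_mul hxz (hx.add hz)).const_mul_left (1 / 2)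
  exact ((hy.sub hexp).sub h3).congr_left fun x => by ring

lemma log_avgV_tendsto (hd : 0 < d) (hp : 2 < p) (hp' : p < 3) (hS : IsPricePath p S P)
    (hT : 0 ≤ T) (hJ : ∀ a, IsJet (J a)) (hD : ∀ a, ‖J a‖ ≤ D) (hJc : Continuous J) :
    Tendsto (psum P T fun s t => (∑ i, avgF S P J m s i * (market S t i - market S s i))
        - 1 / 2 * (∑ i, avgF S P J m s i * (market S t i - market S s i)) ^ 2) atTop
      (𝓝 (Real.log (avgV S P J m T))) := by
  have hp0 : 0 < p := by linarith
  obtain ⟨ω, hr⟩ := exists_roughCtl hp0 hS hT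
  have hg := hr.gauges hp0 le_rfl hS
  have hV := (avgV_mctl (m := m) hd hp hp' hS hr hJ hD hJc).sctl hd hp0 hS hr
  have hpos := fun t ht => (avgV_pos (m := m) hd hp hp' hS hr hJ hD hJc (t := t) ht).ne'
  have hi : ContinuousOn (fun t => (avgV S P J m t)⁻¹) (Icc 0 T) := hV.cont.inv₀ hpos
  have hii := (hV.inc hg).inv hV.cont hpos
  have hv := unifPath_jval hd hp0 hS hr hJ hD hJc
  have hj := unifPath_jder hd hp0 hS hr hJ hD hJc
  have he := unifPath_expV hd hp hp' hS hr hJ hD hJc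
  have hmul : ∀ {φ : ι → ℝ → ℝ}, UnifPath p T ω φ → ∀ ij, Tendsto (psum P T fun s t =>
      wavg S P J m φ s * (avgV S P J m s)⁻¹ * marketLift S P s t ij) atTop (𝓝 0) := by
    intro φ hφ ij
    have h1 := (he.mul hφ).incO_integral (m := m)
    have h2 := h1.continuousOn (by positivity) hr.reg
    exact psum_mul_marketLift_tendsto hd hp hp' hS hT hr (h1.mul hii h2 hi) (h2.mul hi) ij
  have hlev : Tendsto (psum P T (avgLevel S P J m)) atTop (𝓝 0) := by
    have h1 := tendsto_finsetSum (Finset.univ : Finset (Fin d)) fun i _ =>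
      tendsto_finsetSum (Finset.univ : Finset (Fin d)) fun j _ =>
        (hmul (hj i j) (j, i)).add (hmul ((hv i).mul (hv j)) (i, j))
    simp only [add_zero, Finset.sum_const_zero] at h1
    refine h1.congr fun n => ?_
    simp only [← psum_add, ← psum_sum]
    rfl
  have h0 := psum_tendsto_zero_of_bigO hp0 hp' hS.gridSeq hT hr.reg
    (Ξ := fun s t => Real.log (avgV S P J m t) - Real.log (avgV S P J m s)
      - ((∑ i, avgF S P J m s i * (market S t i - market S s i))
        - 1 / 2 * (∑ i, avgF S P J m s i * (market S t i - market S s i)) ^ 2)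
      - avgLevel S P J m s t) (log_avgV_sub_bigO hd hp hp' hS hr hJ hD hJc)
  have h1 := (h0.add hlev).const_sub (Real.log (avgV S P J m T))
  rw [add_zero, sub_zero] at h1
  refine h1.congr fun n => ?_
  have h2 := hS.gridSeq.psum_inc hT (fun t => Real.log (avgV S P J m t)) n
  rw [avgV_zero hd hp0 hp' hS hJ, Real.log_one, sub_zero] at h2
  rw [← h2, ← psum_add, ← psum_sub]
  refine hS.gridSeq.psum_congr hT (fun s t _ _ _ => ?_) n
  simp only [inc]
  ring

end Family

end Universal

/-! ### Compactness of the Hölder ball -/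

section Compactness

variable {d : ℕ} {α : ℝ≥0} {K : ℝ}

lemma isCompact_simplex (d : ℕ) : IsCompact (simplex d) :=
  ((EuclideanSpace.equiv (Fin d) ℝ).toHomeomorph.isCompact_preimage).2
    (isCompact_stdSimplex ℝ (Fin d))

instance (d : ℕ) : CompactSpace (simplex d) := isCompact_iff_compactSpace.1 (isCompact_simplex d)

lemma isCompact_closure_holder {X E : Type*} [PseudoMetricSpace X] [CompactSpace X]
    [NormedAddCommGroup E] [ProperSpace E] (K : ℝ) {κ : ℝ} (hκ : 0 < κ) :
    IsCompact (closure {f : X →ᵇ E | ‖f‖ ≤ K ∧ ∀ x y, dist (f x) (f y) ≤ K * dist x y ^ κ}) := by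
  refine BoundedContinuousFunction.arzela_ascoli (Metric.closedBall 0 K)
    (isCompact_closedBall _ _) _ (fun f x hf => ?_) ?_
  · rw [mem_closedBall_zero_iff]
    exact (f.norm_coe_le_norm x).trans hf.1
  · refine Metric.equicontinuous_of_continuity_modulus (fun r => K * r ^ κ) ?_ _
      fun x y f => f.2.2 x y
    have h1 : Tendsto (fun r : ℝ => r ^ κ) (𝓝 0) (𝓝 (0 ^ κ)) :=
      (Real.continuous_rpow_const hκ.le).tendsto 0
    rw [Real.zero_rpow hκ.ne'] at h1
    simpa using h1.const_mul K

lemma totallyBounded_holderSet (hα : 0 < α) : TotallyBounded (holderSet d α K) := by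
  have h1 := isCompact_closure_holder (X := simplex d) (E := Vec d) K one_pos
  have h2 := isCompact_closure_holder (X := simplex d) (E := Vec d →L[ℝ] Vec d) K one_pos
  have h3 := isCompact_closure_holder (X := simplex d) (E := Vec d →L[ℝ] Vec d →L[ℝ] Vec d) K
    (NNReal.coe_pos.2 hα)
  refine (h1.prod (h2.prod h3)).totallyBounded.subset fun F hF => ?_
  have hJ : ‖F‖ ≤ K := HolderBall.norm_le ⟨F, hF⟩
  refine ⟨subset_closure ⟨(norm_fst_le F).trans hJ, fun x y => ?_⟩,
    subset_closure ⟨(norm_fst_le F.2).trans ((norm_snd_le F).trans hJ), fun x y => ?_⟩,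
    subset_closure ⟨(norm_snd_le F.2).trans ((norm_snd_le F).trans hJ), fun x y => ?_⟩⟩
  · rw [Real.rpow_one, dist_comm, dist_comm x, dist_eq_norm, Subtype.dist_eq, dist_eq_norm]
    exact hF.1.norm_sub_le (norm_first_le hJ) x y
  · rw [Real.rpow_one, dist_comm, dist_comm x, dist_eq_norm, Subtype.dist_eq, dist_eq_norm]
    exact hF.2.1.norm_sub_le (norm_second_le hJ) x y
  · refine (hF.2.2.1.holderWith.dist_le x y).trans ?_
    have h4 := hF.2.2.2
    have h5 := norm_nonneg F
    gcongr
    linarith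

lemma HolderBall.totallyBounded_univ (hα : 0 < α) :
    TotallyBounded (univ : Set (HolderBall d α K)) := by
  have h := totallyBounded_preimage (f := (Subtype.val : holderSet d α K → Jet d))
    isUniformEmbedding_subtype_val.isUniformInducing (totallyBounded_holderSet (K := K) hα)
  rwa [Subtype.coe_preimage_self] at h

lemma HolderBall.continuous_val : Continuous fun F : HolderBall d α K => F.1 :=
  continuous_subtype_val

/-- A measure with full support charges the balls of a given radius uniformly. -/
lemma exists_le_measureReal_ball {X : Type*} [PseudoMetricSpace X] [MeasurableSpace X]
    (hX : TotallyBounded (univ : Set X)) (m : Measure X) [IsProbabilityMeasure m]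
    [m.IsOpenPosMeasure] {η : ℝ} (hη : 0 < η) : ∃ δ > 0, ∀ x, δ ≤ m.real (Metric.ball x η) := by
  obtain ⟨t, ht, hsub⟩ := Metric.totallyBounded_iff.1 hX (η / 2) (by positivity)
  obtain ⟨x₀⟩ : Nonempty X := nonempty_of_isProbabilityMeasure m
  have hne : t.Nonempty := by
    obtain ⟨y, hy, -⟩ := mem_iUnion₂.1 (hsub (mem_univ x₀))
    exact ⟨y, hy⟩
  obtain ⟨y₀, -, hmin⟩ := Set.exists_min_image t (fun y => m.real (Metric.ball y (η / 2))) ht hne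
  refine ⟨m.real (Metric.ball y₀ (η / 2)), ?_, fun x => ?_⟩
  · exact ENNReal.toReal_pos (Metric.measure_ball_pos m _ (by positivity)).ne' (measure_ne_top _ _)
  · obtain ⟨y, hy, hxy⟩ := mem_iUnion₂.1 (hsub (mem_univ x))
    refine (hmin y hy).trans (measureReal_mono fun z hz => ?_)
    rw [Metric.mem_ball] at hxy hz ⊢
    linarith [dist_triangle z y x, dist_comm x y]

end Compactness

/-! ### The wealth of the universal portfolio -/

section UniversalWealth

variable {d : ℕ} {p q T : ℝ} {S : ℝ → Vec d} {P : ℕ → ℕ → ℝ} {ω : ℝ → ℝ → ℝ}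
  {α : ℝ≥0} {K : ℝ} {m : Measure (HolderBall d α K)}

lemma controlledWealth_eq_expV (hd : 0 < d) (hp : 2 < p) (hp' : p < 3) (hq : p ≤ q)
    (hpq : 1 < 2 / p + 1 / q) (hS : IsPricePath p S P) (hT : 0 ≤ T) :
    (fun F : HolderBall d α K => controlledWealth p q S P F T) = fun F => expV S P F.1 T :=
  funext fun F => controlledWealth_eq hd hp hp' hq hpq hS hT F

lemma bddAbove_controlledWealth (hd : 0 < d) (hp : 2 < p) (hp' : p < 3) (hq : p ≤ q)
    (hpq : 1 < 2 / p + 1 / q) (hS : IsPricePath p S P) (hT : 0 ≤ T) :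
    BddAbove (range fun F : HolderBall d α K => controlledWealth p q S P F T) := by
  have hp0 : 0 < p := by linarith
  obtain ⟨ω, hr⟩ := exists_roughCtl hp0 hS hT
  obtain ⟨B, hB⟩ := exists_expV_le hd hp0 hp' hS hr (J := fun F : HolderBall d α K => F.1)
    HolderBall.isJet HolderBall.norm_le
  rw [controlledWealth_eq_expV hd hp hp' hq hpq hS hT]
  exact ⟨B, forall_mem_range.2 fun F => hB F T ⟨hT, le_rfl⟩⟩

lemma avgV_eq (hd : 0 < d) (hp : 2 < p) (hp' : p < 3) (hq : p ≤ q)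
    (hpq : 1 < 2 / p + 1 / q) (hS : IsPricePath p S P) (hT : 0 ≤ T) :
    avgV S P (fun F : HolderBall d α K => F.1) m T = ∫ F, controlledWealth p q S P F T ∂m := by
  simp only [avgV, wavg, mul_one, expV, controlledWealth_eq hd hp hp' hq hpq hS hT]

variable [IsProbabilityMeasure m]

lemma integrable_controlledWealth (hd : 0 < d) (hp : 2 < p) (hp' : p < 3) (hq : p ≤ q)
    (hpq : 1 < 2 / p + 1 / q) (hS : IsPricePath p S P) (hT : 0 ≤ T) :
    Integrable (fun F : HolderBall d α K => controlledWealth p q S P F T) m := by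
  have hp0 : 0 < p := by linarith
  obtain ⟨ω, hr⟩ := exists_roughCtl hp0 hS hT
  rw [controlledWealth_eq_expV hd hp hp' hq hpq hS hT]
  exact (unifPath_expV hd hp hp' hS hr HolderBall.isJet HolderBall.norm_le
    HolderBall.continuous_val).integrable ⟨hT, le_rfl⟩

lemma integrable_controlledWealth_mul_jval (hd : 0 < d) (hp : 2 < p) (hp' : p < 3) (hq : p ≤ q)
    (hpq : 1 < 2 / p + 1 / q) (hS : IsPricePath p S P) (hT : 0 ≤ T) (i : Fin d) :
    Integrable (fun F : HolderBall d α K =>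
      controlledWealth p q S P F T * jval F.1 i (market S T)) m := by
  have hp0 : 0 < p := by linarith
  obtain ⟨ω, hr⟩ := exists_roughCtl hp0 hS hT
  simp only [controlledWealth_eq hd hp hp' hq hpq hS hT]
  exact ((unifPath_expV hd hp hp' hS hr HolderBall.isJet HolderBall.norm_le
    HolderBall.continuous_val).mul (unifPath_jval hd hp0 hS hr HolderBall.isJet HolderBall.norm_le
    HolderBall.continuous_val i)).integrable ⟨hT, le_rfl⟩

lemma integrable_controlledWealth_smul (hd : 0 < d) (hp : 2 < p) (hp' : p < 3) (hq : p ≤ q)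
    (hpq : 1 < 2 / p + 1 / q) (hS : IsPricePath p S P) (hT : 0 ≤ T) :
    Integrable (fun F : HolderBall d α K =>
      controlledWealth p q S P F T • controlledPortfolio S F T) m := by
  refine Integrable.of_eval_piLp fun i => ?_
  have h1 := integrable_controlledWealth (m := m) hd hp hp' hq hpq hS hT
  have h2 := integrable_controlledWealth_mul_jval (m := m) hd hp hp' hq hpq hS hT
  refine (((h2 i).add h1).sub (integrable_finsetSum Finset.univ fun j _ =>
    (h2 j).const_mul (market S T j))).const_mul (market S T i) |>.congr (.of_forall fun F => ?_)
  simp only [PiLp.smul_apply, smul_eq_mul, controlledPortfolio, HolderBall.eval_apply,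
    Pi.sub_apply, Pi.add_apply, mul_left_comm _ (controlledWealth p q S P F T), ← Finset.mul_sum]
  ring

lemma avgV_holderBall_pos (hd : 0 < d) (hp : 2 < p) (hp' : p < 3) (hS : IsPricePath p S P)
    (hT : 0 ≤ T) : 0 < avgV S P (fun F : HolderBall d α K => F.1) m T := by
  have hp0 : 0 < p := by linarith
  obtain ⟨ω, hr⟩ := exists_roughCtl hp0 hS hT
  exact avgV_pos hd hp hp' hS hr HolderBall.isJet HolderBall.norm_le HolderBall.continuous_val
    ⟨hT, le_rfl⟩

lemma universalPortfolio_eq (hd : 0 < d) (hp : 2 < p) (hp' : p < 3) (hq : p ≤ q)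
    (hpq : 1 < 2 / p + 1 / q) (hS : IsPricePath p S P) (hT : 0 ≤ T) :
    universalPortfolio p q S P m T
      = gen S (avgF S P (fun F : HolderBall d α K => F.1) m) T := by
  have h1 := integrable_controlledWealth (m := m) hd hp hp' hq hpq hS hT
  have h2 := integrable_controlledWealth_mul_jval (m := m) hd hp hp' hq hpq hS hT
  have h3 := integrable_controlledWealth_smul (m := m) hd hp hp' hq hpq hS hT
  have hZ := (avgV_holderBall_pos (m := m) hd hp hp' hS hT).ne'
  rw [avgV_eq hd hp hp' hq hpq hS hT] at hZ
  have h4 : ∀ j, avgF S P (fun F : HolderBall d α K => F.1) m T j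
      = (∫ F, controlledWealth p q S P F T * jval F.1 j (market S T) ∂m)
        * (∫ F, controlledWealth p q S P F T ∂m)⁻¹ := by
    intro j
    simp only [avgF, avgV_eq hd hp hp' hq hpq hS hT, wavg, expV,
      controlledWealth_eq hd hp hp' hq hpq hS hT]
  ext i
  rw [universalPortfolio, PiLp.smul_apply, smul_eq_mul, eval_integral_piLp fun i => h3.eval_piLp i]
  have e1 : ∀ F : HolderBall d α K,
      (controlledWealth p q S P F T • controlledPortfolio S F T) i = market S T i
      * (controlledWealth p q S P F T * jval F.1 i (market S T) + controlledWealth p q S P F T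
        - ∑ j, market S T j * (controlledWealth p q S P F T * jval F.1 j (market S T))) := by
    intro F
    simp only [PiLp.smul_apply, smul_eq_mul, controlledPortfolio, HolderBall.eval_apply,
      mul_left_comm _ (controlledWealth p q S P F T), ← Finset.mul_sum]
    ring
  simp only [e1, gen, h4]
  rw [integral_const_mul, integral_sub (f := fun F => controlledWealth p q S P F T
      * jval F.1 i (market S T) + controlledWealth p q S P F T) ((h2 i).add h1)
    (integrable_finsetSum _ fun j _ => (h2 j).const_mul _), integral_add (h2 i) h1,
    integral_finsetSum _ fun j _ => (h2 j).const_mul _]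
  simp only [integral_const_mul]
  simp only [← mul_assoc, ← Finset.sum_mul]
  field_simp

lemma universalPortfolio_isControlled (hd : 0 < d) (hp : 2 < p) (hp' : p < 3) (hq : p ≤ q)
    (hpq : 1 < 2 / p + 1 / q) (hS : IsPricePath p S P) (hT : 0 ≤ T) :
    ∃ π' : ℝ → Mat d, IsControlled p q T S (universalPortfolio p q S P m) π' := by
  have hp0 : 0 < p := by linarith
  obtain ⟨ω, hr⟩ := exists_roughCtl hp0 hS hT
  choose g' hg' using fun i => avgF_sctl (m := m) hd hp hp' hS hr HolderBall.isJet
    HolderBall.norm_le HolderBall.continuous_val i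
  obtain ⟨π', hπ'⟩ := gen_isControlled hd hp0 hq hS hr hg'
  exact ⟨π', hπ'.congr fun t ht => universalPortfolio_eq hd hp hp' hq hpq hS ht.1⟩

lemma universalPortfolio_isPortfolio (hd : 0 < d) (hp : 2 < p) (hp' : p < 3) (hq : p ≤ q)
    (hpq : 1 < 2 / p + 1 / q) (hS : IsPricePath p S P) :
    IsPortfolio p q S (universalPortfolio p q S P m) := by
  refine ⟨fun t ht => ?_, fun T hT =>
    universalPortfolio_isControlled hd hp hp' hq hpq hS hT.le⟩
  rw [universalPortfolio_eq hd hp hp' hq hpq hS ht]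
  exact gen_sum hd hS _ ht

/-- The relative wealth of the universal portfolio is the average of the relative wealths. -/
theorem relWealth_universalPortfolio (hd : 0 < d) (hp : 2 < p) (hp' : p < 3) (hq : p ≤ q)
    (hpq : 1 < 2 / p + 1 / q) (hS : IsPricePath p S P) (hT : 0 ≤ T) :
    relWealth p q S P (universalPortfolio p q S P m) T
      = ∫ F, controlledWealth p q S P F T ∂m := by
  have hp0 : 0 < p := by linarith
  obtain ⟨ω, hr⟩ := exists_roughCtl hp0 hS hT
  have hc : ContinuousOn (avgF S P (fun F : HolderBall d α K => F.1) m) (Icc 0 T) :=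
    continuousOn_of_coord fun i => by
      obtain ⟨g', hG⟩ := avgF_sctl (m := m) hd hp hp' hS hr HolderBall.isJet
        HolderBall.norm_le HolderBall.continuous_val i
      exact hG.cont
  obtain ⟨ℓ, h1, h2⟩ := relWealth_gen hd hp hp' hq hpq hS hT hc
    (universalPortfolio_isControlled (m := m) hd hp hp' hq hpq hS hT)
    fun t ht => universalPortfolio_eq hd hp hp' hq hpq hS ht.1
  rw [h1, tendsto_nhds_unique h2 (log_avgV_tendsto hd hp hp' hS hT HolderBall.isJet
    HolderBall.norm_le HolderBall.continuous_val),
    Real.exp_log (avgV_holderBall_pos hd hp hp' hS hT), avgV_eq hd hp hp' hq hpq hS hT]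

lemma integral_controlledWealth_pos (hd : 0 < d) (hp : 2 < p) (hp' : p < 3) (hq : p ≤ q)
    (hpq : 1 < 2 / p + 1 / q) (hS : IsPricePath p S P) (hT : 0 ≤ T) :
    0 < ∫ F, controlledWealth p q S P F T ∂m := by
  rw [← avgV_eq hd hp hp' hq hpq hS hT]
  exact avgV_holderBall_pos hd hp hp' hS hT

lemma integral_le_bestWealth (hd : 0 < d) (hp : 2 < p) (hp' : p < 3) (hq : p ≤ q)
    (hpq : 1 < 2 / p + 1 / q) (hS : IsPricePath p S P) (hT : 0 ≤ T) :
    ∫ F, controlledWealth p q S P F T ∂m ≤ bestWealth α K p q S P T := by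
  have h := integral_mono (integrable_controlledWealth (m := m) hd hp hp' hq hpq hS hT)
    (integrable_const (bestWealth α K p q S P T))
    fun F => le_ciSup (bddAbove_controlledWealth hd hp hp' hq hpq hS hT) F
  simpa using h

lemma mul_bestWealth_le (hd : 0 < d) (hp : 2 < p) (hp' : p < 3) (hq : p ≤ q)
    (hpq : 1 < 2 / p + 1 / q) (hS : IsPricePath p S P) (hT : 0 ≤ T) (hK : 0 ≤ K) {η δ : ℝ}
    (hδ : 0 < δ) (hball : ∀ F : HolderBall d α K, δ ≤ m.real (Metric.ball F η)) :
    bestWealth α K p q S P T ≤ (∫ F, controlledWealth p q S P F T ∂m) * δ⁻¹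
      * Real.exp (lipC d p K * η * clock p S P T) := by
  have : Nonempty (HolderBall d α K) := nonempty_of_isProbabilityMeasure m
  have hp0 : 0 < p := by linarith
  refine ciSup_le fun F => ?_
  set c := controlledWealth p q S P F T * Real.exp (-(lipC d p K * η * clock p S P T)) with hc
  have hc0 : 0 < c := by
    rw [hc, controlledWealth_eq hd hp hp' hq hpq hS hT]
    positivity
  have h1 : ∫ G, (Metric.ball F η).indicator (fun _ => c) G ∂m
      ≤ ∫ G, controlledWealth p q S P G T ∂m := by
    refine integral_mono ((integrable_const c).indicator Metric.isOpen_ball.measurableSet)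
      (integrable_controlledWealth hd hp hp' hq hpq hS hT) fun G => ?_
    refine indicator_le' (f := fun _ => c) (g := fun G => controlledWealth p q S P G T)
      (fun G hG => ?_) (fun G _ => ?_) G
    · simp only [hc, controlledWealth_eq hd hp hp' hq hpq hS hT, ← Real.exp_add, Real.exp_le_exp]
      have h2 := abs_logV_sub_le hd hp hp' hS hT F.isJet G.isJet F.norm_le G.norm_le
      rw [HolderBall.norm_sub] at h2
      have h3 : dist F G ≤ η := by rw [dist_comm]; exact (Metric.mem_ball.1 hG).le
      have h4 := lipC_nonneg (d := d) hp0 hp' hK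
      have h5 := clock_nonneg hd hp hp' hS hT
      have h6 : lipC d p K * dist F G * clock p S P T ≤ lipC d p K * η * clock p S P T := by
        gcongr
      linarith [le_abs_self (logV S P F.1 T - logV S P G.1 T)]
    · simp only [controlledWealth_eq hd hp hp' hq hpq hS hT]
      exact (Real.exp_pos _).le
  rw [integral_indicator_const _ Metric.isOpen_ball.measurableSet, smul_eq_mul] at h1
  have h2 := (mul_le_mul_of_nonneg_right (hball F) hc0.le).trans h1
  calc controlledWealth p q S P F T
      = δ * c * δ⁻¹ * Real.exp (lipC d p K * η * clock p S P T) := by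
        rw [hc, Real.exp_neg]
        field_simp
    _ ≤ _ := by gcongr

end UniversalWealth

end RoughPortfolio

open RoughPortfolio

theorem mainTheorem4 (d : ℕ) (p q : ℝ) (hp : 2 < p) (hp' : p < 3) (hq : p ≤ q)
    (hpq : 1 < 2 / p + 1 / q)
    (S : ℝ → Vec d) (P : ℕ → ℕ → ℝ) (hS : IsPricePath p S P)
    (α : ℝ≥0) (hα : 0 < α) (hα' : α ≤ 1) (K : ℝ) (hK : 0 < K)
    (m : Measure (HolderBall d α K)) [IsProbabilityMeasure m] [m.IsOpenPosMeasure]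
    (hclock : Tendsto (fun T => clock p S P T) atTop atTop) :
    (∀ F : HolderBall d α K, IsPortfolio p q S (controlledPortfolio S F)) ∧
    (∀ T : ℝ, 0 ≤ T →
      BddAbove (range fun F : HolderBall d α K => controlledWealth p q S P F T) ∧
      Integrable (fun F : HolderBall d α K => controlledWealth p q S P F T) m ∧
      Integrable (fun F : HolderBall d α K =>
        controlledWealth p q S P F T • controlledPortfolio S F T) m) ∧
    IsPortfolio p q S (universalPortfolio p q S P m) ∧
    Tendsto (fun T => 1 / clock p S P T *
        (Real.log (bestWealth α K p q S P T)
          - Real.log (relWealth p q S P (universalPortfolio p q S P m) T)))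
      atTop (𝓝 0) := by
  have hd : 0 < d := by
    by_contra h0
    obtain rfl : d = 0 := by omega
    obtain ⟨T, hT⟩ := (hclock.eventually_gt_atTop 0).exists
    have hV : ∀ {E : Type} [NormedAddCommGroup E] [Subsingleton E] (r : ℝ), 0 < r →
        ∀ A : ℝ → ℝ → E, pVar r A 0 T = 0 := by
      intro E _ _ r hr A
      have : ∀ s t, A s t = 0 := fun s t => Subsingleton.elim _ _
      simp [pVar, this, ENNReal.zero_rpow_of_pos, hr]
    simp [clock, xi, hV p (by linarith), hV (p / 2) (by linarith)] at hT
  have hp0 : 0 < p := by linarith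
  refine ⟨fun F => controlledPortfolio_isPortfolio hd hp0 hq hS F, fun T hT =>
    ⟨bddAbove_controlledWealth hd hp hp' hq hpq hS hT,
      integrable_controlledWealth hd hp hp' hq hpq hS hT,
      integrable_controlledWealth_smul hd hp hp' hq hpq hS hT⟩,
    universalPortfolio_isPortfolio hd hp hp' hq hpq hS, ?_⟩
  refine Metric.tendsto_nhds.2 fun ε hε => ?_
  have hC := lipC_nonneg (d := d) hp0 hp' hK.le
  set C := lipC d p K
  obtain ⟨δ, hδ, hball⟩ := exists_le_measureReal_ball (HolderBall.totallyBounded_univ hα) m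
    (η := ε / (2 * (C + 1))) (by positivity)
  filter_upwards [eventually_ge_atTop 0, hclock.eventually_gt_atTop 0,
    hclock.eventually_gt_atTop (2 * -Real.log δ / ε)] with T hT h1 h2
  have hpos := integral_controlledWealth_pos (m := m) hd hp hp' hq hpq hS hT
  have hle := integral_le_bestWealth (m := m) hd hp hp' hq hpq hS hT
  have hbest := mul_bestWealth_le hd hp hp' hq hpq hS hT hK.le hδ hball
  have hlog := Real.log_le_log (hpos.trans_le hle) hbest
  rw [Real.log_mul (by positivity) (Real.exp_pos _).ne', Real.log_exp,
    Real.log_mul hpos.ne' (inv_pos.2 hδ).ne', Real.log_inv] at hlog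
  have hlog' := Real.log_le_log hpos hle
  rw [relWealth_universalPortfolio hd hp hp' hq hpq hS hT, dist_zero_right, Real.norm_of_nonneg
    (mul_nonneg (by positivity) (sub_nonneg.2 hlog')), one_div_mul_eq_div, div_lt_iff₀ h1]
  rw [div_lt_iff₀ hε] at h2
  have h3 : C * (ε / (2 * (C + 1))) ≤ ε / 2 := by
    rw [← mul_div_assoc, div_le_div_iff₀ (by positivity) two_pos]
    nlinarith
  have h4 := mul_le_mul_of_nonneg_right h3 h1.le
  linarith
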